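/- Let $\mathcal M$ be a (Hausdorff) smooth manifold of dimension $d\ge 2$ with a dualistic structure $(g,\nabla,\nabla^*)$: $g=\langle\cdot,\cdot\rangle$ is a smooth Riemannian metric and $\nabla,\nabla^*$ are smooth torsion-free affine connections with $Z\langle X,Y\rangle=\langle\nabla_ZX,Y\rangle+\langle X,\nabla^*_ZY\rangle$ for all smooth vector fields $X,Y,Z$. Assume that both $\nabla$ and $\nabla^*$ are projectively flat, i.e. for each of them, denoted $D$, there are a flat torsion-free connection $\widetilde D$ (vanishing curvature tensor) and a $1$-form $\tau$ on $\mathcal M$ with $D_XY=\widetilde D_XY+\tau(X)Y+\tau(Y)X$ for all smooth $X,Y$. A connection with curvature tensor $R(X,Y)Z=\nabla_X\nabla_YZ-\nabla_Y\nabla_XZ-\nabla_{[X,Y]}Z$ has constant sectional curvature $k$ if $R(X,Y)Z=k(\langle Y,Z\rangle X-\langle X,Z\rangle Y)$ for all smooth $X,Y,Z$. Let $\alpha>0$. For a function $f$ on a convex open set $\Omega\subset\mathbb R^d$, we say that $f$ is $\alpha$-exponentially concave (convex) if $e^{\alpha f}$ is concave (convex) on $\Omega$. Suppose that $\nabla$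 and $\nabla^*$ both have constant sectional curvature $-\alpha$. Then every point of $\mathcal M$ has an open neighbourhood $U$ with smooth coordinate systems $\xi=(\xi^1,\dots,\xi^d)$ and $\eta=(\eta^1,\dots,\eta^d)$ on $U$, both with convex image in $\mathbb R^d$, such that: (i) every $\nabla$-geodesic in $U$ is a straight line in the coordinates $\xi$ up to a time reparametrization, that is, $\xi(\gamma(t))=a+h(t)v$ with $a,v\in\mathbb R^d$ and $h$ smooth with $h'>0$; likewise every $\nabla^*$-geodesic in $U$ is a straight line in the coordinates $\eta$ up to a time reparametrization; (ii) $1+\alpha\sum_{\ell=1}^d\xi^\ell\eta^\ell>0$ on $U$; (iii) there are smooth $\alpha$-exponentially concave functions $\varphi$ on $\xi(U)$ and $\psi$ on $\eta(U)$ such that, at every point of $U$ with coordinates $\xi$ and $\eta$, $$\varphi(\xi)+\psi(\eta)=\frac1\alpha\log\Bigl(1+\alpha\sum_{\ell=1}^d\xi^\ell\eta^\ell\Bigr);$$ (iv) in the coordinates $\xi$ and $\eta$ respectively, the coefficients of the metric $g$ are $$g_{ij}(\xi)=-\frac{\partial^2\varphi}{\partial\xi^i\partial\xi^j}(\xi)-\alpha\frac{\partial\varphi}{\partial\xi^i}(\xi)\frac{\partial\varphi}{\partial\xi^j}(\xi),\qquad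 g_{ij}(\eta)=-\frac{\partial^2\psi}{\partial\eta^i\partial\eta^j}(\eta)-\alpha\frac{\partial\psi}{\partial\eta^i}(\eta)\frac{\partial\psi}{\partial\eta^j}(\eta).$$ If instead $\nabla$ and $\nabla^*$ both have constant sectional curvature $+\alpha$, then the same conclusion holds with (i) and (ii) unchanged, with $\varphi$ and $\psi$ in (iii) $\alpha$-exponentially convex (and the same identity), and with (iv) replaced by $$g_{ij}(\xi)=\frac{\partial^2\varphi}{\partial\xi^i\partial\xi^j}+\alpha\frac{\partial\varphi}{\partial\xi^i}\frac{\partial\varphi}{\partial\xi^j},\qquad g_{ij}(\eta)=\frac{\partial^2\psi}{\partial\eta^i\partial\eta^j}+\alpha\frac{\partial\psi}{\partial\eta^i}\frac{\partial\psi}{\partial\eta^j}.$$ -/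

import Mathlib

open scoped Manifold ContDiff

noncomputable section

namespace InfoGeo

/-! Throughout, a `d`-dimensional smooth manifold `M` is modelled on `EuclideanSpace ℝ (Fin d)`
through the boundaryless model `𝓡 d`. -/

section Connections

variable {d : ℕ} {M : Type*} [TopologicalSpace M] [ChartedSpace (EuclideanSpace ℝ (Fin d)) M]
  [IsManifold (𝓡 d) ∞ M]

/-- Smooth (globally defined) vector fields. -/
def IsSmoothField (X : ∀ x : M, TangentSpace (𝓡 d) x) : Prop :=
  ContMDiff (𝓡 d) (𝓡 d).tangent ∞ (fun x ↦ (⟨x, X x⟩ : TangentBundle (𝓡 d) M))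

variable (d M) in
/-- Affine connections (not necessarily smooth or torsion-free). The vector field `∇_X Y` is
`fun x ↦ nabla Y x (X x)`. -/
abbrev AffineConnection : Type _ :=
  CovariantDerivative (𝓡 d) (EuclideanSpace ℝ (Fin d)) (TangentSpace (𝓡 d) : M → Type _)

/-- The vector field `∇_X Y`. -/
def AffineConnection.along (nabla : AffineConnection d M) (X Y : ∀ x : M, TangentSpace (𝓡 d) x) :
    ∀ x : M, TangentSpace (𝓡 d) x :=
  fun x ↦ nabla Y x (X x)

/-- The curvature `R(X, Y) Z = ∇_X ∇_Y Z - ∇_Y ∇_X Z - ∇_{[X, Y]} Z`. -/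
def AffineConnection.curvature (nabla : AffineConnection d M)
    (X Y Z : ∀ x : M, TangentSpace (𝓡 d) x) : ∀ x : M, TangentSpace (𝓡 d) x :=
  nabla.along X (nabla.along Y Z) - nabla.along Y (nabla.along X Z)
    - nabla.along (VectorField.mlieBracket (𝓡 d) X Y) Z

/-- A connection is flat if its curvature tensor vanishes. -/
def AffineConnection.IsFlat (nabla : AffineConnection d M) : Prop :=
  ∀ X Y Z : ∀ x : M, TangentSpace (𝓡 d) x,
    IsSmoothField X → IsSmoothField Y → IsSmoothField Z → nabla.curvature X Y Z = 0

/-- Smooth torsion-free connections. -/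
structure AffineConnection.IsSmoothTorsionFree (nabla : AffineConnection d M) : Prop where
  smooth : CovariantDerivative.ContMDiffCovariantDerivative nabla ∞
  torsion_eq_zero : nabla.torsion = 0

/-- Projective equivalence: there is a smooth `1`-form `τ` such that
`∇_X Y = ∇'_X Y + τ(X) Y + τ(Y) X` for all smooth vector fields `X`, `Y`. -/
def AffineConnection.ProjectivelyEquivalent (nabla nabla' : AffineConnection d M) : Prop :=
  ∃ τ : ∀ x : M, TangentSpace (𝓡 d) x →L[ℝ] ℝ,
    ContMDiff (𝓡 d) ((𝓡 d).prod 𝓘(ℝ, EuclideanSpace ℝ (Fin d) →L[ℝ] ℝ)) ∞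
      (fun x ↦ Bundle.TotalSpace.mk' (EuclideanSpace ℝ (Fin d) →L[ℝ] ℝ)
        (E := fun x : M ↦ TangentSpace (𝓡 d) x →L[ℝ] ℝ) x (τ x)) ∧
    ∀ X Y : ∀ x : M, TangentSpace (𝓡 d) x, IsSmoothField X → IsSmoothField Y →
      ∀ x, nabla.along X Y x = nabla'.along X Y x + τ x (X x) • Y x + τ x (Y x) • X x

/-- A connection is projectively flat if it is projectively equivalent to a
flat (smooth torsion-free) connection. -/
def AffineConnection.IsProjectivelyFlat (nabla : AffineConnection d M) : Prop :=
  ∃ nabla' : AffineConnection d M,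
    nabla'.IsSmoothTorsionFree ∧ nabla'.IsFlat ∧ nabla.ProjectivelyEquivalent nabla'

variable (d M) in
/-- Smooth Riemannian metrics. -/
abbrev RiemMetric : Type _ :=
  Bundle.ContMDiffRiemannianMetric (𝓡 d) ∞ (EuclideanSpace ℝ (Fin d))
    (TangentSpace (𝓡 d) : M → Type _)

/-- Constant sectional curvature `k` with respect to `g`:
`R(X, Y) Z = k (⟨Y, Z⟩ X - ⟨X, Z⟩ Y)` for all smooth vector fields. -/
def AffineConnection.HasConstantCurvature (nabla : AffineConnection d M) (g : RiemMetric d M)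
    (k : ℝ) : Prop :=
  ∀ X Y Z : ∀ x : M, TangentSpace (𝓡 d) x,
    IsSmoothField X → IsSmoothField Y → IsSmoothField Z →
      ∀ x, nabla.curvature X Y Z x
        = k • (g.inner x (Y x) (Z x) • X x - g.inner x (X x) (Z x) • Y x)

variable (d M) in
/-- A dualistic structure `(g, ∇, ∇*)` on `M`: a Riemannian metric and two torsion-free
connections which are dual with respect to it, that is
`Z ⟨X, Y⟩ = ⟨∇_Z X, Y⟩ + ⟨X, ∇*_Z Y⟩` for all smooth vector fields. -/
structure StatisticalStructure where
  g : RiemMetric d M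
  primal : AffineConnection d M
  dual : AffineConnection d M
  primal_smooth_torsionFree : primal.IsSmoothTorsionFree
  dual_smooth_torsionFree : dual.IsSmoothTorsionFree
  duality : ∀ X Y Z : ∀ x : M, TangentSpace (𝓡 d) x,
    IsSmoothField X → IsSmoothField Y → IsSmoothField Z →
      ∀ x : M, mvfderiv (𝓡 d) (fun y ↦ g.inner y (X y) (Y y)) x (Z x)
        = g.inner x (primal.along Z X x) (Y x) + g.inner x (X x) (dual.along Z Y x)

end Connections

section Coordinates

variable {d : ℕ} {M : Type*} [TopologicalSpace M] [ChartedSpace (EuclideanSpace ℝ (Fin d)) M]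
  [IsManifold (𝓡 d) ∞ M]

/-- For a chart `e` and a vector `v` of the coordinate space, the vector field (on the domain of
`e`) whose representation in the coordinates `e` is constantly `v`. For `v` the `i`-th standard
basis vector this is the coordinate vector field `∂/∂eⁱ`. -/
def coordField (e : OpenPartialHomeomorph M (EuclideanSpace ℝ (Fin d)))
    (v : EuclideanSpace ℝ (Fin d)) : ∀ x : M, TangentSpace (𝓡 d) x :=
  fun x ↦ (mvfderiv (𝓡 d) e x).inverse v

/-- The Christoffel symbols in the coordinates `e` as a bilinear expression: the coordinate
representation at `x` of `∇_U V`, where `U`, `V` have constant coordinate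
representations `u`, `v`; its `k`-th component is `∑ i j, uⁱ vʲ Γᵢⱼᵏ`. -/
def AffineConnection.christoffel (nabla : AffineConnection d M)
    (e : OpenPartialHomeomorph M (EuclideanSpace ℝ (Fin d))) (x : M)
    (u v : EuclideanSpace ℝ (Fin d)) : EuclideanSpace ℝ (Fin d) :=
  mvfderiv (𝓡 d) e x
    (nabla.along (coordField e u) (coordField e v) x)

/-- A smooth curve `γ` on a nondegenerate interval `J` is a geodesic if it satisfies the geodesic
equation `ẍᵏ + ẋⁱ ẋʲ Γᵢⱼᵏ = 0` in every smooth coordinate system. Only the values of `γ`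
on `J` matter. -/
structure AffineConnection.IsGeodesicOn (nabla : AffineConnection d M) (γ : ℝ → M)
    (J : Set ℝ) : Prop where
  ordConnected : J.OrdConnected
  nontrivial : J.Nontrivial
  smooth : ContMDiffOn 𝓘(ℝ, ℝ) (𝓡 d) ∞ γ J
  equation : ∀ t ∈ J, ∀ e ∈ IsManifold.maximalAtlas (𝓡 d) ∞ M, γ t ∈ e.source →
    derivWithin (derivWithin (fun s ↦ e (γ s)) J) J t
      + nabla.christoffel e (γ t) (derivWithin (fun s ↦ e (γ s)) J t)
          (derivWithin (fun s ↦ e (γ s)) J t) = 0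

/-- On the interval `J` the curve `c` is a straight line up to a smooth time
reparametrization `h` with positive derivative. -/
def IsReparametrizedLineOn (c : ℝ → EuclideanSpace ℝ (Fin d)) (J : Set ℝ) : Prop :=
  ∃ (a v : EuclideanSpace ℝ (Fin d)) (h : ℝ → ℝ),
    ContDiffOn ℝ ∞ h J ∧ (∀ t ∈ J, 0 < derivWithin h J t) ∧ ∀ t ∈ J, c t = a + h t • v

/-- Every geodesic of `nabla` running in the domain of the chart `e` is, in the
coordinates `e`, a straight line up to time reparametrization. -/
def AffineConnection.GeodesicsAreLinesIn (nabla : AffineConnection d M)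
    (e : OpenPartialHomeomorph M (EuclideanSpace ℝ (Fin d))) : Prop :=
  ∀ (γ : ℝ → M) (J : Set ℝ), nabla.IsGeodesicOn γ J → (∀ t ∈ J, γ t ∈ e.source) →
    IsReparametrizedLineOn (fun t ↦ e (γ t)) J

/-- The coefficient `gᵢⱼ = ⟨∂/∂eⁱ, ∂/∂eʲ⟩` of the metric in the coordinates `e`, at `x`. -/
def metricCoeff (g : RiemMetric d M)
    (e : OpenPartialHomeomorph M (EuclideanSpace ℝ (Fin d))) (x : M) (i j : Fin d) : ℝ :=
  g.inner x (coordField e (EuclideanSpace.single i 1) x)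
    (coordField e (EuclideanSpace.single j 1) x)

/-- The partial derivative `∂f/∂yⁱ`. -/
def pderiv (i : Fin d) (f : EuclideanSpace ℝ (Fin d) → ℝ) (y : EuclideanSpace ℝ (Fin d)) : ℝ :=
  fderiv ℝ f y (EuclideanSpace.single i 1)

/-- The entries of `D²f + α (Df)(Df)ᵀ` at `y`. -/
def expHessian (α : ℝ) (f : EuclideanSpace ℝ (Fin d) → ℝ) (y : EuclideanSpace ℝ (Fin d))
    (i j : Fin d) : ℝ :=
  pderiv i (pderiv j f) y + α * pderiv i f y * pderiv j f y

/-- `f` is `α`-exponentially concave on the convex set `Ω`: `exp (α f)` is concave on `Ω`.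
(`ConcaveOn` contains the convexity of `Ω`.) -/
def ExpConcaveOn (α : ℝ) (Ω : Set (EuclideanSpace ℝ (Fin d)))
    (f : EuclideanSpace ℝ (Fin d) → ℝ) : Prop :=
  ConcaveOn ℝ Ω (fun y ↦ Real.exp (α * f y))

/-- `f` is `α`-exponentially convex on the convex set `Ω`: `exp (α f)` is convex on `Ω`.
(`ConvexOn` contains the convexity of `Ω`.) -/
def ExpConvexOn (α : ℝ) (Ω : Set (EuclideanSpace ℝ (Fin d)))
    (f : EuclideanSpace ℝ (Fin d) → ℝ) : Prop :=
  ConvexOn ℝ Ω (fun y ↦ Real.exp (α * f y))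

end Coordinates

end InfoGeo

end

/-! Let k be the curvature, -α or α. The overdetermined equation ∇df = -k g f is a linear total
differential system for the 1-jet (f, df). Its integrability condition is the curvature equation
together with the total symmetry of ∇g, and that symmetry follows from duality and the vanishing of
both torsions (`codazzi_of_dual`). The Frobenius theorem for linear systems
(`exists_total_solution`) therefore yields local solutions with any initial 1-jet
(`exists_hessian_solution`).

Take a solution f = (p, q) with values in ℝ × ℝ^d for which the frame (f, df) is the identity at the
base point, and let h be the functional with h(f) = 1 and h(df) = 0. Differentiating these relations
and using duality shows that h solves the corresponding equation ∇*dh = -k g h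
(`dual_hessian_equation`). Write h as the pair (p', αq') and put ξ = q/p, η = q'/p', φ = -(1/α) log
p, ψ = -(1/α) log p'. Then h(f) = 1 reads p p' + α q·q' = 1, that is 1 + α ξ·η = 1/(p p'), which
gives both the positivity and the identity for φ + ψ.

In the coordinates ξ, with l denoting p, both l and l ξ solve the Hessian equation. Comparing the
two (`hessian_homogeneous`) gives l Γ(u, v) = dl(u) v + dl(v) u, so geodesics are reparametrized
lines, and D²(1/l) = k g / l. As e^{αφ} = 1/l, this gives exponential concavity or convexity
according to the sign of k; the companion identity for D²l gives the metric formula. The same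
argument applies to η and ψ.

For convex images, the common domain is the preimage of a small ball under ξ. Its image under η is a
sublevel set of ‖ξ ∘ η⁻¹‖², which is convex near its nondegenerate zero (`exists_convex_charts`). -/

open scoped Manifold ContDiff

noncomputable section

set_option linter.unusedSectionVars false
namespace InfoGeo

/-! ### Calculus on rays: smooth dependence on the endpoint, and the Volterra operator. -/

section LinearSystems

open Set Filter Topology

variable {E V W : Type} [NormedAddCommGroup E] [NormedSpace ℝ E]
  [NormedAddCommGroup V] [NormedSpace ℝ V] [NormedAddCommGroup W] [NormedSpace ℝ W]

/-- The restriction of `f` to the segment from `0` to `x`, parametrized by the unit interval. -/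
def rayMap (f : C(E, W)) (x : E) : C(unitInterval, W) :=
  ⟨fun s ↦ f ((s : ℝ) • x), by fun_prop⟩

@[simp] lemma rayMap_apply (f : C(E, W)) (x : E) (s : unitInterval) :
    rayMap f x s = f ((s : ℝ) • x) := rfl

lemma continuous_rayMap (f : C(E, W)) : Continuous (rayMap f) := by
  refine (ContinuousMap.curry ⟨fun p : E × unitInterval ↦ f ((p.2 : ℝ) • p.1), ?_⟩).continuous
  fun_prop

/-- Evaluation of a family of linear maps on the unit interval at the multiples `ρ s • v` of a
vector. -/
def rayEval (ρ : C(unitInterval, unitInterval)) : C(unitInterval, E →L[ℝ] W) →L[ℝ] E →L[ℝ] C(unitInterval, W) :=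
  LinearMap.mkContinuous₂
    (LinearMap.mk₂ ℝ (fun (a : C(unitInterval, E →L[ℝ] W)) (v : E) ↦
        (⟨fun s ↦ a s ((ρ s : ℝ) • v), by fun_prop⟩ : C(unitInterval, W)))
      (fun a b v ↦ by ext; simp) (fun c a v ↦ by ext; simp [smul_comm c])
      (fun a v w ↦ by ext; simp) (fun c a v ↦ by ext s; simp [smul_comm c (ρ s : ℝ)])) 1
    (fun a v ↦ by
      rw [one_mul, ContinuousMap.norm_le _ (by positivity)]
      intro s
      refine ((a s).le_opNorm _).trans ?_
      rw [norm_smul]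
      have h1 : ‖(ρ s : ℝ)‖ ≤ 1 := by
        rw [Real.norm_eq_abs, abs_of_nonneg (ρ s).2.1]; exact (ρ s).2.2
      have h2 : ‖(ρ s : ℝ)‖ * ‖v‖ ≤ ‖v‖ := mul_le_of_le_one_left (norm_nonneg _) h1
      exact mul_le_mul (a.norm_coe_le_norm s) h2 (by positivity) (norm_nonneg a))

@[simp] lemma rayEval_apply (ρ : C(unitInterval, unitInterval))
    (a : C(unitInterval, E →L[ℝ] W)) (v : E) (s : unitInterval) :
    rayEval ρ a v s = a s ((ρ s : ℝ) • v) := rfl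

/-- The remainder is small uniformly in s because x ↦ `rayMap f' x` is continuous for the sup norm.
The mean value inequality on the segment from s x to s(x + v), whose points are s(x + t v), turns
this into the required little-o bound. -/
lemma hasFDerivAt_rayMap (f : C(E, W)) (f' : C(E, E →L[ℝ] W))
    (hf : ∀ x, HasFDerivAt f (f' x) x) (x : E) :
    HasFDerivAt (rayMap f) (rayEval (.id _) (rayMap f' x)) x := by
  rw [hasFDerivAt_iff_isLittleO_nhds_zero, Asymptotics.isLittleO_iff]
  intro ε hε
  have hc := (continuous_rayMap f').tendsto x
  rw [Metric.tendsto_nhds_nhds] at hc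
  obtain ⟨δ, hδ, H⟩ := hc ε hε
  filter_upwards [Metric.ball_mem_nhds (0 : E) hδ] with v hv
  rw [ContinuousMap.norm_le _ (by positivity)]
  intro s
  have hs : ‖(s : ℝ)‖ ≤ 1 := by
    rw [Real.norm_eq_abs, abs_of_nonneg s.2.1]; exact s.2.2
  have key : ‖f ((s : ℝ) • x + (s : ℝ) • v) - f ((s : ℝ) • x)
      - f' ((s : ℝ) • x) (((s : ℝ) • x + (s : ℝ) • v) - (s : ℝ) • x)‖
      ≤ ε * ‖((s : ℝ) • x + (s : ℝ) • v) - (s : ℝ) • x‖ := by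
    refine (convex_segment ((s : ℝ) • x) ((s : ℝ) • x + (s : ℝ) • v)).norm_image_sub_le_of_norm_hasFDerivWithin_le'
      (fun y _ ↦ (hf y).hasFDerivWithinAt) ?_ (left_mem_segment _ _ _) (right_mem_segment _ _ _)
    intro y hy
    rw [segment_eq_image'] at hy
    obtain ⟨t, ht, rfl⟩ := hy
    have h1 : dist (x + t • v) x < δ := by
      rw [dist_eq_norm, add_sub_cancel_left, norm_smul, Real.norm_eq_abs, abs_of_nonneg ht.1]
      have : ‖v‖ < δ := by simpa using hv
      exact (mul_le_of_le_one_left (norm_nonneg _) ht.2).trans_lt this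
    have h2 := (ContinuousMap.dist_apply_le_dist (f := rayMap f' (x + t • v))
      (g := rayMap f' x) s).trans (H h1).le
    rw [dist_eq_norm] at h2
    beta_reduce
    rwa [show (s : ℝ) • x + t • ((s : ℝ) • x + (s : ℝ) • v - (s : ℝ) • x)
      = (s : ℝ) • (x + t • v) by rw [add_sub_cancel_left, smul_add, smul_comm t]]
  have e : ((s : ℝ) • x + (s : ℝ) • v) - (s : ℝ) • x = (s : ℝ) • v := by abel
  rw [e] at key
  have h3 : ‖(s : ℝ) • v‖ ≤ ‖v‖ := by
    rw [norm_smul]; exact mul_le_of_le_one_left (norm_nonneg _) hs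
  calc _ = ‖f ((s : ℝ) • x + (s : ℝ) • v) - f ((s : ℝ) • x) - f' ((s : ℝ) • x) ((s : ℝ) • v)‖ := by
        simp [smul_add]
    _ ≤ ε * ‖(s : ℝ) • v‖ := key
    _ ≤ _ := by gcongr

/-- The derivative of `rayMap f` is a fixed continuous linear map applied to `rayMap f'`, with f'
the derivative of f. Induction on the order, with the target space varying, does the rest. -/
lemma contDiff_rayMap (f : C(E, W)) (hf : ContDiff ℝ ∞ f) : ContDiff ℝ ∞ (rayMap f) := by
  rw [contDiff_infty] at *
  intro n
  induction n generalizing W with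
  | zero => exact contDiff_zero.2 (continuous_rayMap f)
  | succ n ih =>
    have hf1 : ContDiff ℝ (0 + 1) f := by simpa using hf 1
    have hd : ∀ x, HasFDerivAt f (fderiv ℝ f x) x := fun x ↦
      ((hf1.differentiable (by simp)) x).hasFDerivAt
    let f' : C(E, E →L[ℝ] W) := ⟨fderiv ℝ f, (contDiff_succ_iff_fderiv.1 hf1).2.2.continuous⟩
    have hD := hasFDerivAt_rayMap f f' hd
    rw [Nat.cast_succ, contDiff_succ_iff_fderiv]
    refine ⟨fun x ↦ (hD x).differentiableAt, by simp, ?_⟩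
    rw [show fderiv ℝ (rayMap f) = fun x ↦ rayEval (.id _) (rayMap f' x) from
      funext fun x ↦ (hD x).fderiv]
    have hL : ContDiff ℝ n (fun a : C(unitInterval, E →L[ℝ] W) ↦ rayEval (.id _) a) := by
      fun_prop
    refine hL.comp (ih f' fun m ↦ ?_)
    have := hf (m + 1)
    rw [Nat.cast_succ, contDiff_succ_iff_fderiv] at this
    exact this.2.2

/-- The operator `(a, S) ↦ (t ↦ ∫ s in 0..t, a s (S s))` on the unit interval. -/
def volterra : C(unitInterval, V →L[ℝ] V) →L[ℝ] C(unitInterval, V) →L[ℝ] C(unitInterval, V) :=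
  -- `projIcc` extends the integrand continuously to all of ℝ, so that interval integrals and their
  -- derivatives are available.
  have hc : ∀ (a : C(unitInterval, V →L[ℝ] V)) (S : C(unitInterval, V)),
      Continuous fun s : ℝ ↦ a (projIcc 0 1 zero_le_one s) (S (projIcc 0 1 zero_le_one s)) := by
    intro a S; fun_prop
  have hi : ∀ (a : C(unitInterval, V →L[ℝ] V)) (S : C(unitInterval, V)) (p q : ℝ),
      IntervalIntegrable (fun s : ℝ ↦ a (projIcc 0 1 zero_le_one s) (S (projIcc 0 1 zero_le_one s)))
        MeasureTheory.volume p q := fun a S p q ↦ (hc a S).intervalIntegrable p q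
  LinearMap.mkContinuous₂
    (LinearMap.mk₂ ℝ (fun a S ↦ (⟨fun t ↦ ∫ s in (0 : ℝ)..t,
        a (projIcc 0 1 zero_le_one s) (S (projIcc 0 1 zero_le_one s)),
        (intervalIntegral.continuous_primitive (hi a S) 0).comp continuous_subtype_val⟩ :
          C(unitInterval, V)))
      (fun a b S ↦ by
        ext t; simpa using intervalIntegral.integral_add (hi a S 0 t) (hi b S 0 t))
      (fun c a S ↦ by ext t; simp)
      (fun a S T ↦ by
        ext t; simpa using intervalIntegral.integral_add (hi a S 0 t) (hi a T 0 t))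
      (fun c a S ↦ by ext t; simp)) 1
    (fun a S ↦ by
      rw [one_mul, ContinuousMap.norm_le _ (by positivity)]
      intro t
      have := intervalIntegral.norm_integral_le_of_norm_le_const (a := (0 : ℝ)) (b := t)
        (f := fun s : ℝ ↦ a (projIcc 0 1 zero_le_one s) (S (projIcc 0 1 zero_le_one s)))
        (C := ‖a‖ * ‖S‖) (fun s _ ↦ ((a _).le_opNorm _).trans
          (mul_le_mul (a.norm_coe_le_norm _) (S.norm_coe_le_norm _) (norm_nonneg _)
            (norm_nonneg a)))
      refine this.trans (mul_le_of_le_one_right (by positivity) ?_)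
      rw [sub_zero, abs_of_nonneg t.2.1]; exact t.2.2)

lemma volterra_apply (a : C(unitInterval, V →L[ℝ] V)) (S : C(unitInterval, V))
    (t : unitInterval) : volterra a S t = ∫ s in (0 : ℝ)..t,
      a (projIcc 0 1 zero_le_one s) (S (projIcc 0 1 zero_le_one s)) := rfl

end LinearSystems

end InfoGeo
namespace InfoGeo

/-! ### Solving a linear system along rays from the origin. -/

section LinearSystems

open Set Filter Topology

variable {E V W : Type} [NormedAddCommGroup E] [NormedSpace ℝ E]
  [NormedAddCommGroup V] [NormedSpace ℝ V] [NormedAddCommGroup W] [NormedSpace ℝ W]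

/-- Multiplication by a bump function. It provides globally defined coefficients, which the ray
construction needs. -/
lemma exists_contDiff_eventuallyEq [FiniteDimensional ℝ E] {A : E → W} {U : Set E}
    (hU : U ∈ 𝓝 (0 : E)) (hA : ContDiffOn ℝ ∞ A U) :
    ∃ A' : E → W, ContDiff ℝ ∞ A' ∧ A' =ᶠ[𝓝 0] A := by
  obtain ⟨ε, hε, hεU⟩ := Metric.mem_nhds_iff.1 hU
  let f : ContDiffBump (0 : E) := ⟨ε / 4, ε / 2, by positivity, by linarith⟩
  refine ⟨fun x ↦ f x • A x, contDiff_iff_contDiffAt.2 fun x ↦ ?_, ?_⟩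
  · by_cases hx : x ∈ Metric.ball (0 : E) ε
    · exact f.contDiff.contDiffAt.smul
        ((hA.mono hεU).contDiffAt (Metric.isOpen_ball.mem_nhds hx))
    · have h0 : x ∉ tsupport f := by
        rw [f.tsupport_eq]
        simp only [Metric.mem_ball, dist_zero_right, not_lt, Metric.mem_closedBall, not_le] at hx ⊢
        change ε / 2 < ‖x‖
        linarith
      have h1 : (fun x ↦ f x • A x) =ᶠ[𝓝 x] fun _ ↦ 0 := by
        filter_upwards [notMem_tsupport_iff_eventuallyEq.1 h0] with y hy
        simp [hy]
      exact contDiffAt_const.congr_of_eventuallyEq h1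
  · filter_upwards [f.eventuallyEq_one] with x hx
    simp [hx]

/-- Since K 0 = 0, the operator 1 - K x is invertible for x near 0, and (1 - K x)⁻¹ c depends
smoothly on x because inversion in a Banach algebra is smooth. -/
lemma exists_contDiffOn_fixedPoint {X : Type} [NormedAddCommGroup X] [NormedSpace ℝ X]
    [CompleteSpace X] {K : E → X →L[ℝ] X} (hK : ContDiff ℝ ∞ K) (hK0 : K 0 = 0) (c : X) :
    ∃ (s : E → X) (r : ℝ), 0 < r ∧ ContDiffOn ℝ ∞ s (Metric.ball 0 r) ∧
      ∀ x ∈ Metric.ball (0 : E) r, s x = c + K x (s x) ∧ ∀ T, T = c + K x T → T = s x := by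
  have hunit : ∀ᶠ x in 𝓝 (0 : E), IsUnit (1 - K x) := by
    have hc : ContinuousAt (fun x ↦ 1 - K x) 0 := (continuous_const.sub hK.continuous).continuousAt
    refine hc.eventually (Units.isOpen.mem_nhds ?_)
    simp [hK0]
  obtain ⟨r, hr, hball⟩ := Metric.eventually_nhds_iff_ball.1 hunit
  refine ⟨fun x ↦ Ring.inverse (1 - K x) c, r, hr, ?_, fun x hx ↦ ⟨?_, ?_⟩⟩
  · intro x hx
    obtain ⟨u, hu⟩ := hball x hx
    have h1 : ContDiffAt ℝ ∞ (fun x ↦ Ring.inverse (1 - K x)) x := by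
      have h := contDiffAt_ringInverse ℝ (n := ∞) u
      rw [hu] at h
      exact h.comp x (contDiff_const.sub hK).contDiffAt
    exact (h1.clm_apply contDiffAt_const).contDiffWithinAt
  · have h1 : ((1 - K x) * Ring.inverse (1 - K x)) c = c := by
      rw [Ring.mul_inverse_cancel _ (hball x hx)]; rfl
    rw [← sub_eq_iff_eq_add]
    exact h1
  · intro T hT
    have h1 : (1 - K x) T = c := by
      rw [← sub_eq_iff_eq_add] at hT
      exact hT
    have h2 : (Ring.inverse (1 - K x) * (1 - K x)) T = T := by
      rw [Ring.inverse_mul_cancel _ (hball x hx)]; rfl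
    rw [← h2, ← h1]; rfl

/-- On the ray t ↦ t x the system is a linear ODE, equivalently a Volterra equation with x as a
smooth parameter and with kernel zero at x = 0. The value of its solution at time 1 defines S(x), so
smoothness in x comes from the fixed-point lemma rather than from ODE theory. -/
lemma exists_radial_solution [CompleteSpace V] (A : C(E, E →L[ℝ] V →L[ℝ] V)) (hA : ContDiff ℝ ∞ A)
    (S₀ : V) : ∃ (S : E → V) (r : ℝ), 0 < r ∧ S 0 = S₀ ∧ ContDiffOn ℝ ∞ S (Metric.ball 0 r) ∧
      ∀ x ∈ Metric.ball (0 : E) r, fderiv ℝ S x x = A x x (S x) := by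
  let K : E → C(unitInterval, V) →L[ℝ] C(unitInterval, V) := fun x ↦
    volterra (rayEval (.const _ 1) (rayMap A x) x)
  have hK : ContDiff ℝ ∞ K := by
    have h1 := contDiff_rayMap (W := E →L[ℝ] V →L[ℝ] V) A hA
    have h2 : ContDiff ℝ ∞ fun x ↦ rayEval (.const _ 1) (rayMap A x) := by fun_prop
    have h3 : ContDiff ℝ ∞ fun x ↦ rayEval (.const _ 1) (rayMap A x) x := h2.clm_apply contDiff_id
    fun_prop
  have hK0 : K 0 = 0 := by simp [K]
  obtain ⟨s, r, hr, hs, hsK⟩ := exists_contDiffOn_fixedPoint hK hK0 (.const _ S₀)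
  have heq : ∀ x ∈ Metric.ball (0 : E) r, ∀ t, s x t = S₀ + K x (s x) t := fun x hx t ↦
    congrArg (fun f : C(unitInterval, V) ↦ f t) (hsK x hx).1
  have huniq : ∀ x ∈ Metric.ball (0 : E) r, ∀ T : C(unitInterval, V),
      (∀ t, T t = S₀ + K x T t) → T = s x := fun x hx T hT ↦
    (hsK x hx).2 T (ContinuousMap.ext hT)
  have hKapp : ∀ x T t, K x T t = ∫ τ in (0 : ℝ)..t,
      A ((projIcc 0 1 zero_le_one τ : ℝ) • x) x (T (projIcc 0 1 zero_le_one τ)) := by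
    intro x T t
    simp [K, volterra_apply]
  -- By the change of variables τ ↦ t τ, the rescaled path u ↦ s x (t u) solves the Volterra
  -- equation at t x; uniqueness identifies it with s (t x).
  have hscale : ∀ x ∈ Metric.ball (0 : E) r, ∀ t : unitInterval, s ((t : ℝ) • x) 1 = s x t := by
    intro x hx t
    have hx' : (t : ℝ) • x ∈ Metric.ball (0 : E) r := by
      simp only [Metric.mem_ball, dist_zero_right, norm_smul, Real.norm_eq_abs,
        abs_of_nonneg t.2.1] at hx ⊢
      exact (mul_le_of_le_one_left (norm_nonneg _) t.2.2).trans_lt hx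
    let T : C(unitInterval, V) := ⟨fun u ↦ s x (t * u), by fun_prop⟩
    have := huniq _ hx' T fun u ↦ by
      change s x (t * u) = _
      rw [heq x hx, hKapp, hKapp]
      congr 1
      have hcv := intervalIntegral.smul_integral_comp_mul_left (a := 0) (b := (u : ℝ))
        (fun τ : ℝ ↦ A ((projIcc 0 1 zero_le_one τ : ℝ) • x) x (s x (projIcc 0 1 zero_le_one τ)))
        (t : ℝ)
      rw [mul_zero] at hcv
      rw [show ((t * u : unitInterval) : ℝ) = (t : ℝ) * u from rfl, ← hcv,
        ← intervalIntegral.integral_smul]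
      refine intervalIntegral.integral_congr fun τ hτ ↦ ?_
      rw [uIcc_of_le u.2.1] at hτ
      have hτ1 : τ ∈ Icc (0 : ℝ) 1 := ⟨hτ.1, hτ.2.trans u.2.2⟩
      have hτ2 : (t : ℝ) * τ ∈ Icc (0 : ℝ) 1 := unitInterval.mul_mem t.2 hτ1
      simp only [projIcc_of_mem zero_le_one hτ1, projIcc_of_mem zero_le_one hτ2, map_smul,
        smul_smul, T, ContinuousMap.coe_mk, mul_comm τ]
      rfl
    rw [← this]
    simp [T]
  refine ⟨fun x ↦ s x 1, r, hr, ?_, ?_, ?_⟩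
  · have h1 := heq 0 (Metric.mem_ball_self hr) 1
    simpa [hK0] using h1
  · exact (ContinuousMap.evalCLM ℝ (1 : unitInterval)).contDiff.comp_contDiffOn hs
  · intro y hy
    -- The scaling identity only covers times in [0, 1], so y is written as t x with t interior;
    -- this gives a two-sided derivative along the ray.
    obtain ⟨t, ht0, ht1, hty⟩ : ∃ t : ℝ, 0 < t ∧ t < 1 ∧ t⁻¹ • y ∈ Metric.ball (0 : E) r := by
      have h1 : ContinuousAt (fun t : ℝ ↦ t⁻¹ • y) 1 :=
        (continuousAt_inv₀ one_ne_zero).smul continuousAt_const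
      have h2 : ∀ᶠ t : ℝ in 𝓝 1, t⁻¹ • y ∈ Metric.ball (0 : E) r :=
        h1.eventually (Metric.isOpen_ball.mem_nhds (by simpa using hy))
      have h3 : ∀ᶠ t : ℝ in 𝓝[<] 1, 0 < t ∧ t < 1 ∧ t⁻¹ • y ∈ Metric.ball (0 : E) r := by
        filter_upwards [nhdsWithin_le_nhds h2, self_mem_nhdsWithin,
          nhdsWithin_le_nhds (lt_mem_nhds (zero_lt_one (α := ℝ)))] with t a b c
        exact ⟨c, b, a⟩
      exact h3.exists
    set x := t⁻¹ • y with hxdef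
    have hyx : y = t • x := by rw [hxdef, smul_smul, mul_inv_cancel₀ ht0.ne', one_smul]
    have hmem : t ∈ Icc (0 : ℝ) 1 := ⟨ht0.le, ht1.le⟩
    let g : ℝ → V := fun τ ↦ A ((projIcc 0 1 zero_le_one τ : ℝ) • x) x
      (s x (projIcc 0 1 zero_le_one τ))
    have hg : Continuous g := by fun_prop
    have hd : HasDerivAt (fun τ ↦ S₀ + ∫ u in (0 : ℝ)..τ, g u) (g t) t :=
      (hg.integral_hasStrictDerivAt 0 t).hasDerivAt.const_add S₀
    have hev : (fun τ : ℝ ↦ s (τ • x) 1) =ᶠ[𝓝 t] fun τ ↦ S₀ + ∫ u in (0 : ℝ)..τ, g u := by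
      filter_upwards [Icc_mem_nhds ht0 ht1] with τ hτ
      rw [hscale x hty ⟨τ, hτ⟩, heq x hty, hKapp]
    have hd1 := hd.congr_of_eventuallyEq hev
    have hsd : DifferentiableAt ℝ (fun x ↦ s x 1) (t • x) := by
      rw [← hyx]
      exact (((ContinuousMap.evalCLM ℝ (1 : unitInterval)).contDiff.comp_contDiffOn
        hs).contDiffAt (Metric.isOpen_ball.mem_nhds hy)).differentiableAt (by simp)
    have hd2 : HasDerivAt (fun τ : ℝ ↦ s (τ • x) 1) (fderiv ℝ (fun x ↦ s x 1) (t • x) x) t := by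
      have h1 : HasDerivAt (fun τ : ℝ ↦ τ • x) x t := by
        simpa using (hasDerivAt_id t).smul_const x
      exact hsd.hasFDerivAt.comp_hasDerivAt t h1
    have h := hd2.unique hd1
    simp only [g, projIcc_of_mem zero_le_one hmem, ← hscale x hty ⟨t, hmem⟩] at h
    conv_lhs => rw [hyx, map_smul, h]
    conv_rhs => rw [hyx, map_smul]
    rfl

end LinearSystems

end InfoGeo
namespace InfoGeo

/-! ### From radial solutions to total solutions: the Frobenius theorem. -/

section LinearSystems

open Set Filter Topology

variable {E V W : Type} [NormedAddCommGroup E] [NormedSpace ℝ E]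
  [NormedAddCommGroup V] [NormedSpace ℝ V] [NormedAddCommGroup W] [NormedSpace ℝ W]

lemma two_le_infty : (2 : ℕ∞ω) ≤ ∞ := by
  rw [show (2 : ℕ∞ω) = ((2 : ℕ∞) : ℕ∞ω) from rfl]
  exact WithTop.coe_le_coe.2 le_top

/-- A radial solution of a linear total differential system with vanishing curvature is a
solution. -/
lemma fderiv_eq_of_radial {A : E → E →L[ℝ] V →L[ℝ] V} {S : E → V} {r : ℝ}
    (hA : ContDiffOn ℝ ∞ A (Metric.ball 0 r)) (hS : ContDiffOn ℝ ∞ S (Metric.ball 0 r))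
    (hflat : ∀ x ∈ Metric.ball (0 : E) r, ∀ u v w,
      fderiv ℝ A x u v w + A x v (A x u w) = fderiv ℝ A x v u w + A x u (A x v w))
    (hrad : ∀ x ∈ Metric.ball (0 : E) r, fderiv ℝ S x x = A x x (S x))
    {x : E} (hx : x ∈ Metric.ball (0 : E) r) (v : E) : fderiv ℝ S x v = A x v (S x) := by
  have hAd : ∀ y ∈ Metric.ball (0 : E) r, HasFDerivAt A (fderiv ℝ A y) y := fun y hy ↦
    ((hA.contDiffAt (Metric.isOpen_ball.mem_nhds hy)).differentiableAt (by simp)).hasFDerivAt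
  have hSc : ∀ y ∈ Metric.ball (0 : E) r, ContDiffAt ℝ ∞ S y := fun y hy ↦
    hS.contDiffAt (Metric.isOpen_ball.mem_nhds hy)
  have hSd : ∀ y ∈ Metric.ball (0 : E) r, HasFDerivAt S (fderiv ℝ S y) y := fun y hy ↦
    ((hSc y hy).differentiableAt (by simp)).hasFDerivAt
  have hSdd : ∀ y ∈ Metric.ball (0 : E) r,
      HasFDerivAt (fderiv ℝ S) (fderiv ℝ (fderiv ℝ S) y) y := fun y hy ↦
    (((hSc y hy).fderiv_right (m := 1) two_le_infty).differentiableAt (by simp)).hasFDerivAt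
  -- Differentiate the radial equation in the direction v and use the symmetry of the second
  -- derivative of S.
  have hdiff : ∀ y ∈ Metric.ball (0 : E) r, ∀ v,
      fderiv ℝ (fderiv ℝ S) y y v + fderiv ℝ S y v
        = fderiv ℝ A y v y (S y) + A y v (S y) + A y y (fderiv ℝ S y v) := by
    intro y hy v
    have h1 := ((hSdd y hy).clm_apply (hasFDerivAt_id y))
    have h2 := ((hAd y hy).clm_apply (hasFDerivAt_id y)).clm_apply (hSd y hy)
    have h3 : (fun z ↦ fderiv ℝ S z (id z)) =ᶠ[𝓝 y] fun z ↦ A z (id z) (S z) := by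
      filter_upwards [Metric.isOpen_ball.mem_nhds hy] with z hz
      exact hrad z hz
    have h4 := congrArg (fun L : E →L[ℝ] V ↦ L v) (h1.unique (h2.congr_of_eventuallyEq h3))
    have hsymm := ((hSc y hy).isSymmSndFDerivAt (by simpa using two_le_infty)) y v
    simp at h4
    rw [hsymm, add_comm, h4]
    abel
  -- The defect of the total equation along the ray. The factor t gives D(0) = 0 and absorbs the
  -- extra term dS(v) from `hdiff`; with flatness, D satisfies the homogeneous linear ODE D' = A(t
  -- x)(x) D.
  let D : ℝ → V := fun t ↦ t • (fderiv ℝ S (t • x) v - A (t • x) v (S (t • x)))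
  have hmem : ∀ t ∈ Icc (0 : ℝ) 1, t • x ∈ Metric.ball (0 : E) r := by
    intro t ht
    simp only [Metric.mem_ball, dist_zero_right, norm_smul, Real.norm_eq_abs,
      abs_of_nonneg ht.1] at hx ⊢
    exact (mul_le_of_le_one_left (norm_nonneg _) ht.2).trans_lt hx
  have hD : ∀ t ∈ Icc (0 : ℝ) 1, HasDerivAt D (A (t • x) x (D t)) t := by
    intro t ht
    have hy := hmem t ht
    have h0 : HasDerivAt (fun τ : ℝ ↦ τ • x) x t := by
      simpa using (hasDerivAt_id t).smul_const x
    have hS1 : HasDerivAt (fun τ : ℝ ↦ S (τ • x)) (fderiv ℝ S (t • x) x) t :=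
      (hSd _ hy).comp_hasDerivAt t h0
    have hS2 : HasDerivAt (fun τ : ℝ ↦ fderiv ℝ S (τ • x))
        (fderiv ℝ (fderiv ℝ S) (t • x) x) t := (hSdd _ hy).comp_hasDerivAt t h0
    have hA1 : HasDerivAt (fun τ : ℝ ↦ A (τ • x)) (fderiv ℝ A (t • x) x) t :=
      HasFDerivAt.comp_hasDerivAt (E := E →L[ℝ] V →L[ℝ] V) t (hAd _ hy) h0
    have h1 := hS2.clm_apply (hasDerivAt_const t v)
    have h2 := (hA1.clm_apply (hasDerivAt_const t v)).clm_apply hS1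
    have h3 := (hasDerivAt_id t).smul (h1.sub h2)
    refine HasDerivAt.congr_deriv (f := D) h3 ?_
    have e1 := hdiff _ hy v
    have e2 := hflat _ hy (t • x) v (S (t • x))
    have e3 := hrad _ hy
    simp only [map_smul, smul_apply] at e1 e2 e3
    simp only [id, map_zero, add_zero, one_smul, D, map_smul, map_sub,
      smul_sub, smul_add, Pi.sub_apply]
    rw [← map_smul (A (t • x) v) t, e3]
    simp only [map_smul]
    rw [eq_sub_of_add_eq e1, eq_sub_of_add_eq e2]
    abel
  have hcA : ContinuousOn (fun t : ℝ ↦ A (t • x) x) (Icc 0 1) := by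
    have h1 : ContinuousOn (fun t : ℝ ↦ A (t • x)) (Icc 0 1) :=
      hA.continuousOn.comp (by fun_prop) fun t ht ↦ hmem t ht
    exact h1.clm_apply continuousOn_const
  obtain ⟨C, hC⟩ := isCompact_Icc.exists_bound_of_continuousOn hcA
  -- Gronwall forces D = 0 on [0, 1]; its value at t = 1 is the equation sought.
  have h0 := eq_zero_of_abs_deriv_le_mul_abs_self_of_eq_zero_right (f := D)
    (f' := fun t ↦ A (t • x) x (D t)) (K := C) (a := 0) (b := 1)
    (fun t ht ↦ (hD t ht).continuousAt.continuousWithinAt)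
    (fun t ht ↦ (hD t ⟨ht.1, ht.2.le⟩).hasDerivWithinAt) (by simp [D])
    (fun t ht ↦ (ContinuousLinearMap.le_opNorm _ _).trans
      (mul_le_mul_of_nonneg_right (hC t ⟨ht.1, ht.2.le⟩) (norm_nonneg _)))
    1 (right_mem_Icc.2 zero_le_one)
  simpa [D, sub_eq_zero] using h0

/-- The Frobenius theorem for linear total differential systems. -/
theorem exists_total_solution [FiniteDimensional ℝ E] [CompleteSpace V]
    {A : E → E →L[ℝ] V →L[ℝ] V} {U : Set E} (hU : U ∈ 𝓝 (0 : E)) (hA : ContDiffOn ℝ ∞ A U)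
    (hflat : ∀ x ∈ U, ∀ u v w,
      fderiv ℝ A x u v w + A x v (A x u w) = fderiv ℝ A x v u w + A x u (A x v w)) (S₀ : V) :
    ∃ (S : E → V) (r : ℝ), 0 < r ∧ Metric.ball 0 r ⊆ U ∧ S 0 = S₀ ∧
      ContDiffOn ℝ ∞ S (Metric.ball 0 r) ∧
      ∀ x ∈ Metric.ball (0 : E) r, ∀ v, fderiv ℝ S x v = A x v (S x) := by
  obtain ⟨A', hA', hAA'⟩ := exists_contDiff_eventuallyEq hU hA
  obtain ⟨S, ρ, hρ, hS0, hS, hrad⟩ := exists_radial_solution ⟨A', hA'.continuous⟩ hA' S₀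
  obtain ⟨ε, hε, hball⟩ := Metric.eventually_nhds_iff_ball.1 (hAA'.eventually_nhds.and hU)
  have h1 : Metric.ball (0 : E) (min ρ ε) ⊆ Metric.ball 0 ρ := Metric.ball_subset_ball (min_le_left _ _)
  have h2 : Metric.ball (0 : E) (min ρ ε) ⊆ Metric.ball 0 ε :=
    Metric.ball_subset_ball (min_le_right _ _)
  have hU' : Metric.ball (0 : E) (min ρ ε) ⊆ U := fun x hx ↦ (hball x (h2 hx)).2
  refine ⟨S, min ρ ε, lt_min hρ hε, hU', hS0, hS.mono h1, fun x hx v ↦ ?_⟩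
  refine fderiv_eq_of_radial (hA.mono hU') (hS.mono h1) (fun x hx ↦ hflat x (hU' hx))
    (fun y hy ↦ ?_) hx v
  have h3 : A' y = A y := Eventually.self_of_nhds (p := fun z ↦ A' z = A z) (hball y (h2 hy)).1
  rw [hrad y (h1 hy), ← h3]
  rfl

end LinearSystems

end InfoGeo
namespace InfoGeo

/-! ### The Hessian equation ∇df = -k g f as a linear system on 1-jets. -/

section HessianEquation

open Set Filter Topology

lemma fderiv_add_comp_apply {E Y P Q : Type} [NormedAddCommGroup E] [NormedSpace ℝ E]
    [NormedAddCommGroup Y] [NormedSpace ℝ Y]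
    [NormedAddCommGroup P] [NormedSpace ℝ P] [NormedAddCommGroup Q] [NormedSpace ℝ Q]
    (L₀ : E →L[ℝ] Y) (L₁ : P →L[ℝ] Y) (L₂ : Q →L[ℝ] Y)
    {Γ : E → E →L[ℝ] P} {G : E → E →L[ℝ] Q} {Γ' : E →L[ℝ] E →L[ℝ] P} {G' : E →L[ℝ] E →L[ℝ] Q}
    {x : E} (hΓ : HasFDerivAt Γ Γ' x) (hG : HasFDerivAt G G' x) (u v : E) :
    fderiv ℝ (fun x ↦ L₀ + L₁ ∘L Γ x + L₂ ∘L G x) x u v = L₁ (Γ' u v) + L₂ (G' u v) := by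
  have h1 := (((hasFDerivAt_const L₁ x).clm_comp hΓ).const_add L₀).add
    ((hasFDerivAt_const L₂ x).clm_comp hG)
  rw [HasFDerivAt.fderiv (f := fun x ↦ L₀ + L₁ ∘L Γ x + L₂ ∘L G x) h1]
  simp

/-- The Frobenius theorem for a coefficient depending affinely on Γ and G, with integrability stated
through their own derivatives. This is the shape of the 1-jet system below. -/
lemma exists_total_solution_of_comp {E V P Q : Type} [NormedAddCommGroup E] [NormedSpace ℝ E]
    [FiniteDimensional ℝ E] [NormedAddCommGroup V] [NormedSpace ℝ V] [CompleteSpace V]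
    [NormedAddCommGroup P] [NormedSpace ℝ P] [NormedAddCommGroup Q] [NormedSpace ℝ Q]
    (L₀ : E →L[ℝ] V →L[ℝ] V) (L₁ : P →L[ℝ] V →L[ℝ] V) (L₂ : Q →L[ℝ] V →L[ℝ] V)
    {Γ : E → E →L[ℝ] P} {G : E → E →L[ℝ] Q} {U : Set E} (hU : IsOpen U) (h0 : 0 ∈ U)
    (hΓ : ContDiffOn ℝ ∞ Γ U) (hG : ContDiffOn ℝ ∞ G U)
    (hflat : ∀ x ∈ U, ∀ u v w,
      L₁ (fderiv ℝ Γ x u v) w + L₂ (fderiv ℝ G x u v) w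
          + (L₀ v + L₁ (Γ x v) + L₂ (G x v)) ((L₀ u + L₁ (Γ x u) + L₂ (G x u)) w)
        = L₁ (fderiv ℝ Γ x v u) w + L₂ (fderiv ℝ G x v u) w
          + (L₀ u + L₁ (Γ x u) + L₂ (G x u)) ((L₀ v + L₁ (Γ x v) + L₂ (G x v)) w))
    (S₀ : V) :
    ∃ (S : E → V) (r : ℝ), 0 < r ∧ Metric.ball 0 r ⊆ U ∧ S 0 = S₀ ∧
      ContDiffOn ℝ ∞ S (Metric.ball 0 r) ∧
      ∀ x ∈ Metric.ball (0 : E) r, ∀ v,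
        fderiv ℝ S x v = (L₀ v + L₁ (Γ x v) + L₂ (G x v)) (S x) := by
  refine exists_total_solution (A := fun x ↦ L₀ + L₁ ∘L Γ x + L₂ ∘L G x) (hU.mem_nhds h0)
    ((contDiffOn_const.add (contDiffOn_const.clm_comp hΓ)).add (contDiffOn_const.clm_comp hG))
    (fun x hx u v w ↦ ?_) S₀
  have hΓ' := ((hΓ.contDiffAt (hU.mem_nhds hx)).differentiableAt (by simp)).hasFDerivAt
  have hG' := ((hG.contDiffAt (hU.mem_nhds hx)).differentiableAt (by simp)).hasFDerivAt
  rw [fderiv_add_comp_apply L₀ L₁ L₂ hΓ' hG', fderiv_add_comp_apply L₀ L₁ L₂ hΓ' hG']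
  exact hflat x hx u v w

variable {E F : Type} [NormedAddCommGroup E] [NormedSpace ℝ E] [FiniteDimensional ℝ E]
  [NormedAddCommGroup F] [NormedSpace ℝ F] [FiniteDimensional ℝ F]

/-- The operator `(s, ω) ↦ (ω u, 0)`. -/
def jetEval : E →L[ℝ] (F × (E →L[ℝ] F)) →L[ℝ] F × (E →L[ℝ] F) :=
  LinearMap.toContinuousLinearMap
    { toFun := fun u ↦ ContinuousLinearMap.inl ℝ F (E →L[ℝ] F) ∘L
        ContinuousLinearMap.apply ℝ F u ∘L ContinuousLinearMap.snd ℝ F (E →L[ℝ] F)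
      map_add' := fun u v ↦ by ext p <;> simp
      map_smul' := fun c u ↦ by ext p <;> simp }

lemma jetEval_apply (u : E) (p : F × (E →L[ℝ] F)) : jetEval u p = (p.2 u, 0) := rfl

/-- The operator `(s, ω) ↦ (0, ω ∘ T)`. -/
def jetComp : (E →L[ℝ] E) →L[ℝ] (F × (E →L[ℝ] F)) →L[ℝ] F × (E →L[ℝ] F) :=
  LinearMap.toContinuousLinearMap
    { toFun := fun T ↦ LinearMap.toContinuousLinearMap
        { toFun := fun p ↦ (0, p.2 ∘L T)
          map_add' := fun p q ↦ by ext <;> simp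
          map_smul' := fun c p ↦ by ext <;> simp }
      map_add' := fun u v ↦ by ext p <;> simp
      map_smul' := fun c u ↦ by ext p <;> simp }

lemma jetComp_apply (T : E →L[ℝ] E) (p : F × (E →L[ℝ] F)) : jetComp T p = (0, p.2 ∘L T) := rfl

/-- The operator `(s, ω) ↦ (0, g ⊗ s)`. -/
def jetSMul : (E →L[ℝ] ℝ) →L[ℝ] (F × (E →L[ℝ] F)) →L[ℝ] F × (E →L[ℝ] F) :=
  LinearMap.toContinuousLinearMap
    { toFun := fun g ↦ LinearMap.toContinuousLinearMap
        { toFun := fun p ↦ (0, g.smulRight p.1)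
          map_add' := fun p q ↦ by ext <;> simp
          map_smul' := fun c p ↦ by ext <;> simp [smul_comm c] }
      map_add' := fun u v ↦ by ext p <;> simp [add_smul]
      map_smul' := fun c u ↦ by ext p <;> simp [mul_smul] }

lemma jetSMul_apply (g : E →L[ℝ] ℝ) (p : F × (E →L[ℝ] F)) :
    jetSMul g p = (0, g.smulRight p.1) := rfl

/-- Local solutions of `∇df = -k g f` with values in `F` and arbitrary initial data, for a
torsion-free connection with Christoffel symbols `Γ` of constant curvature `k` such that
`∇g` is totally symmetric. -/
theorem exists_hessian_solution {k : ℝ} {Γ : E → E →L[ℝ] E →L[ℝ] E} {G : E → E →L[ℝ] E →L[ℝ] ℝ}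
    {U : Set E} (hU : IsOpen U) (h0 : 0 ∈ U)
    (hΓ : ContDiffOn ℝ ∞ Γ U) (hG : ContDiffOn ℝ ∞ G U)
    (hΓsymm : ∀ x ∈ U, ∀ u v, Γ x u v = Γ x v u) (hGsymm : ∀ x ∈ U, ∀ u v, G x u v = G x v u)
    (hcodazzi : ∀ x ∈ U, ∀ u v w, fderiv ℝ G x w u v + G x w (Γ x u v)
      = fderiv ℝ G x u w v + G x u (Γ x w v))
    (hcurv : ∀ x ∈ U, ∀ u v w, fderiv ℝ Γ x u v w - fderiv ℝ Γ x v u w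
      + Γ x u (Γ x v w) - Γ x v (Γ x u w) = k • (G x v w • u - G x u w • v))
    (f₀ : F) (ω₀ : E →L[ℝ] F) :
    ∃ (f : E → F) (r : ℝ), 0 < r ∧ Metric.ball 0 r ⊆ U ∧ f 0 = f₀ ∧ fderiv ℝ f 0 = ω₀ ∧
      ContDiffOn ℝ ∞ f (Metric.ball 0 r) ∧
      ∀ x ∈ Metric.ball (0 : E) r, ∀ u v,
        fderiv ℝ (fderiv ℝ f) x u v = fderiv ℝ f x (Γ x u v) - (k * G x u v) • f x := by
  -- The system for S = (s, ω) is ds = ω, dω = ω ∘ Γ - k G ⊗ s. In the integrability condition, the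
  -- first component needs only the symmetry of Γ and G. In the second, the terms in ω are the
  -- curvature equation and the terms in s are the Codazzi equation.
  obtain ⟨S, r, hr, hrU, hS0, hS, hSd⟩ := exists_total_solution_of_comp
    (V := F × (E →L[ℝ] F)) jetEval jetComp (-k • jetSMul) hU h0 hΓ hG (fun x hx u v p ↦ by
      refine Prod.ext ?_ ?_
      · simp [jetEval_apply, jetComp_apply, jetSMul_apply, hΓsymm x hx u v, hGsymm x hx u v]
      · ext w
        have h1 := hcodazzi x hx u w v
        have h2 := congrArg p.2 (hcurv x hx u v w)
        simp only [map_add, map_sub, map_smul] at h2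
        have h3 := congrArg (fun c : ℝ ↦ k • c • p.1) h1
        simp only [smul_add, add_smul, smul_sub] at h2 h3
        simp only [jetEval_apply, jetComp_apply, jetSMul_apply, smul_apply, add_apply,
          Prod.snd_add, Prod.fst_add, Prod.smul_snd, Prod.smul_fst, ContinuousLinearMap.comp_apply,
          ContinuousLinearMap.smulRight_apply, neg_smul, Prod.snd_neg,
          Prod.fst_neg, neg_apply, smul_zero, neg_zero, add_zero, zero_add]
        linear_combination (norm := module) h2 + h3)
    (f₀, ω₀)
  have hball : IsOpen (Metric.ball (0 : E) r) := Metric.isOpen_ball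
  have hd : ∀ x ∈ Metric.ball (0 : E) r, HasFDerivAt S (fderiv ℝ S x) x := fun x hx ↦
    ((hS.contDiffAt (hball.mem_nhds hx)).differentiableAt (by simp)).hasFDerivAt
  have hf : ∀ x ∈ Metric.ball (0 : E) r, fderiv ℝ (fun x ↦ (S x).1) x = (S x).2 := by
    intro x hx
    rw [(hd x hx).fst.fderiv]
    ext v
    simp [hSd x hx v, jetEval_apply, jetComp_apply, jetSMul_apply]
  refine ⟨fun x ↦ (S x).1, r, hr, hrU, by simp [hS0], ?_, hS.fst, fun x hx u v ↦ ?_⟩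
  · rw [hf 0 (Metric.mem_ball_self hr), hS0]
  · have h1 : fderiv ℝ (fun x ↦ (S x).1) =ᶠ[𝓝 x] fun x ↦ (S x).2 := by
      filter_upwards [hball.mem_nhds hx] with y hy using hf y hy
    rw [h1.fderiv_eq, hf x hx, (hd x hx).snd.fderiv]
    simp [hSd x hx u, mul_smul, jetEval_apply, jetComp_apply, jetSMul_apply, sub_eq_add_neg]

end HessianEquation

end InfoGeo
namespace InfoGeo

/-! ### The dual functional and the Hessian equation of the dual connection. -/

section DualSolution

open Set Filter Topology

variable {E F : Type} [NormedAddCommGroup E] [NormedSpace ℝ E]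
  [NormedAddCommGroup F] [NormedSpace ℝ F]

/-- Differentiating the relations `h(f) = 1` and `h(df) = 0`, one obtains from a solution `f` of
the Hessian equation for `Γ` a solution `h` of the Hessian equation for the dual connection. -/
theorem dual_hessian_equation {k : ℝ} {Γ Γ' : E → E →L[ℝ] E →L[ℝ] E} {G : E → E →L[ℝ] E →L[ℝ] ℝ}
    {U : Set E} (hU : IsOpen U) (hG : ContDiffOn ℝ ∞ G U)
    (hGsymm : ∀ x ∈ U, ∀ u v, G x u v = G x v u)
    (hdual : ∀ x ∈ U, ∀ u v w, fderiv ℝ G x w u v = G x (Γ x w u) v + G x u (Γ' x w v))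
    {f : E → F} (hf : ContDiffOn ℝ ∞ f U)
    (hfΓ : ∀ x ∈ U, ∀ u v,
      fderiv ℝ (fderiv ℝ f) x u v = fderiv ℝ f x (Γ x u v) - (k * G x u v) • f x)
    {h : E → F →L[ℝ] ℝ} (hh : ContDiffOn ℝ ∞ h U)
    (h_f : ∀ x ∈ U, h x (f x) = 1) (h_df : ∀ x ∈ U, ∀ u, h x (fderiv ℝ f x u) = 0)
    (hframe : ∀ x ∈ U, ∀ m : F →L[ℝ] ℝ, m (f x) = 0 → (∀ u, m (fderiv ℝ f x u) = 0) → m = 0) :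
    ∀ x ∈ U, (∀ v, fderiv ℝ h x v (f x) = 0) ∧
      (∀ u v, fderiv ℝ h x v (fderiv ℝ f x u) = k * G x u v) ∧
      ∀ w v, fderiv ℝ (fderiv ℝ h) x w v = fderiv ℝ h x (Γ' x w v) - (k * G x w v) • h x := by
  have hfd : ∀ x ∈ U, HasFDerivAt f (fderiv ℝ f x) x := fun x hx ↦
    ((hf.contDiffAt (hU.mem_nhds hx)).differentiableAt (by simp)).hasFDerivAt
  have hfdd : ∀ x ∈ U, HasFDerivAt (fderiv ℝ f) (fderiv ℝ (fderiv ℝ f) x) x := fun x hx ↦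
    (((hf.contDiffAt (hU.mem_nhds hx)).fderiv_right (m := 1) two_le_infty).differentiableAt
      (by simp)).hasFDerivAt
  have hhd : ∀ x ∈ U, HasFDerivAt h (fderiv ℝ h x) x := fun x hx ↦
    ((hh.contDiffAt (hU.mem_nhds hx)).differentiableAt (by simp)).hasFDerivAt
  have hhdd : ∀ x ∈ U, HasFDerivAt (fderiv ℝ h) (fderiv ℝ (fderiv ℝ h) x) x := fun x hx ↦
    (((hh.contDiffAt (hU.mem_nhds hx)).fderiv_right (m := 1) two_le_infty).differentiableAt
      (by simp)).hasFDerivAt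
  have hGd : ∀ x ∈ U, HasFDerivAt G (fderiv ℝ G x) x := fun x hx ↦
    ((hG.contDiffAt (hU.mem_nhds hx)).differentiableAt (by simp)).hasFDerivAt
  have hfd_apply : ∀ x ∈ U, ∀ u, HasFDerivAt (fun y ↦ fderiv ℝ f y u)
      ((fderiv ℝ (fderiv ℝ f) x).flip u) x := fun x hx u ↦ by
    simpa using (hfdd x hx).clm_apply (hasFDerivAt_const u x)
  have hhd_apply : ∀ x ∈ U, ∀ u, HasFDerivAt (fun y ↦ fderiv ℝ h y u)
      ((fderiv ℝ (fderiv ℝ h) x).flip u) x := fun x hx u ↦ by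
    simpa using (hhdd x hx).clm_apply (hasFDerivAt_const u x)
  have hGd_apply : ∀ x ∈ U, ∀ u v w, fderiv ℝ (fun y ↦ k * G y u v) x w
      = k * fderiv ℝ G x w u v := fun x hx u v w ↦ by
    have h1 := (((hGd x hx).clm_apply (hasFDerivAt_const u x)).clm_apply
      (hasFDerivAt_const v x)).const_mul k
    rw [h1.fderiv]
    simp
  -- Differentiate h(f) = 1 and use h(df) = 0.
  have h1 : ∀ x ∈ U, ∀ v, fderiv ℝ h x v (f x) = 0 := by
    intro x hx v
    have e1 := (hhd x hx).clm_apply (hfd x hx)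
    have e2 : (fun y ↦ h y (f y)) =ᶠ[𝓝 x] fun _ ↦ 1 := by
      filter_upwards [hU.mem_nhds hx] with y hy using h_f y hy
    have e3 := congrArg (fun L : E →L[ℝ] ℝ ↦ L v) (e1.fderiv.symm.trans e2.fderiv_eq)
    simpa [h_df x hx] using e3
  -- Differentiate h(df u) = 0: in the Hessian of f, the functional h kills the df part and sees
  -- only -k G f.
  have h2 : ∀ x ∈ U, ∀ u v, fderiv ℝ h x v (fderiv ℝ f x u) = k * G x u v := by
    intro x hx u v
    have e1 := (hhd x hx).clm_apply (hfd_apply x hx u)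
    have e2 : (fun y ↦ h y (fderiv ℝ f y u)) =ᶠ[𝓝 x] fun _ ↦ 0 := by
      filter_upwards [hU.mem_nhds hx] with y hy using h_df y hy u
    have e3 := congrArg (fun L : E →L[ℝ] ℝ ↦ L v) (e1.fderiv.symm.trans e2.fderiv_eq)
    simp [hfΓ x hx, h_df x hx, h_f x hx] at e3
    rw [hGsymm x hx u v]
    linarith
  refine fun x hx ↦ ⟨h1 x hx, h2 x hx, fun w v ↦ ?_⟩
  rw [← sub_eq_zero]
  -- The two sides are functionals, so they are compared on the frame f, df u by differentiating
  -- `h1` and `h2`. On df u the left side contains k ∂G; duality splits it, its Γ part cancels, and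
  -- the part with Γ' remains.
  refine hframe x hx _ ?_ fun u ↦ ?_
  · have e1 := (hhd_apply x hx v).clm_apply (hfd x hx)
    have e2 : (fun y ↦ fderiv ℝ h y v (f y)) =ᶠ[𝓝 x] fun _ ↦ 0 := by
      filter_upwards [hU.mem_nhds hx] with y hy using h1 y hy v
    have e3 := congrArg (fun L : E →L[ℝ] ℝ ↦ L w) (e1.fderiv.symm.trans e2.fderiv_eq)
    simp [h2 x hx] at e3
    simp [h1 x hx, h_f x hx]
    linarith
  · have e1 := (hhd_apply x hx v).clm_apply (hfd_apply x hx u)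
    have e2 : (fun y ↦ fderiv ℝ h y v (fderiv ℝ f y u)) =ᶠ[𝓝 x] fun y ↦ k * G y u v := by
      filter_upwards [hU.mem_nhds hx] with y hy using h2 y hy u v
    have e3 := congrArg (fun L : E →L[ℝ] ℝ ↦ L w) (e1.fderiv.symm.trans e2.fderiv_eq)
    rw [hGd_apply x hx, hdual x hx] at e3
    simp [h2 x hx, hfΓ x hx, h1 x hx] at e3
    simp [h2 x hx, h_df x hx]
    linarith

/-- The functional dual to the first vector of the frame `(f, df)`. -/
theorem exists_dual_functional [CompleteSpace E] {f : E → ℝ × E} {r : ℝ} (hr : 0 < r)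
    (hf : ContDiffOn ℝ ∞ f (Metric.ball 0 r)) (hf0 : f 0 = (1, 0))
    (hdf0 : fderiv ℝ f 0 = ContinuousLinearMap.inr ℝ ℝ E) :
    ∃ (h : E → ℝ × E →L[ℝ] ℝ) (r' : ℝ), 0 < r' ∧ r' ≤ r ∧ ContDiffOn ℝ ∞ h (Metric.ball 0 r') ∧
      h 0 = ContinuousLinearMap.fst ℝ ℝ E ∧ ∀ x ∈ Metric.ball (0 : E) r',
        h x (f x) = 1 ∧ (∀ u, h x (fderiv ℝ f x u) = 0) ∧
        ∀ m : ℝ × E →L[ℝ] ℝ, m (f x) = 0 → (∀ u, m (fderiv ℝ f x u) = 0) → m = 0 := by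
  -- The frame as an operator (a, u) ↦ a f(x) + df(u). It is the identity at 0, hence invertible
  -- nearby, and h is the first coordinate of its inverse.
  let L : E → ℝ × E →L[ℝ] ℝ × E := fun x ↦
    (ContinuousLinearMap.fst ℝ ℝ E).smulRight (f x) + fderiv ℝ f x ∘L ContinuousLinearMap.snd ℝ ℝ E
  have hL : ContDiffOn ℝ ∞ L (Metric.ball 0 r) := by
    have h1 : ContDiffOn ℝ ∞ (fderiv ℝ f) (Metric.ball 0 r) :=
      hf.fderiv_of_isOpen Metric.isOpen_ball (by simp)
    exact (contDiffOn_const.smulRight hf).add (h1.clm_comp contDiffOn_const)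
  have hL0 : L 0 = 1 := by
    ext p <;> simp [L, hf0, hdf0]
  have hunit : ∀ᶠ x in 𝓝 (0 : E), IsUnit (L x) := by
    have hc : ContinuousAt L 0 :=
      hL.continuousOn.continuousAt (Metric.ball_mem_nhds 0 hr)
    refine hc.eventually (Units.isOpen.mem_nhds ?_)
    simp [hL0]
  obtain ⟨ε, hε, hball⟩ := Metric.eventually_nhds_iff_ball.1 hunit
  have hsub : Metric.ball (0 : E) (min r ε) ⊆ Metric.ball 0 r :=
    Metric.ball_subset_ball (min_le_left _ _)
  have hsub' : Metric.ball (0 : E) (min r ε) ⊆ Metric.ball 0 ε :=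
    Metric.ball_subset_ball (min_le_right _ _)
  refine ⟨fun x ↦ ContinuousLinearMap.fst ℝ ℝ E ∘L Ring.inverse (L x), min r ε, lt_min hr hε,
    min_le_left _ _, ?_, ?_, fun x hx ↦ ?_⟩
  · intro x hx
    obtain ⟨u, hu⟩ := hball x (hsub' hx)
    have h1 : ContDiffAt ℝ ∞ (fun x ↦ Ring.inverse (L x)) x := by
      have h := contDiffAt_ringInverse ℝ (n := ∞) u
      rw [hu] at h
      exact h.comp x (hL.contDiffAt (Metric.isOpen_ball.mem_nhds (hsub hx)))
    exact (contDiffAt_const.clm_comp h1).contDiffWithinAt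
  · beta_reduce
    rw [hL0, Ring.inverse_one]; rfl
  · have hinv : ∀ p, Ring.inverse (L x) (L x p) = p := fun p ↦
      congrArg (fun T : ℝ × E →L[ℝ] ℝ × E ↦ T p) (Ring.inverse_mul_cancel _ (hball x (hsub' hx)))
    have hinv' : ∀ p, L x (Ring.inverse (L x) p) = p := fun p ↦
      congrArg (fun T : ℝ × E →L[ℝ] ℝ × E ↦ T p) (Ring.mul_inverse_cancel _ (hball x (hsub' hx)))
    have h1 : f x = L x (1, 0) := by simp [L]
    have h2 : ∀ u, fderiv ℝ f x u = L x (0, u) := fun u ↦ by simp [L]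
    refine ⟨?_, fun u ↦ ?_, fun m hm hm' ↦ ContinuousLinearMap.ext fun p ↦ ?_⟩
    · rw [ContinuousLinearMap.comp_apply, h1, hinv]; rfl
    · rw [ContinuousLinearMap.comp_apply, h2, hinv]; rfl
    · rw [← hinv' p]
      simp [L, hm, hm']

end DualSolution

end InfoGeo
namespace InfoGeo

/-! ### Convexity by Hessians, and two charts with convex images on one domain. -/

section ConvexCharts

open Set Filter Topology

/-- Restriction to segments reduces this to the one-variable second derivative test. -/
theorem convexOn_of_hessian_nonneg {E : Type} [NormedAddCommGroup E] [NormedSpace ℝ E]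
    {s : Set E} (hs : IsOpen s) (hconv : Convex ℝ s) {f : E → ℝ} (hf : ContDiffOn ℝ ∞ f s)
    (hnonneg : ∀ x ∈ s, ∀ v, 0 ≤ fderiv ℝ (fderiv ℝ f) x v v) : ConvexOn ℝ s f := by
  refine ⟨hconv, fun x hx y hy a b ha hb hab ↦ ?_⟩
  let c : ℝ → E := fun t ↦ x + t • (y - x)
  have hc : ∀ t ∈ Icc (0 : ℝ) 1, c t ∈ s := fun t ht ↦ by
    have := hconv hx hy (sub_nonneg.2 ht.2) ht.1 (by ring)
    rwa [show (1 - t) • x + t • y = c t by simp only [c]; module] at this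
  have hcd : ∀ t, HasDerivAt c (y - x) t := fun t ↦ by
    have h := ((hasDerivAt_id t).smul_const (y - x)).const_add x
    rwa [one_smul] at h
  have h1 : ∀ t ∈ Icc (0 : ℝ) 1, HasDerivAt (fun t ↦ f (c t)) (fderiv ℝ f (c t) (y - x)) t :=
    fun t ht ↦ (((hf.contDiffAt (hs.mem_nhds (hc t ht))).differentiableAt
      (by simp)).hasFDerivAt).comp_hasDerivAt t (hcd t)
  have h2 : ∀ t ∈ Icc (0 : ℝ) 1, HasDerivAt (fun t ↦ fderiv ℝ f (c t) (y - x))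
      (fderiv ℝ (fderiv ℝ f) (c t) (y - x) (y - x)) t := fun t ht ↦ by
    have h3 : HasDerivAt (fun t ↦ fderiv ℝ f (c t)) (fderiv ℝ (fderiv ℝ f) (c t) (y - x)) t :=
      (((hf.contDiffAt (hs.mem_nhds (hc t ht))).fderiv_right (m := 1)
        two_le_infty).differentiableAt (by simp)).hasFDerivAt.comp_hasDerivAt t (hcd t)
    simpa using h3.clm_apply (hasDerivAt_const t (y - x))
  have hconvg : ConvexOn ℝ (Icc (0 : ℝ) 1) (fun t ↦ f (c t)) :=
    convexOn_of_hasDerivWithinAt2_nonneg (convex_Icc 0 1)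
      (fun t ht ↦ (h1 t ht).continuousAt.continuousWithinAt)
      (fun t ht ↦ (h1 t (interior_subset ht)).hasDerivWithinAt)
      (fun t ht ↦ (h2 t (interior_subset ht)).hasDerivWithinAt)
      (fun t ht ↦ hnonneg _ (hc t (interior_subset ht)) _)
  have h := hconvg.2 (left_mem_Icc.2 zero_le_one) (right_mem_Icc.2 zero_le_one) ha hb hab
  simp only [smul_eq_mul, mul_zero, mul_one, zero_add] at h
  have e : c b = a • x + b • y := by
    simp only [c]; rw [← eq_sub_iff_add_eq] at hab; rw [hab]; module
  simpa [e, c] using h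

theorem concaveOn_of_hessian_nonpos {E : Type} [NormedAddCommGroup E] [NormedSpace ℝ E]
    {s : Set E} (hs : IsOpen s) (hconv : Convex ℝ s) {f : E → ℝ} (hf : ContDiffOn ℝ ∞ f s)
    (hnonpos : ∀ x ∈ s, ∀ v, fderiv ℝ (fderiv ℝ f) x v v ≤ 0) : ConcaveOn ℝ s f := by
  rw [← neg_convexOn_iff]
  refine convexOn_of_hessian_nonneg hs hconv hf.neg fun x hx v ↦ ?_
  have h1 : fderiv ℝ (-f) = -fderiv ℝ f := by
    ext1 y; exact fderiv_neg
  rw [h1, fderiv_neg]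
  simpa using hnonpos x hx v

variable {E : Type} [NormedAddCommGroup E] [InnerProductSpace ℝ E] [FiniteDimensional ℝ E]

/-- The inverse function theorem, with a domain on which the inverse is smooth. -/
lemma exists_openPartialHomeomorph {ξ : E → E} {N : Set E} (hN : IsOpen N) (h0 : 0 ∈ N)
    (hξ : ContDiffOn ℝ ∞ ξ N) (hinv : (fderiv ℝ ξ 0).IsInvertible) :
    ∃ θ : OpenPartialHomeomorph E E, 0 ∈ θ.source ∧ θ.source ⊆ N ∧ ⇑θ = ξ ∧
      (∀ x ∈ θ.source, (fderiv ℝ ξ x).IsInvertible) ∧ ContDiffOn ℝ ∞ θ.symm θ.target := by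
  have hd : ∀ x ∈ N, HasFDerivAt ξ (fderiv ℝ ξ x) x := fun x hx ↦
    ((hξ.contDiffAt (hN.mem_nhds hx)).differentiableAt (by simp)).hasFDerivAt
  have hcont : ContinuousOn (fderiv ℝ ξ) N := (hξ.fderiv_of_isOpen hN (m := 0) (by simp)).continuousOn
  let N' := N ∩ fderiv ℝ ξ ⁻¹' (range ((↑) : (E ≃L[ℝ] E) → E →L[ℝ] E))
  have hN' : IsOpen N' := hcont.isOpen_inter_preimage hN ContinuousLinearEquiv.isOpen
  obtain ⟨e, he⟩ := hinv
  have hd0 := hd 0 h0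
  rw [← he] at hd0
  let θ₀ := (hξ.contDiffAt (hN.mem_nhds h0)).toOpenPartialHomeomorph ξ hd0 (by simp)
  have hθ₀ : ⇑θ₀ = ξ := rfl
  refine ⟨θ₀.restrOpen N' hN', ⟨ContDiffAt.mem_toOpenPartialHomeomorph_source _ hd0 (by simp),
    h0, ⟨e, he⟩⟩, fun x hx ↦ hx.2.1, hθ₀, fun x hx ↦ hx.2.2, fun y hy ↦ ?_⟩
  have hx := (θ₀.restrOpen N' hN').map_target hy
  obtain ⟨e', he'⟩ := hx.2.2
  refine (OpenPartialHomeomorph.contDiffAt_symm (f₀' := e') _ hy ?_ ?_).contDiffWithinAt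
  · rw [he']; exact hd _ hx.2.1
  · exact hξ.contDiffAt (hN.mem_nhds hx.2.1)

/-- At the zero y₀ the second derivatives of ζ drop out of the Hessian of ‖ζ‖², leaving 2‖dζ(v)‖².
This is positive definite as dζ is invertible, so the Hessian stays nonnegative on a small ball. -/
lemma exists_ball_convexOn_norm_sq {ζ : E → E} {N : Set E} (hN : IsOpen N) {y₀ : E} (hy₀ : y₀ ∈ N)
    (hζ : ContDiffOn ℝ ∞ ζ N) (h0 : ζ y₀ = 0) (hinv : (fderiv ℝ ζ y₀).IsInvertible) :
    ∃ ε > 0, Metric.ball y₀ ε ⊆ N ∧ ConvexOn ℝ (Metric.ball y₀ ε) (fun y ↦ ‖ζ y‖ ^ 2) := by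
  have hq : ContDiffOn ℝ ∞ (fun y ↦ ‖ζ y‖ ^ 2) N := hζ.norm_sq ℝ
  have hd : ∀ x ∈ N, HasFDerivAt ζ (fderiv ℝ ζ x) x := fun x hx ↦
    ((hζ.contDiffAt (hN.mem_nhds hx)).differentiableAt (by simp)).hasFDerivAt
  have hdd : HasFDerivAt (fderiv ℝ ζ) (fderiv ℝ (fderiv ℝ ζ) y₀) y₀ :=
    (((hζ.contDiffAt (hN.mem_nhds hy₀)).fderiv_right (m := 1) two_le_infty).differentiableAt
      (by simp)).hasFDerivAt
  have hD : ∀ v, fderiv ℝ (fderiv ℝ (fun y ↦ ‖ζ y‖ ^ 2)) y₀ v v = 2 * ‖fderiv ℝ ζ y₀ v‖ ^ 2 := by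
    intro v
    have h1 : (fun y ↦ fderiv ℝ (fun y ↦ ‖ζ y‖ ^ 2) y v)
        =ᶠ[𝓝 y₀] fun y ↦ 2 * inner ℝ (ζ y) (fderiv ℝ ζ y v) := by
      filter_upwards [hN.mem_nhds hy₀] with y hy
      rw [(hd y hy).norm_sq.fderiv]
      simp
    have h2 : HasFDerivAt (fderiv ℝ (fun y ↦ ‖ζ y‖ ^ 2)) _ y₀ :=
      (((hq.contDiffAt (hN.mem_nhds hy₀)).fderiv_right (m := 1) two_le_infty).differentiableAt
        (by simp)).hasFDerivAt
    have h3 := (h2.clm_apply (hasFDerivAt_const v y₀)).fderiv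
    have h4 : HasFDerivAt (fun y ↦ fderiv ℝ ζ y v) ((fderiv ℝ (fderiv ℝ ζ) y₀).flip v) y₀ := by
      simpa using hdd.clm_apply (hasFDerivAt_const v y₀)
    have h5 := (((hd y₀ hy₀).inner ℝ h4).const_mul (2 : ℝ)).fderiv
    rw [h1.fderiv_eq] at h3
    have h6 := congrArg (fun L : E →L[ℝ] ℝ ↦ L v) (h3.symm.trans h5)
    simpa [h0, fderivInnerCLM_apply] using h6
  obtain ⟨e, he⟩ := hinv
  have hlow : ∀ v, ‖v‖ ≤ (‖(e.symm : E →L[ℝ] E)‖ + 1) * ‖fderiv ℝ ζ y₀ v‖ := fun v ↦ by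
    have h1 : v = e.symm (fderiv ℝ ζ y₀ v) := by rw [← he]; simp
    calc ‖v‖ = ‖e.symm (fderiv ℝ ζ y₀ v)‖ := by rw [← h1]
      _ ≤ ‖(e.symm : E →L[ℝ] E)‖ * ‖fderiv ℝ ζ y₀ v‖ := (e.symm : E →L[ℝ] E).le_opNorm _
      _ ≤ _ := by gcongr; linarith
  set C := ‖(e.symm : E →L[ℝ] E)‖ + 1 with hC
  have hCpos : 0 < C := by positivity
  have hcont : ContinuousOn (fderiv ℝ (fderiv ℝ (fun y ↦ ‖ζ y‖ ^ 2))) N :=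
    ((hq.fderiv_of_isOpen hN (m := ∞) (by simp)).fderiv_of_isOpen hN (m := 0)
      (by simp)).continuousOn
  -- As ‖v‖ ≤ C‖dζ(v)‖, moving the Hessian by less than 1/C² changes its value at (v, v) by at most
  -- ‖dζ(v)‖², half of its value at y₀.
  have hnear := Metric.continuousAt_iff (β := E →L[ℝ] E →L[ℝ] ℝ) |>.1
    (hcont.continuousAt (hN.mem_nhds hy₀)) (1 / C ^ 2)
    (by positivity)
  obtain ⟨δ, hδ, hδ'⟩ := hnear
  obtain ⟨ε, hε, hεN⟩ := Metric.isOpen_iff.1 hN y₀ hy₀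
  refine ⟨min δ ε, lt_min hδ hε, (Metric.ball_subset_ball (min_le_right _ _)).trans hεN, ?_⟩
  refine convexOn_of_hessian_nonneg Metric.isOpen_ball (convex_ball _ _)
    (hq.mono ((Metric.ball_subset_ball (min_le_right _ _)).trans hεN)) fun y hy v ↦ ?_
  have h1 := hδ' (lt_of_lt_of_le (Metric.mem_ball.1 hy) (min_le_left _ _))
  rw [dist_eq_norm (E := E →L[ℝ] E →L[ℝ] ℝ)] at h1
  have h2 : ‖(fderiv ℝ (fderiv ℝ (fun y ↦ ‖ζ y‖ ^ 2)) y
      - fderiv ℝ (fderiv ℝ (fun y ↦ ‖ζ y‖ ^ 2)) y₀) v v‖ ≤ 1 / C ^ 2 * ‖v‖ * ‖v‖ :=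
    (ContinuousLinearMap.le_opNorm₂ _ v v).trans (by gcongr)
  rw [Real.norm_eq_abs, sub_apply, sub_apply, hD] at h2
  have h3 := (abs_le.1 h2).1
  have h4 : ‖v‖ ^ 2 ≤ C ^ 2 * ‖fderiv ℝ ζ y₀ v‖ ^ 2 := by
    rw [← mul_pow]; exact pow_le_pow_left₀ (norm_nonneg _) (hlow v) 2
  have h5 : 1 / C ^ 2 * ‖v‖ * ‖v‖ ≤ ‖fderiv ℝ ζ y₀ v‖ ^ 2 := by
    rw [mul_assoc, ← sq, one_div, inv_mul_le_iff₀ (by positivity)]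
    exact h4
  nlinarith [sq_nonneg ‖fderiv ℝ ζ y₀ v‖]

/-- Two local diffeomorphisms can be restricted to a common domain with convex images. -/
theorem exists_convex_charts {ξ η : E → E} {N : Set E} (hN : IsOpen N) (h0 : 0 ∈ N)
    (hξ : ContDiffOn ℝ ∞ ξ N) (hη : ContDiffOn ℝ ∞ η N) (hξ0 : ξ 0 = 0)
    (hξinv : (fderiv ℝ ξ 0).IsInvertible) (hηinv : (fderiv ℝ η 0).IsInvertible) :
    ∃ θ₁ θ₂ : OpenPartialHomeomorph E E, 0 ∈ θ₁.source ∧ θ₁.source = θ₂.source ∧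
      θ₁.source ⊆ N ∧ ⇑θ₁ = ξ ∧ ⇑θ₂ = η ∧
      (∀ x ∈ θ₁.source, (fderiv ℝ ξ x).IsInvertible) ∧
      (∀ x ∈ θ₂.source, (fderiv ℝ η x).IsInvertible) ∧
      ContDiffOn ℝ ∞ θ₁.symm θ₁.target ∧ ContDiffOn ℝ ∞ θ₂.symm θ₂.target ∧
      Convex ℝ θ₁.target ∧ Convex ℝ θ₂.target := by
  obtain ⟨θ₁, h1s, h1N, h1c, h1inv, h1symm⟩ := exists_openPartialHomeomorph hN h0 hξ hξinv
  obtain ⟨θ₂, h2s, h2N, h2c, h2inv, h2symm⟩ := exists_openPartialHomeomorph hN h0 hη hηinv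
  have h2d : ∀ x ∈ θ₂.source, HasFDerivAt η (fderiv ℝ η x) x := fun x hx ↦
    ((hη.contDiffAt (hN.mem_nhds (h2N hx))).differentiableAt (by simp)).hasFDerivAt
  have h20 : η 0 ∈ θ₂.target := by rw [← h2c]; exact θ₂.map_source h2s
  have h2symm0 : θ₂.symm (η 0) = 0 := by rw [← h2c]; exact θ₂.left_inv h2s
  let N₂ := θ₂.target ∩ θ₂.symm ⁻¹' θ₁.source
  have hN₂ : IsOpen N₂ := θ₂.isOpen_inter_preimage_symm θ₁.open_source
  -- The transition map ζ = ξ ∘ η⁻¹, which vanishes at η(0); the previous lemma is applied to it.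
  have hζ : ContDiffOn ℝ ∞ (fun y ↦ ξ (θ₂.symm y)) N₂ :=
    hξ.comp (h2symm.mono inter_subset_left) fun y hy ↦ h1N hy.2
  have hη0N₂ : η 0 ∈ N₂ := ⟨h20, by simpa [h2symm0] using h1s⟩
  have hζinv : (fderiv ℝ (fun y ↦ ξ (θ₂.symm y)) (η 0)).IsInvertible := by
    obtain ⟨e₂, he₂⟩ := hηinv
    have hd2 : HasFDerivAt θ₂.symm (e₂.symm : E →L[ℝ] E) (η 0) := by
      refine θ₂.hasFDerivAt_symm h20 ?_
      rw [h2symm0, he₂, h2c]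
      exact h2d 0 h2s
    have hd1 : HasFDerivAt ξ (fderiv ℝ ξ 0) (θ₂.symm (η 0)) := by
      rw [h2symm0]
      exact ((hξ.contDiffAt (hN.mem_nhds h0)).differentiableAt (by simp)).hasFDerivAt
    have := hd1.comp (η 0) hd2
    rw [HasFDerivAt.fderiv (f := fun y ↦ ξ (θ₂.symm y)) this]
    exact hξinv.comp ⟨e₂.symm, rfl⟩
  obtain ⟨ε, hε, hεN, hconv⟩ := exists_ball_convexOn_norm_sq hN₂ hη0N₂ hζ
    (by rw [h2symm0, hξ0]) hζinv
  have hW : IsOpen (θ₁.target ∩ θ₁.symm ⁻¹' (θ₂.source ∩ η ⁻¹' Metric.ball (η 0) ε)) := by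
    refine θ₁.isOpen_inter_preimage_symm ?_
    rw [← h2c]
    exact θ₂.isOpen_inter_preimage Metric.isOpen_ball
  have h10 : (0 : E) ∈ θ₁.target := by
    have := θ₁.map_source h1s
    rwa [h1c, hξ0] at this
  have h1symm0 : θ₁.symm 0 = 0 := by
    have := θ₁.left_inv h1s
    rwa [h1c, hξ0] at this
  -- ρ is small enough that the ξ-preimage of the ρ-ball maps under η into the ball on which ‖ζ‖² is
  -- convex.
  obtain ⟨ρ, hρ, hρW⟩ := Metric.isOpen_iff.1 hW 0
    ⟨h10, by simpa [h1symm0] using ⟨h2s, hε⟩⟩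
  have hU : IsOpen (θ₁.source ∩ ξ ⁻¹' Metric.ball 0 ρ) := by
    rw [← h1c]; exact θ₁.isOpen_inter_preimage Metric.isOpen_ball
  set U := θ₁.source ∩ ξ ⁻¹' Metric.ball 0 ρ with hUdef
  have hUmem : ∀ x ∈ U, x ∈ θ₂.source ∧ η x ∈ Metric.ball (η 0) ε := by
    intro x hx
    have h1 := hρW hx.2
    have h2 : θ₁.symm (ξ x) = x := by rw [← h1c]; exact θ₁.left_inv hx.1
    simpa [h2] using h1.2
  have h1src : (θ₁.restrOpen U hU).source = U := inter_eq_self_of_subset_right fun x hx ↦ hx.1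
  have h2src : (θ₂.restrOpen U hU).source = U := inter_eq_self_of_subset_right fun x hx ↦
    (hUmem x hx).1
  refine ⟨θ₁.restrOpen U hU, θ₂.restrOpen U hU, ?_, h1src.trans h2src.symm,
    fun x hx ↦ h1N hx.1, h1c, h2c, fun x hx ↦ h1inv x hx.1, fun x hx ↦ h2inv x hx.1,
    h1symm.mono inter_subset_left, h2symm.mono inter_subset_left, ?_, ?_⟩
  · rw [h1src]
    exact ⟨h1s, by simpa [hξ0] using hρ⟩
  · convert convex_ball (0 : E) ρ
    rw [← OpenPartialHomeomorph.image_source_eq_target, h1src]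
    change θ₁ '' U = _
    rw [h1c]
    ext y
    refine ⟨?_, fun hy ↦ ⟨θ₁.symm y, ⟨θ₁.map_target (hρW hy).1, ?_⟩, ?_⟩⟩
    · rintro ⟨x, hx, rfl⟩
      exact hx.2
    · rw [mem_preimage, ← h1c, θ₁.right_inv (hρW hy).1]; exact hy
    · rw [← h1c, θ₁.right_inv (hρW hy).1]
  -- In the coordinates η the domain is the sublevel set ‖ζ‖² < ρ² of a convex function.
  · convert hconv.convex_lt (ρ ^ 2)
    rw [← OpenPartialHomeomorph.image_source_eq_target, h2src]
    change θ₂ '' U = _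
    rw [h2c]
    ext y
    constructor
    · rintro ⟨x, hx, rfl⟩
      refine ⟨(hUmem x hx).2, ?_⟩
      have h1 : θ₂.symm (η x) = x := by rw [← h2c]; exact θ₂.left_inv (hUmem x hx).1
      have h2 : ‖ξ x‖ < ρ := by simpa using hx.2
      simp only [h1]
      exact pow_lt_pow_left₀ h2 (norm_nonneg _) two_ne_zero
    · rintro ⟨hy, hlt⟩
      refine ⟨θ₂.symm y, ⟨(hεN hy).2, ?_⟩, ?_⟩
      · simpa using lt_of_pow_lt_pow_left₀ 2 hρ.le hlt
      · rw [← h2c, θ₂.right_inv (hεN hy).1]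

end ConvexCharts

end InfoGeo

namespace InfoGeo

/-! ### Vector fields and covariant derivatives in a chart. -/

section ChartFields

open Set Filter Topology

variable {d : ℕ} {M : Type*} [TopologicalSpace M] [ChartedSpace (EuclideanSpace ℝ (Fin d)) M]
  [IsManifold (𝓡 d) ∞ M]
  {e : OpenPartialHomeomorph M (EuclideanSpace ℝ (Fin d))}

/-- The vector field on the domain of `e` whose coordinate representation is `Y`. -/
def chartField (e : OpenPartialHomeomorph M (EuclideanSpace ℝ (Fin d)))
    (Y : EuclideanSpace ℝ (Fin d) → EuclideanSpace ℝ (Fin d)) : ∀ x : M, TangentSpace (𝓡 d) x :=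
  fun x ↦ coordField e (Y (e x)) x

theorem coordField_eq_chartField (v : EuclideanSpace ℝ (Fin d)) :
    coordField e v = chartField e (fun _ ↦ v) := rfl

theorem mdifferentiable_of_mem_maximalAtlas
    (he : e ∈ IsManifold.maximalAtlas (𝓡 d) ∞ M) : e.MDifferentiable (𝓡 d) (𝓡 d) :=
  ⟨(contMDiffOn_of_mem_maximalAtlas he).mdifferentiableOn (by simp),
    (contMDiffOn_symm_of_mem_maximalAtlas he).mdifferentiableOn (by simp)⟩

theorem mfderiv_isInvertible (he : e ∈ IsManifold.maximalAtlas (𝓡 d) ∞ M) {x : M}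
    (hx : x ∈ e.source) : (mfderiv (𝓡 d) (𝓡 d) e x).IsInvertible :=
  ⟨(mdifferentiable_of_mem_maximalAtlas he).mfderiv hx, rfl⟩

theorem mvfderiv_isInvertible (he : e ∈ IsManifold.maximalAtlas (𝓡 d) ∞ M) {x : M}
    (hx : x ∈ e.source) : (mvfderiv (𝓡 d) e x).IsInvertible :=
  mfderiv_isInvertible he hx

theorem mvfderiv_coordField (he : e ∈ IsManifold.maximalAtlas (𝓡 d) ∞ M) {x : M}
    (hx : x ∈ e.source) (v : EuclideanSpace ℝ (Fin d)) :
    mvfderiv (𝓡 d) e x (coordField e v x) = v :=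
  (mvfderiv_isInvertible he hx).self_apply_inverse v

theorem coordField_mvfderiv (he : e ∈ IsManifold.maximalAtlas (𝓡 d) ∞ M) {x : M}
    (hx : x ∈ e.source) (w : TangentSpace (𝓡 d) x) :
    coordField e (mvfderiv (𝓡 d) e x w) x = w :=
  (mvfderiv_isInvertible he hx).inverse_apply_self w

theorem coordField_add (u v : EuclideanSpace ℝ (Fin d)) (x : M) :
    coordField e (u + v) x = coordField e u x + coordField e v x :=
  map_add _ _ _

theorem coordField_smul (c : ℝ) (v : EuclideanSpace ℝ (Fin d)) (x : M) :
    coordField e (c • v) x = c • coordField e v x :=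
  map_smul _ _ _

theorem contMDiffAt_chartField (he : e ∈ IsManifold.maximalAtlas (𝓡 d) ∞ M) {x : M}
    (hx : x ∈ e.source) {Y : EuclideanSpace ℝ (Fin d) → EuclideanSpace ℝ (Fin d)}
    (hY : ContDiffAt ℝ ∞ Y (e x)) :
    ContMDiffAt (𝓡 d) (𝓡 d).tangent ∞
      (fun y ↦ (⟨y, chartField e Y y⟩ : TangentBundle (𝓡 d) M)) x :=
  haveI : IsManifold (𝓡 d) 1 M := IsManifold.of_le (n := ∞) (by simp)
  ContMDiffAt.mpullback_vectorField_preimage (n := ∞) (contMDiffAt_vectorSpace_iff_contDiffAt.2 hY)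
    (contMDiffAt_of_mem_maximalAtlas he hx) (mfderiv_isInvertible he hx) (by simp)

theorem mdifferentiableAt_chartField (he : e ∈ IsManifold.maximalAtlas (𝓡 d) ∞ M) {x : M}
    (hx : x ∈ e.source) {Y : EuclideanSpace ℝ (Fin d) → EuclideanSpace ℝ (Fin d)}
    (hY : ContDiffAt ℝ ∞ Y (e x)) :
    MDifferentiableAt (𝓡 d) (𝓡 d).tangent
      (fun y ↦ (⟨y, chartField e Y y⟩ : TangentBundle (𝓡 d) M)) x :=
  (contMDiffAt_chartField he hx hY).mdifferentiableAt (by simp)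

theorem mvfderiv_comp_chart (he : e ∈ IsManifold.maximalAtlas (𝓡 d) ∞ M) {x : M}
    (hx : x ∈ e.source) {G : Type*} [NormedAddCommGroup G] [NormedSpace ℝ G]
    {f : EuclideanSpace ℝ (Fin d) → G} (hf : DifferentiableAt ℝ f (e x))
    (w : TangentSpace (𝓡 d) x) :
    mvfderiv (𝓡 d) (fun y ↦ f (e y)) x w = fderiv ℝ f (e x) (mvfderiv (𝓡 d) e x w) := by
  have h := mfderiv_comp (I := 𝓡 d) (I' := 𝓡 d) (I'' := 𝓘(ℝ, G)) x (g := f) (f := e)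
    hf.mdifferentiableAt ((mdifferentiable_of_mem_maximalAtlas he).mdifferentiableAt hx)
  have h2 : mfderiv (𝓡 d) 𝓘(ℝ, G) (fun y ↦ f (e y)) x w
    = mfderiv (𝓡 d) 𝓘(ℝ, G) f (e x) (mfderiv (𝓡 d) (𝓡 d) e x w) := by
    rw [show (fun y ↦ f (e y)) = f ∘ e from rfl, h]; rfl
  rw [mfderiv_eq_fderiv] at h2
  exact h2

theorem chartField_eq_of_fields (he : e ∈ IsManifold.maximalAtlas (𝓡 d) ∞ M)
    (X : ∀ x : M, TangentSpace (𝓡 d) x) {x : M} (hx : x ∈ e.source) :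
    chartField e (fun y ↦ mvfderiv (𝓡 d) e (e.symm y) (X (e.symm y))) x = X x := by
  have h := e.left_inv hx
  simp only [chartField]
  rw [h]
  exact coordField_mvfderiv he hx _

/-- Duality and curvature are hypotheses on global smooth fields, while coordinate fields are
meaningful only on a chart domain. A bump function extends them without changing their germ. -/
theorem exists_isSmoothField_eventuallyEq [T2Space M] {X : ∀ x : M, TangentSpace (𝓡 d) x}
    {U : Set M} (hU : IsOpen U) {x : M} (hx : x ∈ U)
    (hX : ContMDiffOn (𝓡 d) (𝓡 d).tangent ∞
      (fun y ↦ (⟨y, X y⟩ : TangentBundle (𝓡 d) M)) U) :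
    ∃ X' : ∀ x : M, TangentSpace (𝓡 d) x, IsSmoothField X' ∧ ∀ᶠ y in 𝓝 x, X' y = X y := by
  obtain ⟨ψ, -, hψ⟩ := (SmoothBumpFunction.nhds_basis_tsupport (I := 𝓡 d) x).mem_iff.1
    (hU.mem_nhds hx)
  have : IsManifold (𝓡 d) 1 M := IsManifold.of_le (n := ∞) (by simp)
  refine ⟨fun y ↦ ψ y • X y,
    ContMDiffOn.smul_section_of_tsupport (n := ∞) ψ.contMDiff.contMDiffOn hU hψ hX, ?_⟩
  filter_upwards [ψ.eventuallyEq_one] with y hy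
  rw [hy, Pi.one_apply, one_smul]


variable (nabla : AffineConnection d M)

theorem nabla_congr {X X' : ∀ x : M, TangentSpace (𝓡 d) x} {x : M}
    (hX : MDifferentiableAt (𝓡 d) (𝓡 d).tangent
      (fun y ↦ (⟨y, X y⟩ : TangentBundle (𝓡 d) M)) x)
    (hXX' : ∀ᶠ y in 𝓝 x, X y = X' y) : nabla X x = nabla X' x := by
  refine nabla.isCovariantDerivativeOn.congr_of_eventuallyEq (s := univ) hX ?_ univ_mem hXX'
  refine hX.congr_of_eventuallyEq ?_
  filter_upwards [hXX'] with y hy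
  rw [hy]

theorem nabla_chartField_sum (he : e ∈ IsManifold.maximalAtlas (𝓡 d) ∞ M) {x : M}
    (hx : x ∈ e.source) {ι : Type*} (s : Finset ι) {c : ι → EuclideanSpace ℝ (Fin d) → ℝ}
    (v : ι → EuclideanSpace ℝ (Fin d)) (hc : ∀ i, ContDiffAt ℝ ∞ (c i) (e x))
    (w : TangentSpace (𝓡 d) x) :
    nabla (chartField e fun y ↦ ∑ i ∈ s, c i y • v i) x w
      = ∑ i ∈ s, (fderiv ℝ (c i) (e x) (mvfderiv (𝓡 d) e x w) • coordField e (v i) x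
          + c i (e x) • nabla (coordField e (v i)) x w) := by
  classical
  induction s using Finset.induction_on with
  | empty =>
    have : (chartField e fun y ↦ ∑ i ∈ (∅ : Finset ι), c i y • v i) = 0 := by
      funext y; simp [chartField, coordField]
    rw [this, CovariantDerivative.zero]; simp
  | insert a s ha ih =>
    have h1 : (chartField e fun y ↦ ∑ i ∈ insert a s, c i y • v i)
        = (fun y ↦ c a (e y)) • coordField e (v a)
          + chartField e fun y ↦ ∑ i ∈ s, c i y • v i := by
      funext y
      simp [chartField, Finset.sum_insert ha, coordField]
    have hva := mdifferentiableAt_chartField (M := M) he hx (Y := fun _ ↦ v a) contDiffAt_const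
    have hca : MDifferentiableAt (𝓡 d) 𝓘(ℝ, ℝ) (fun y ↦ c a (e y)) x :=
      ((hc a).differentiableAt (by simp)).mdifferentiableAt.comp x
        ((mdifferentiable_of_mem_maximalAtlas he).mdifferentiableAt hx)
    have h2 : MDifferentiableAt (𝓡 d) (𝓡 d).tangent
        (fun y ↦ (⟨y, ((fun y ↦ c a (e y)) • coordField e (v a)) y⟩ : TangentBundle (𝓡 d) M)) x :=
      mdifferentiableAt_chartField he hx (Y := fun y ↦ c a y • v a) ((hc a).smul contDiffAt_const)
        |>.congr_of_eventuallyEq (Eventually.of_forall fun y ↦ by simp [chartField, coordField])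
    have h3 := mdifferentiableAt_chartField (M := M) he hx (Y := fun y ↦ ∑ i ∈ s, c i y • v i)
      (ContDiffAt.sum fun i _ ↦ (hc i).smul contDiffAt_const)
    rw [h1, nabla.isCovariantDerivativeOnUniv.add h2 h3,
      nabla.isCovariantDerivativeOnUniv.leibniz (σ := coordField e (v a)) hva hca, Finset.sum_insert ha, add_apply, ih]
    congr 1
    rw [add_apply, add_comm]
    congr 1
    exact congrArg (· • coordField e (v a) x)
      (mvfderiv_comp_chart he hx ((hc a).differentiableAt (by simp)) w)

/-- The coordinate expression of a covariant derivative. -/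
theorem mvfderiv_nabla_chartField (he : e ∈ IsManifold.maximalAtlas (𝓡 d) ∞ M) {x : M}
    (hx : x ∈ e.source) {Y : EuclideanSpace ℝ (Fin d) → EuclideanSpace ℝ (Fin d)}
    (hY : ContDiffAt ℝ ∞ Y (e x)) (u : EuclideanSpace ℝ (Fin d)) :
    mvfderiv (𝓡 d) e x (nabla (chartField e Y) x (coordField e u x))
      = fderiv ℝ Y (e x) u + nabla.christoffel e x u (Y (e x)) := by
  have hbasis : ∀ y : EuclideanSpace ℝ (Fin d), y = ∑ i, y i • EuclideanSpace.single i (1 : ℝ) :=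
    fun y ↦ by ext j; simp [Pi.single_apply]
  have key : ∀ Z : EuclideanSpace ℝ (Fin d) → EuclideanSpace ℝ (Fin d), ContDiffAt ℝ ∞ Z (e x) →
      mvfderiv (𝓡 d) e x (nabla (chartField e Z) x (coordField e u x))
      = fderiv ℝ Z (e x) u + ∑ i, Z (e x) i • mvfderiv (𝓡 d) e x
        (nabla (coordField e (EuclideanSpace.single i (1 : ℝ))) x (coordField e u x)) := by
    intro Z hZ
    have hc : ∀ i, ContDiffAt ℝ ∞ (fun y ↦ Z y i) (e x) := fun i ↦ by fun_prop
    have h := nabla_chartField_sum nabla he hx Finset.univ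
      (fun i ↦ EuclideanSpace.single i (1 : ℝ)) hc (coordField e u x)
    have hZ' : (fun y ↦ ∑ i, Z y i • EuclideanSpace.single i (1 : ℝ)) = Z :=
      funext fun y ↦ (hbasis (Z y)).symm
    rw [hZ'] at h
    rw [h, map_sum, hbasis (fderiv ℝ Z (e x) u), ← Finset.sum_add_distrib]
    refine Finset.sum_congr rfl fun i _ ↦ ?_
    rw [map_add, map_smul, map_smul, mvfderiv_coordField he hx, mvfderiv_coordField he hx]
    congr 2
    have := ((EuclideanSpace.proj (𝕜 := ℝ) i).hasFDerivAt.comp (e x)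
      (hZ.differentiableAt (by simp)).hasFDerivAt).fderiv
    exact DFunLike.congr_fun this u
  -- Freezing Y at its value at the point kills the derivative term and identifies the sum in `key`
  -- with the Christoffel expression.
  have h0 := key (fun _ ↦ Y (e x)) contDiffAt_const
  rw [key Y hY]
  simp only [AffineConnection.christoffel, AffineConnection.along, coordField_eq_chartField] at h0 ⊢
  rw [h0]
  simp

end ChartFields

end InfoGeo

namespace InfoGeo

/-! ### Smooth coefficients of connection and metric; duality and curvature in coordinates. -/

section ConnectionCoefficients

open Set Filter Topology

/-- In finite dimension, smoothness of an operator-valued map can be tested on vectors. Off U the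
value is set to 0. -/
theorem exists_bilinear_contDiffOn {E F : Type*} [NormedAddCommGroup E] [NormedSpace ℝ E]
    [FiniteDimensional ℝ E] [NormedAddCommGroup F] [NormedSpace ℝ F] {B : E → E → E → F} {U : Set E}
    (hB : ∀ u v, ContDiffOn ℝ ∞ (fun y ↦ B y u v) U)
    (hadd : ∀ y ∈ U, ∀ u u' v, B y (u + u') v = B y u v + B y u' v)
    (hsmul : ∀ y ∈ U, ∀ (c : ℝ) u v, B y (c • u) v = c • B y u v)
    (hadd' : ∀ y ∈ U, ∀ u v v', B y u (v + v') = B y u v + B y u v')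
    (hsmul' : ∀ y ∈ U, ∀ (c : ℝ) u v, B y u (c • v) = c • B y u v) :
    ∃ Γ : E → E →L[ℝ] E →L[ℝ] F, ContDiffOn ℝ ∞ Γ U ∧ ∀ y ∈ U, ∀ u v, Γ y u v = B y u v := by
  classical
  let Γ : E → E →L[ℝ] E →L[ℝ] F := fun y ↦ if hy : y ∈ U then
    (LinearMap.mk₂ ℝ (B y) (hadd y hy) (hsmul y hy) (hadd' y hy)
      (hsmul' y hy)).toContinuousBilinearMap else 0
  have hΓ : ∀ y ∈ U, ∀ u v, Γ y u v = B y u v := fun y hy u v ↦ by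
    simp only [Γ, hy, dite_true]; rfl
  refine ⟨Γ, ?_, hΓ⟩
  rw [contDiffOn_clm_apply]
  intro u
  rw [contDiffOn_clm_apply]
  exact fun v ↦ (hB u v).congr fun y hy ↦ hΓ y hy u v

variable {d : ℕ} {M : Type*} [TopologicalSpace M] [ChartedSpace (EuclideanSpace ℝ (Fin d)) M]
  [IsManifold (𝓡 d) ∞ M]
  {e : OpenPartialHomeomorph M (EuclideanSpace ℝ (Fin d))}

theorem contMDiffAt_tangentMap_field (he : e ∈ IsManifold.maximalAtlas (𝓡 d) ∞ M) {x : M}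
    (hx : x ∈ e.source) {X : ∀ x : M, TangentSpace (𝓡 d) x}
    (hX : ContMDiffAt (𝓡 d) (𝓡 d).tangent ∞
      (fun y ↦ (⟨y, X y⟩ : TangentBundle (𝓡 d) M)) x) :
    ContMDiffAt (𝓡 d) (𝓡 d).tangent ∞ (fun y ↦ tangentMap (𝓡 d) (𝓡 d) e ⟨y, X y⟩) x := by
  have : IsManifold (𝓡 d) 1 M := IsManifold.of_le (n := ∞) (by simp)
  have h1 := (contMDiffOn_of_mem_maximalAtlas he).contMDiffOn_tangentMapWithin (m := ∞)
    (by simp) e.open_source.uniqueMDiffOn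
  have hopen : IsOpen ((Bundle.TotalSpace.proj : TangentBundle (𝓡 d) M → M) ⁻¹' e.source) :=
    e.open_source.preimage (FiberBundle.continuous_proj _ _)
  have h2 := (h1.contMDiffAt (x := (⟨x, X x⟩ : TangentBundle (𝓡 d) M)) (hopen.mem_nhds hx)).comp x hX
  refine h2.congr_of_eventuallyEq ?_
  filter_upwards [e.open_source.mem_nhds hx] with y hy
  exact (tangentMapWithin_eq_tangentMap (p := ⟨y, X y⟩) (e.open_source.uniqueMDiffOn y hy)
    ((mdifferentiable_of_mem_maximalAtlas he).mdifferentiableAt hy)).symm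

theorem contMDiffAt_mvfderiv_field (he : e ∈ IsManifold.maximalAtlas (𝓡 d) ∞ M) {x : M}
    (hx : x ∈ e.source) {X : ∀ x : M, TangentSpace (𝓡 d) x}
    (hX : ContMDiffAt (𝓡 d) (𝓡 d).tangent ∞
      (fun y ↦ (⟨y, X y⟩ : TangentBundle (𝓡 d) M)) x) :
    ContMDiffAt (𝓡 d) (𝓡 d) ∞ (fun y ↦ mvfderiv (𝓡 d) e y (X y)) x :=
  (contMDiff_snd_tangentBundle_modelSpace (EuclideanSpace ℝ (Fin d)) (𝓡 d)
    (n := ∞)).contMDiffAt.comp x (contMDiffAt_tangentMap_field he hx hX)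

open VectorField in
theorem mlieBracket_eq_lieBracket {E : Type*} [NormedAddCommGroup E] [NormedSpace ℝ E]
    (V W : ∀ x : E, TangentSpace 𝓘(ℝ, E) x) :
    mlieBracket 𝓘(ℝ, E) V W = lieBracket ℝ V W := by
  rw [← mlieBracketWithin_univ, mlieBracketWithin_eq_lieBracketWithin]
  exact lieBracketWithin_univ

open VectorField in
theorem mlieBracket_const {E : Type*} [NormedAddCommGroup E] [NormedSpace ℝ E] (u v x : E) :
    mlieBracket 𝓘(ℝ, E) (M := E) (fun _ ↦ u) (fun _ ↦ v) x = 0 := by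
  refine (congrFun (mlieBracket_eq_lieBracket (E := E) (fun _ ↦ u) (fun _ ↦ v)) x).trans ?_
  simp only [lieBracket, fderiv_fun_const, Pi.zero_apply, zero_apply, sub_self]
  rfl

open VectorField in
-- Coordinate fields are pullbacks of constant fields, and the Lie bracket commutes with pullback.
theorem mlieBracket_coordField (he : e ∈ IsManifold.maximalAtlas (𝓡 d) ∞ M) {x : M}
    (hx : x ∈ e.source) (u v : EuclideanSpace ℝ (Fin d)) :
    mlieBracket (𝓡 d) (coordField e u) (coordField e v) x = 0 := by
  have : IsManifold (𝓡 d) (minSmoothness ℝ 2) M :=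
    IsManifold.of_le (n := ∞) (by simpa using two_le_infty)
  have hc : ∀ w : EuclideanSpace ℝ (Fin d), MDifferentiableAt (𝓡 d) (𝓡 d).tangent
    (fun y : EuclideanSpace ℝ (Fin d) ↦
      (⟨y, w⟩ : TangentBundle (𝓡 d) (EuclideanSpace ℝ (Fin d)))) (e x) := fun w ↦
    (contMDiffAt_vectorSpace_iff_contDiffAt (n := ∞) (V := fun _ ↦ w)).2
      contDiffAt_const |>.mdifferentiableAt (by simp)
  have h := mpullback_mlieBracket (hc u) (hc v) (contMDiffAt_of_mem_maximalAtlas he hx)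
    (by simpa using two_le_infty)
  refine h.symm.trans ?_
  rw [mpullback_apply, mlieBracket_const, map_zero]

theorem contDiffOn_comp_chart_symm (he : e ∈ IsManifold.maximalAtlas (𝓡 d) ∞ M)
    {F : Type*} [NormedAddCommGroup F] [NormedSpace ℝ F] {f : M → F}
    (hf : ∀ x ∈ e.source, ContMDiffAt (𝓡 d) 𝓘(ℝ, F) ∞ f x) :
    ContDiffOn ℝ ∞ (fun y ↦ f (e.symm y)) e.target := by
  intro y hy
  have h := (hf (e.symm y) (e.map_target hy)).comp y (contMDiffAt_symm_of_mem_maximalAtlas he hy)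
  exact (contMDiffAt_iff_contDiffAt.1 h).contDiffWithinAt

variable (nabla : AffineConnection d M)

theorem contMDiffAt_along [T2Space M] (hnabla : nabla.IsSmoothTorsionFree)
    {U : Set M} (hU : IsOpen U) {x : M} (hx : x ∈ U) {X Y : ∀ x : M, TangentSpace (𝓡 d) x}
    (hX : ContMDiffOn (𝓡 d) (𝓡 d).tangent ∞
      (fun y ↦ (⟨y, X y⟩ : TangentBundle (𝓡 d) M)) U)
    (hY : ContMDiffOn (𝓡 d) (𝓡 d).tangent ∞
      (fun y ↦ (⟨y, Y y⟩ : TangentBundle (𝓡 d) M)) U) :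
    ContMDiffAt (𝓡 d) (𝓡 d).tangent ∞
      (fun y ↦ (⟨y, nabla.along X Y y⟩ : TangentBundle (𝓡 d) M)) x := by
  obtain ⟨Y', hY', hYY'⟩ := exists_isSmoothField_eventuallyEq hU hx hY
  have h1 := hnabla.smooth.contMDiff.contMDiff (σ := Y') (contMDiffOn_univ.2 hY')
  have h2 := (contMDiffOn_univ.1 h1).contMDiffAt (x := x)
  have h3 := h2.clm_bundle_apply (hX.contMDiffAt (hU.mem_nhds hx))
  refine h3.congr_of_eventuallyEq ?_
  filter_upwards [hYY'.eventually_nhds] with y hy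
  rw [AffineConnection.along, nabla_congr nabla (hY'.mdifferentiable (by simp) y) hy]

theorem contMDiffOn_coordField (he : e ∈ IsManifold.maximalAtlas (𝓡 d) ∞ M)
    (v : EuclideanSpace ℝ (Fin d)) : ContMDiffOn (𝓡 d) (𝓡 d).tangent ∞
      (fun y ↦ (⟨y, coordField e v y⟩ : TangentBundle (𝓡 d) M)) e.source :=
  fun _ hx ↦ (contMDiffAt_chartField he hx (Y := fun _ ↦ v) contDiffAt_const).contMDiffWithinAt

theorem contDiffOn_christoffel [T2Space M] (hnabla : nabla.IsSmoothTorsionFree)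
    (he : e ∈ IsManifold.maximalAtlas (𝓡 d) ∞ M) (u v : EuclideanSpace ℝ (Fin d)) :
    ContDiffOn ℝ ∞ (fun y ↦ nabla.christoffel e (e.symm y) u v) e.target :=
  contDiffOn_comp_chart_symm he (f := fun x ↦ nabla.christoffel e x u v) fun _ hx ↦
    contMDiffAt_mvfderiv_field he hx (contMDiffAt_along nabla hnabla e.open_source hx
      (contMDiffOn_coordField he u) (contMDiffOn_coordField he v))

theorem contMDiffAt_inner (g : RiemMetric d M) {x : M} {X Y : ∀ x : M, TangentSpace (𝓡 d) x}
    (hX : ContMDiffAt (𝓡 d) (𝓡 d).tangent ∞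
      (fun y ↦ (⟨y, X y⟩ : TangentBundle (𝓡 d) M)) x)
    (hY : ContMDiffAt (𝓡 d) (𝓡 d).tangent ∞
      (fun y ↦ (⟨y, Y y⟩ : TangentBundle (𝓡 d) M)) x) :
    ContMDiffAt (𝓡 d) 𝓘(ℝ, ℝ) ∞ (fun y ↦ g.inner y (X y) (Y y)) x := by
  have : ContMDiffAt (𝓡 d) ((𝓡 d).prod 𝓘(ℝ)) ∞
      (fun m ↦ Bundle.TotalSpace.mk' ℝ (E := Bundle.Trivial M ℝ) m (g.inner m (X m) (Y m))) x := by
    apply ContMDiffAt.clm_bundle_apply₂ (F₁ := EuclideanSpace ℝ (Fin d))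
      (F₂ := EuclideanSpace ℝ (Fin d))
    · exact g.contMDiff.contMDiffAt
    · exact hX
    · exact hY
  simp only [Bundle.contMDiffAt_totalSpace] at this
  exact this.2

theorem christoffel_add_right (he : e ∈ IsManifold.maximalAtlas (𝓡 d) ∞ M) {x : M}
    (hx : x ∈ e.source) (u v v' : EuclideanSpace ℝ (Fin d)) :
    nabla.christoffel e x u (v + v') = nabla.christoffel e x u v + nabla.christoffel e x u v' := by
  have h := nabla.isCovariantDerivativeOnUniv.add
    (mdifferentiableAt_chartField (M := M) he hx (Y := fun _ ↦ v) contDiffAt_const)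
    (mdifferentiableAt_chartField (M := M) he hx (Y := fun _ ↦ v') contDiffAt_const)
  have h2 : coordField (M := M) e (v + v') = chartField e (fun _ ↦ v) + chartField e (fun _ ↦ v') :=
    funext fun y ↦ coordField_add v v' y
  simp only [AffineConnection.christoffel, AffineConnection.along]
  rw [h2, h, add_apply, map_add]
  rfl

theorem christoffel_smul_right (he : e ∈ IsManifold.maximalAtlas (𝓡 d) ∞ M) {x : M}
    (hx : x ∈ e.source) (c : ℝ) (u v : EuclideanSpace ℝ (Fin d)) :
    nabla.christoffel e x u (c • v) = c • nabla.christoffel e x u v := by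
  have h := nabla.isCovariantDerivativeOnUniv.smul_const c
    (mdifferentiableAt_chartField (M := M) he hx (Y := fun _ ↦ v) contDiffAt_const)
  have h2 : coordField (M := M) e (c • v) = c • chartField e (fun _ ↦ v) :=
    funext fun y ↦ coordField_smul c v y
  simp only [AffineConnection.christoffel, AffineConnection.along]
  rw [h2, h, smul_apply, map_smul]
  rfl

theorem christoffel_symm (hnabla : nabla.IsSmoothTorsionFree)
    (he : e ∈ IsManifold.maximalAtlas (𝓡 d) ∞ M) {x : M}
    (hx : x ∈ e.source) (u v : EuclideanSpace ℝ (Fin d)) :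
    nabla.christoffel e x u v = nabla.christoffel e x v u := by
  have hu := mdifferentiableAt_chartField (M := M) he hx (Y := fun _ ↦ u) contDiffAt_const
  have hv := mdifferentiableAt_chartField (M := M) he hx (Y := fun _ ↦ v) contDiffAt_const
  have h := nabla.torsion_apply hu hv
  rw [hnabla.torsion_eq_zero] at h
  have h2 := mlieBracket_coordField (M := M) he hx u v
  rw [coordField_eq_chartField, coordField_eq_chartField] at h2
  rw [h2, sub_zero] at h
  exact congrArg (mvfderiv (𝓡 d) e x) (sub_eq_zero.1 h.symm)

theorem exists_christoffel_contDiffOn [T2Space M] (hnabla : nabla.IsSmoothTorsionFree)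
    (he : e ∈ IsManifold.maximalAtlas (𝓡 d) ∞ M) :
    ∃ Γ : EuclideanSpace ℝ (Fin d) →
        EuclideanSpace ℝ (Fin d) →L[ℝ] EuclideanSpace ℝ (Fin d) →L[ℝ] EuclideanSpace ℝ (Fin d),
      ContDiffOn ℝ ∞ Γ e.target ∧
        ∀ y ∈ e.target, ∀ u v, Γ y u v = nabla.christoffel e (e.symm y) u v :=
  exists_bilinear_contDiffOn (B := fun y u v ↦ nabla.christoffel e (e.symm y) u v)
    (contDiffOn_christoffel nabla hnabla he)
    (fun y _ u u' v ↦ by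
      simp only [AffineConnection.christoffel, AffineConnection.along, coordField_add, map_add])
    (fun y _ c u v ↦ by
      simp only [AffineConnection.christoffel, AffineConnection.along, coordField_smul, map_smul])
    (fun y hy u v v' ↦ christoffel_add_right nabla he (e.map_target hy) u v v')
    (fun y hy c u v ↦ christoffel_smul_right nabla he (e.map_target hy) c u v)

theorem exists_metric_contDiffOn (g : RiemMetric d M)
    (he : e ∈ IsManifold.maximalAtlas (𝓡 d) ∞ M) :
    ∃ G : EuclideanSpace ℝ (Fin d) →
        EuclideanSpace ℝ (Fin d) →L[ℝ] EuclideanSpace ℝ (Fin d) →L[ℝ] ℝ,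
      ContDiffOn ℝ ∞ G e.target ∧ ∀ y ∈ e.target, ∀ u v,
        G y u v = g.inner (e.symm y) (coordField e u (e.symm y)) (coordField e v (e.symm y)) :=
  exists_bilinear_contDiffOn (B := fun y u v ↦
      g.inner (e.symm y) (coordField e u (e.symm y)) (coordField e v (e.symm y)))
    (fun u v ↦ contDiffOn_comp_chart_symm he
      (f := fun x ↦ g.inner x (coordField e u x) (coordField e v x)) fun _ hx ↦
      contMDiffAt_inner g ((contMDiffOn_coordField he u).contMDiffAt (e.open_source.mem_nhds hx))
        ((contMDiffOn_coordField he v).contMDiffAt (e.open_source.mem_nhds hx)))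
    (fun y _ u u' v ↦ by simp only [coordField_add, map_add, add_apply])
    (fun y _ c u v ↦ by simp only [coordField_smul, map_smul, smul_apply])
    (fun y _ u v v' ↦ by simp only [coordField_add, map_add])
    (fun y _ c u v ↦ by simp only [coordField_smul, map_smul])

/-- The duality of two connections in coordinates. -/
theorem fderiv_metric_of_dual [T2Space M] (S : StatisticalStructure d M)
    (he : e ∈ IsManifold.maximalAtlas (𝓡 d) ∞ M)
    {G : EuclideanSpace ℝ (Fin d) →
      EuclideanSpace ℝ (Fin d) →L[ℝ] EuclideanSpace ℝ (Fin d) →L[ℝ] ℝ}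
    (hG : ContDiffOn ℝ ∞ G e.target)
    (hGe : ∀ y ∈ e.target, ∀ u v,
      G y u v = S.g.inner (e.symm y) (coordField e u (e.symm y)) (coordField e v (e.symm y)))
    {y : EuclideanSpace ℝ (Fin d)} (hy : y ∈ e.target) (w u v : EuclideanSpace ℝ (Fin d)) :
    fderiv ℝ G y w u v = G y (S.primal.christoffel e (e.symm y) w u) v
      + G y u (S.dual.christoffel e (e.symm y) w v) := by
  set x := e.symm y with hxdef
  have hx : x ∈ e.source := e.map_target hy
  have hyx : e x = y := e.right_inv hy
  obtain ⟨U, hU, hUu⟩ := exists_isSmoothField_eventuallyEq e.open_source hx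
    (contMDiffOn_coordField he u)
  obtain ⟨V, hV, hVv⟩ := exists_isSmoothField_eventuallyEq e.open_source hx
    (contMDiffOn_coordField he v)
  obtain ⟨W, hW, hWw⟩ := exists_isSmoothField_eventuallyEq e.open_source hx
    (contMDiffOn_coordField he w)
  have h := S.duality U V W hU hV hW x
  have hGd : DifferentiableAt ℝ G y :=
    (hG.contDiffAt (e.open_target.mem_nhds hy)).differentiableAt (by simp)
  have hloc : (fun z ↦ S.g.inner z (U z) (V z)) =ᶠ[𝓝 x] fun z ↦ G (e z) u v := by
    filter_upwards [hUu, hVv, e.open_source.mem_nhds hx] with z h1 h2 hz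
    rw [hGe _ (e.map_source hz), e.left_inv hz, h1, h2]
  have hd : HasFDerivAt (fun z ↦ G z u v) ((fderiv ℝ G y).flip u |>.flip v) y := by
    have h1 := (hGd.hasFDerivAt.clm_apply (hasFDerivAt_const u y))
    have h2 := h1.clm_apply (hasFDerivAt_const v y)
    convert! h2 using 1
    ext w
    simp
  have h3 : mvfderiv (𝓡 d) (fun z ↦ S.g.inner z (U z) (V z)) x (W x) = fderiv ℝ G y w u v := by
    have h4 : mvfderiv (𝓡 d) (fun z ↦ S.g.inner z (U z) (V z)) x (W x)
        = mvfderiv (𝓡 d) (fun z ↦ G (e z) u v) x (W x) :=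
      congrArg (fun L : TangentSpace (𝓡 d) x →L[ℝ] ℝ ↦ L (W x)) hloc.mfderiv_eq
    rw [h4, mvfderiv_comp_chart he hx (f := fun z ↦ G z u v) (hyx ▸ hd.differentiableAt), hyx,
      hWw.self_of_nhds, mvfderiv_coordField he hx, hd.fderiv]
    rfl
  rw [← h3, h, hGe y hy, hGe y hy]
  simp only [AffineConnection.along, AffineConnection.christoffel]
  rw [coordField_mvfderiv he hx, coordField_mvfderiv he hx,
    nabla_congr _ (hU.mdifferentiable (by simp) x) hUu,
    nabla_congr _ (hV.mdifferentiable (by simp) x) hVv,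
    hUu.self_of_nhds, hVv.self_of_nhds, hWw.self_of_nhds]

/-- The second covariant derivative of coordinate fields in coordinates. -/
theorem mvfderiv_along_along [T2Space M] (hnabla : nabla.IsSmoothTorsionFree)
    (he : e ∈ IsManifold.maximalAtlas (𝓡 d) ∞ M) {x : M} (hx : x ∈ e.source)
    {u v w : EuclideanSpace ℝ (Fin d)} {U V W : ∀ x : M, TangentSpace (𝓡 d) x}
    (hU : U x = coordField e u x) (hV : IsSmoothField V) (hVv : ∀ᶠ y in 𝓝 x, V y = coordField e v y)
    (hW : IsSmoothField W) (hWw : ∀ᶠ y in 𝓝 x, W y = coordField e w y) :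
    mvfderiv (𝓡 d) e x (nabla.along U (nabla.along V W) x)
      = fderiv ℝ (fun z ↦ nabla.christoffel e (e.symm z) v w) (e x) u
        + nabla.christoffel e x u (nabla.christoffel e x v w) := by
  -- Near x, ∇_V W is again a chart field, with components Γ(v, w), so the coordinate formula for ∇
  -- applies a second time.
  have hloc : ∀ᶠ y in 𝓝 x, nabla.along V W y
      = chartField e (fun z ↦ nabla.christoffel e (e.symm z) v w) y := by
    filter_upwards [hVv, hWw.eventually_nhds, e.open_source.mem_nhds hx] with y h1 h2 hy
    simp only [chartField]
    rw [e.left_inv hy, AffineConnection.christoffel, coordField_mvfderiv he hy,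
      AffineConnection.along, AffineConnection.along, h1,
      nabla_congr _ (hW.mdifferentiable (by simp) y) h2]
  have hsm := contMDiffAt_along nabla hnabla isOpen_univ (mem_univ x) (contMDiffOn_univ.2 hV)
    (contMDiffOn_univ.2 hW)
  have hc := (contDiffOn_christoffel nabla hnabla he v w).contDiffAt
    (e.open_target.mem_nhds (e.map_source hx))
  have h := mvfderiv_nabla_chartField nabla he hx hc u
  rw [AffineConnection.along, nabla_congr _ (hsm.mdifferentiableAt (by simp)) hloc, hU, h,
    e.left_inv hx]

/-- The curvature equation in coordinates. -/
theorem christoffel_curvature_eq [T2Space M] (hnabla : nabla.IsSmoothTorsionFree)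
    (he : e ∈ IsManifold.maximalAtlas (𝓡 d) ∞ M) {g : RiemMetric d M} {k : ℝ}
    (hk : nabla.HasConstantCurvature g k) {x : M} (hx : x ∈ e.source)
    (u v w : EuclideanSpace ℝ (Fin d)) :
    fderiv ℝ (fun z ↦ nabla.christoffel e (e.symm z) v w) (e x) u
        - fderiv ℝ (fun z ↦ nabla.christoffel e (e.symm z) u w) (e x) v
        + nabla.christoffel e x u (nabla.christoffel e x v w)
        - nabla.christoffel e x v (nabla.christoffel e x u w)
      = k • (g.inner x (coordField e v x) (coordField e w x) • u
        - g.inner x (coordField e u x) (coordField e w x) • v) := by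
  obtain ⟨U, hU, hUu⟩ := exists_isSmoothField_eventuallyEq e.open_source hx
    (contMDiffOn_coordField he u)
  obtain ⟨V, hV, hVv⟩ := exists_isSmoothField_eventuallyEq e.open_source hx
    (contMDiffOn_coordField he v)
  obtain ⟨W, hW, hWw⟩ := exists_isSmoothField_eventuallyEq e.open_source hx
    (contMDiffOn_coordField he w)
  have h := congrArg (mvfderiv (𝓡 d) e x) (hk U V W hU hV hW x)
  have hbr : VectorField.mlieBracket (𝓡 d) U V x = 0 := by
    rw [Filter.EventuallyEq.mlieBracket_vectorField_eq hUu hVv, mlieBracket_coordField he hx]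
  have hal : nabla.along (VectorField.mlieBracket (𝓡 d) U V) W x = 0 := by
    rw [AffineConnection.along, hbr, map_zero]
  simp only [AffineConnection.curvature, Pi.sub_apply] at h
  rw [hal, sub_zero, map_sub, map_smul, map_sub, map_smul, map_smul,
    mvfderiv_along_along nabla hnabla he hx hUu.self_of_nhds hV hVv hW hWw,
    mvfderiv_along_along nabla hnabla he hx hVv.self_of_nhds hU hUu hW hWw,
    hUu.self_of_nhds, hVv.self_of_nhds, hWw.self_of_nhds, mvfderiv_coordField he hx,
    mvfderiv_coordField he hx] at h
  rw [← h]
  abel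

end ConnectionCoefficients

end InfoGeo

namespace InfoGeo

/-! ### Invariance of the Hessian under change of chart. -/

section HessianTransfer

open Set Filter Topology

variable {d : ℕ} {M : Type*} [TopologicalSpace M] [ChartedSpace (EuclideanSpace ℝ (Fin d)) M]
  [IsManifold (𝓡 d) ∞ M]
  {e ξ : OpenPartialHomeomorph M (EuclideanSpace ℝ (Fin d))} (nabla : AffineConnection d M)
  {V : Type*} [NormedAddCommGroup V] [NormedSpace ℝ V]

/-- The coordinate expression of the Hessian `X(Y f) - (∇_X Y) f` of a function. -/
theorem hessian_eq_in_chart (he : e ∈ IsManifold.maximalAtlas (𝓡 d) ∞ M) {x : M}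
    (hx : x ∈ e.source) {f : M → V} {f' : EuclideanSpace ℝ (Fin d) → V}
    (hf' : ContDiffAt ℝ ∞ f' (e x)) (hf : ∀ᶠ y in 𝓝 x, f y = f' (e y))
    {Y : ∀ x : M, TangentSpace (𝓡 d) x}
    (hY : ContMDiffAt (𝓡 d) (𝓡 d).tangent ∞
      (fun y ↦ (⟨y, Y y⟩ : TangentBundle (𝓡 d) M)) x) (w : TangentSpace (𝓡 d) x) :
    mvfderiv (𝓡 d) (fun y ↦ mvfderiv (𝓡 d) f y (Y y)) x w
        - mvfderiv (𝓡 d) f x (nabla Y x w)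
      = fderiv ℝ (fderiv ℝ f') (e x) (mvfderiv (𝓡 d) e x w) (mvfderiv (𝓡 d) e x (Y x))
        - fderiv ℝ f' (e x) (nabla.christoffel e x (mvfderiv (𝓡 d) e x w)
          (mvfderiv (𝓡 d) e x (Y x))) := by
  let Z : EuclideanSpace ℝ (Fin d) → EuclideanSpace ℝ (Fin d) :=
    fun z ↦ mvfderiv (𝓡 d) e (e.symm z) (Y (e.symm z))
  have hZx : Z (e x) = mvfderiv (𝓡 d) e x (Y x) := by simp only [Z]; rw [e.left_inv hx]
  have hZ : ContDiffAt ℝ ∞ Z (e x) := by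
    have h1 := contMDiffAt_mvfderiv_field he hx hY
    have h2 := contMDiffAt_symm_of_mem_maximalAtlas he (e.map_source hx)
    exact contMDiffAt_iff_contDiffAt.1
      (ContMDiffAt.comp_of_eq (I := 𝓡 d) (I' := 𝓡 d) (I'' := 𝓡 d)
        (g := fun y ↦ mvfderiv (𝓡 d) e y (Y y)) h1 h2 (e.left_inv hx))
  have hYZ : ∀ᶠ y in 𝓝 x, Y y = chartField e Z y := by
    filter_upwards [e.open_source.mem_nhds hx] with y hy
    exact (chartField_eq_of_fields he Y hy).symm
  have hd : ∀ y ∈ e.source, DifferentiableAt ℝ f' (e y) → f =ᶠ[𝓝 y] (fun y ↦ f' (e y)) →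
      ∀ w : TangentSpace (𝓡 d) y, mvfderiv (𝓡 d) f y w
        = fderiv ℝ f' (e y) (mvfderiv (𝓡 d) e y w) := by
    intro y hy hdy hfy w
    rw [← mvfderiv_comp_chart he hy hdy]
    exact congrArg (fun L : TangentSpace (𝓡 d) y →L[ℝ] V ↦ L w) hfy.mfderiv_eq
  have hdiff : ∀ᶠ y in 𝓝 x, DifferentiableAt ℝ f' (e y) := by
    have h1 : ∀ᶠ z in 𝓝 (e x), DifferentiableAt ℝ f' z := by
      filter_upwards [(hf'.of_le two_le_infty).eventually (by simp)] with z hz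
      exact hz.differentiableAt (by simp)
    exact (e.continuousAt hx).eventually h1
  have hYf : (fun y ↦ mvfderiv (𝓡 d) f y (Y y)) =ᶠ[𝓝 x]
      fun y ↦ (fun z ↦ fderiv ℝ f' z (Z z)) (e y) := by
    filter_upwards [hf.eventually_nhds, hdiff, e.open_source.mem_nhds hx] with y h1 h2 hy
    rw [hd y hy h2 h1]
    simp only [Z]
    rw [e.left_inv hy]
  have hf'' : ContDiffAt ℝ ∞ (fderiv ℝ f') (e x) := hf'.fderiv_right (by simp)
  have h2 : HasFDerivAt (fun z ↦ fderiv ℝ f' z (Z z)) _ (e x) :=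
    (hf''.differentiableAt (by simp)).hasFDerivAt.clm_apply
      (hZ.differentiableAt (by simp)).hasFDerivAt
  have h3 : mvfderiv (𝓡 d) (fun y ↦ mvfderiv (𝓡 d) f y (Y y)) x w
      = mvfderiv (𝓡 d) (fun y ↦ (fun z ↦ fderiv ℝ f' z (Z z)) (e y)) x w :=
    congrArg (fun L : TangentSpace (𝓡 d) x →L[ℝ] V ↦ L w) hYf.mfderiv_eq
  have h4 := mvfderiv_nabla_chartField nabla he hx hZ (mvfderiv (𝓡 d) e x w)
  rw [coordField_mvfderiv he hx] at h4
  rw [h3, mvfderiv_comp_chart he hx h2.differentiableAt, h2.fderiv,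
    hd x hx (hf'.differentiableAt (by simp)) hf,
    nabla_congr nabla (hY.mdifferentiableAt (by simp)) hYZ, h4, ← hZx]
  -- The derivative of the components of Y occurs both in X(Y f) and in (∇_X Y) f, and cancels.
  simp only [add_apply, ContinuousLinearMap.flip_apply, ContinuousLinearMap.comp_apply, map_add]
  abel

/-- Both sides compute the same invariant X(Y f) - (∇_X Y) f, for the coordinate fields of ξ. -/
theorem hessian_transfer (he : e ∈ IsManifold.maximalAtlas (𝓡 d) ∞ M)
    (hξ : ξ ∈ IsManifold.maximalAtlas (𝓡 d) ∞ M) {x : M}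
    (hx : x ∈ e.source) (hxξ : x ∈ ξ.source) {f' f'' : EuclideanSpace ℝ (Fin d) → V}
    (hf' : ContDiffAt ℝ ∞ f' (e x)) (hf'' : ContDiffAt ℝ ∞ f'' (ξ x))
    (hf : ∀ᶠ y in 𝓝 x, f'' (ξ y) = f' (e y)) (u v : EuclideanSpace ℝ (Fin d)) :
    fderiv ℝ (fderiv ℝ f'') (ξ x) u v - fderiv ℝ f'' (ξ x) (nabla.christoffel ξ x u v)
      = fderiv ℝ (fderiv ℝ f') (e x) (mvfderiv (𝓡 d) e x (coordField ξ u x))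
          (mvfderiv (𝓡 d) e x (coordField ξ v x))
        - fderiv ℝ f' (e x) (nabla.christoffel e x (mvfderiv (𝓡 d) e x (coordField ξ u x))
          (mvfderiv (𝓡 d) e x (coordField ξ v x))) := by
  have hY := (contMDiffOn_coordField hξ v).contMDiffAt (ξ.open_source.mem_nhds hxξ)
  rw [← hessian_eq_in_chart nabla he hx hf' hf hY, hessian_eq_in_chart nabla hξ hxξ hf''
    (Eventually.of_forall fun _ ↦ rfl) hY, mvfderiv_coordField hξ hxξ, mvfderiv_coordField hξ hxξ]

/-- The equation `Hess f = -k g f` does not depend on the coordinate system. -/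
theorem hessian_equation_transfer (he : e ∈ IsManifold.maximalAtlas (𝓡 d) ∞ M)
    (hξ : ξ ∈ IsManifold.maximalAtlas (𝓡 d) ∞ M) (g : RiemMetric d M) {k : ℝ} {x : M}
    (hx : x ∈ e.source) (hxξ : x ∈ ξ.source) {f' f'' : EuclideanSpace ℝ (Fin d) → V}
    (hf' : ContDiffAt ℝ ∞ f' (e x)) (hf'' : ContDiffAt ℝ ∞ f'' (ξ x))
    (hf : ∀ᶠ y in 𝓝 x, f'' (ξ y) = f' (e y))
    (hH : ∀ u v, fderiv ℝ (fderiv ℝ f') (e x) u v = fderiv ℝ f' (e x) (nabla.christoffel e x u v)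
      - (k * g.inner x (coordField e u x) (coordField e v x)) • f' (e x))
    (u v : EuclideanSpace ℝ (Fin d)) :
    fderiv ℝ (fderiv ℝ f'') (ξ x) u v = fderiv ℝ f'' (ξ x) (nabla.christoffel ξ x u v)
      - (k * g.inner x (coordField ξ u x) (coordField ξ v x)) • f'' (ξ x) := by
  have h := hessian_transfer nabla he hξ hx hxξ hf' hf'' hf u v
  rw [hH, coordField_mvfderiv he hx, coordField_mvfderiv he hx, ← hf.self_of_nhds] at h
  rw [sub_eq_iff_eq_add.1 h]
  abel

end HessianTransfer

/-! ### Consequences of the Hessian equation for l and l z. -/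

section ProjectiveCoordinates

open Set Filter Topology

variable {E : Type*} [NormedAddCommGroup E] [NormedSpace ℝ E]

theorem fderiv_fderiv_apply {F : Type*} [NormedAddCommGroup F] [NormedSpace ℝ F] {f : E → F}
    {z : E} (hf : ContDiffAt ℝ ∞ f z) (u v : E) :
    fderiv ℝ (fderiv ℝ f) z u v = fderiv ℝ (fun y ↦ fderiv ℝ f y v) z u := by
  have hf' : ContDiffAt ℝ ∞ (fderiv ℝ f) z := hf.fderiv_right (by simp)
  have h := (hf'.differentiableAt (by simp)).hasFDerivAt.clm_apply (hasFDerivAt_const v z)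
  rw [h.fderiv]
  simp

theorem eventually_differentiableAt {F : Type*} [NormedAddCommGroup F] [NormedSpace ℝ F]
    {f : E → F} {z : E} (hf : ContDiffAt ℝ ∞ f z) : ∀ᶠ y in 𝓝 z, DifferentiableAt ℝ f y := by
  filter_upwards [(hf.of_le two_le_infty).eventually (by simp)] with y hy
  exact hy.differentiableAt (by simp)

/-- If `l` and `z ↦ l z • z` both satisfy the Hessian equation, then the connection is
projectively equivalent to the trivial one, and the Hessian of `1 / l` is a multiple of the
metric. -/
theorem hessian_homogeneous {l : E → ℝ} {z u v Γ : E} {c : ℝ} (hl : ContDiffAt ℝ ∞ l z)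
    (hpos : 0 < l z)
    (h1 : fderiv ℝ (fderiv ℝ l) z u v = fderiv ℝ l z Γ - c * l z)
    (h2 : fderiv ℝ (fderiv ℝ fun z ↦ l z • z) z u v
      = fderiv ℝ (fun z ↦ l z • z) z Γ - c • (l z • z)) :
    l z • Γ = fderiv ℝ l z u • v + fderiv ℝ l z v • u ∧
      l z * fderiv ℝ (fderiv ℝ l) z u v = 2 * fderiv ℝ l z u * fderiv ℝ l z v - c * l z ^ 2 ∧
      fderiv ℝ (fderiv ℝ fun z ↦ (l z)⁻¹) z u v = c * (l z)⁻¹ := by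
  have hev := eventually_differentiableAt hl
  have hl1 := (hl.differentiableAt (by simp)).hasFDerivAt
  have hl' : ContDiffAt ℝ ∞ (fderiv ℝ l) z := hl.fderiv_right (by simp)
  have hl2 : HasFDerivAt (fun y ↦ fderiv ℝ l y v) ((fderiv ℝ (fderiv ℝ l) z).flip v) z := by
    have h := (hl'.differentiableAt (by simp)).hasFDerivAt.clm_apply (hasFDerivAt_const v z)
    simpa using h
  have hD1 : ∀ y, DifferentiableAt ℝ l y → ∀ w,
      fderiv ℝ (fun z ↦ l z • z) y w = l y • w + fderiv ℝ l y w • y := by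
    intro y hy w
    have : HasFDerivAt (fun z ↦ l z • z) _ y := hy.hasFDerivAt.smul (hasFDerivAt_id y)
    rw [this.fderiv]
    simp
  have hD2 : fderiv ℝ (fderiv ℝ fun z ↦ l z • z) z u v
      = fderiv ℝ l z u • v + fderiv ℝ l z v • u + fderiv ℝ (fderiv ℝ l) z u v • z := by
    rw [fderiv_fderiv_apply (f := fun z ↦ l z • z) (hl.smul contDiffAt_id),
      Filter.EventuallyEq.fderiv_eq (hev.mono fun y hy ↦ hD1 y hy v)]
    have : HasFDerivAt (fun y ↦ l y • v + fderiv ℝ l y v • y) _ z :=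
      (hl1.smul_const v).add (hl2.smul (hasFDerivAt_id z))
    rw [this.fderiv]
    simp [add_assoc]
  -- Subtract z times the equation for l from the equation for l z; the terms in c and in dl(Γ) z
  -- disappear.
  have hΓ : l z • Γ = fderiv ℝ l z u • v + fderiv ℝ l z v • u := by
    rw [hD2, hD1 z hl1.differentiableAt, h1] at h2
    linear_combination (norm := module) -h2
  -- Applying dl gives l dl(Γ) = 2 dl(u) dl(v), which eliminates Γ from the equation for l.
  have hΓ' := congrArg (fderiv ℝ l z) hΓ
  simp only [map_add, map_smul, smul_eq_mul] at hΓ'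
  refine ⟨hΓ, by rw [h1]; linear_combination hΓ', ?_⟩
  have hne : ∀ᶠ y in 𝓝 z, l y ≠ 0 := hl.continuousAt.eventually_ne hpos.ne'
  have hI1 : ∀ᶠ y in 𝓝 z, fderiv ℝ (fun z ↦ (l z)⁻¹) y v = -((l y) ^ 2)⁻¹ * fderiv ℝ l y v := by
    filter_upwards [hev, hne] with y hy hy0
    have : HasFDerivAt (fun z ↦ (l z)⁻¹) _ y := (hasDerivAt_inv hy0).comp_hasFDerivAt y hy.hasFDerivAt
    rw [this.fderiv]
    simp
  rw [fderiv_fderiv_apply (f := fun z ↦ (l z)⁻¹) (hl.inv hpos.ne'), Filter.EventuallyEq.fderiv_eq hI1]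
  have hsq : HasFDerivAt (fun y ↦ -((l y) ^ 2)⁻¹ * fderiv ℝ l y v) _ z :=
    ((hasDerivAt_inv (pow_ne_zero 2 hpos.ne')).comp_hasFDerivAt z (hl1.pow 2)).neg.mul hl2
  rw [hsq.fderiv]
  simp
  rw [h1]
  field_simp
  linear_combination -hΓ'

/-- Unparametrized geodesics of a connection that is projectively equivalent to the trivial one by
an exact form are lines. -/
theorem isReparametrizedLineOn_of_geodesic {d : ℕ} {c : ℝ → EuclideanSpace ℝ (Fin d)} {J : Set ℝ}
    (hJ : J.OrdConnected) (hJ' : J.Nontrivial) (hc : ContDiffOn ℝ ∞ c J)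
    {l : EuclideanSpace ℝ (Fin d) → ℝ} {T : Set (EuclideanSpace ℝ (Fin d))} (hT : IsOpen T)
    (hl : ContDiffOn ℝ ∞ l T) (hpos : ∀ z ∈ T, 0 < l z) (hcT : ∀ t ∈ J, c t ∈ T)
    (heq : ∀ t ∈ J, l (c t) • derivWithin (derivWithin c J) J t
      + (2 * fderiv ℝ l (c t) (derivWithin c J t)) • derivWithin c J t = 0) :
    IsReparametrizedLineOn c J := by
  obtain ⟨a, ha, b, hb, hab⟩ := hJ'.exists_lt
  have hconv : Convex ℝ J := hJ.convex
  have hint : (interior J).Nonempty :=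
    (nonempty_Ioo.2 hab).mono (interior_maximal (Ioo_subset_Icc_self.trans (hJ.out ha hb)) isOpen_Ioo)
  have hU : UniqueDiffOn ℝ J := uniqueDiffOn_convex hconv hint
  have hconst : ∀ {p : ℝ → EuclideanSpace ℝ (Fin d)}, (∀ t ∈ J, HasDerivWithinAt p 0 J t) →
      ∀ t ∈ J, p t = p a := by
    intro p hp t ht
    refine hconv.is_const_of_fderivWithin_eq_zero (𝕜 := ℝ) (fun t ht ↦
      (hp t ht).differentiableWithinAt) (fun t ht ↦ ?_) ht ha
    have := (hp t ht).hasFDerivWithinAt.fderivWithin (hU t ht)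
    simpa using this
  have hc1 : ∀ t ∈ J, HasDerivWithinAt c (derivWithin c J t) J t := fun t ht ↦
    ((hc t ht).differentiableWithinAt (by simp)).hasDerivWithinAt
  have hc' : ContDiffOn ℝ ∞ (derivWithin c J) J := hc.derivWithin hU (by simp)
  have hc2 : ∀ t ∈ J, HasDerivWithinAt (derivWithin c J) (derivWithin (derivWithin c J) J t) J t :=
    fun t ht ↦ ((hc' t ht).differentiableWithinAt (by simp)).hasDerivWithinAt
  have hlc : ∀ t ∈ J, HasDerivWithinAt (fun t ↦ l (c t))
      (fderiv ℝ l (c t) (derivWithin c J t)) J t := fun t ht ↦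
    ((hl.contDiffAt (hT.mem_nhds (hcT t ht))).differentiableAt
      (by simp)).hasFDerivAt.comp_hasDerivWithinAt t (hc1 t ht)
  -- The geodesic equation l c'' + 2 dl(c') c' = 0, multiplied by l, says that l² c' is constant. So
  -- h' = l⁻² once this constant is taken as the direction v.
  set v := l (c a) ^ 2 • derivWithin c J a with hv
  have hvel : ∀ t ∈ J, l (c t) ^ 2 • derivWithin c J t = v := by
    refine fun t ht ↦ hconst (p := fun t ↦ l (c t) ^ 2 • derivWithin c J t) (fun t ht ↦ ?_) t ht
    have h : HasDerivWithinAt (fun t ↦ l (c t) ^ 2 • derivWithin c J t) _ J t :=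
      ((hlc t ht).pow 2).smul (hc2 t ht)
    refine h.congr_deriv ?_
    have := congrArg (fun w ↦ l (c t) • w) (heq t ht)
    simp only [smul_add, smul_zero, smul_smul] at this
    rw [← this]
    simp only [Pi.pow_apply]
    module
  have hvel' : ∀ t ∈ J, derivWithin c J t = (l (c t) ^ 2)⁻¹ • v := fun t ht ↦ by
    rw [← hvel t ht, inv_smul_smul₀ (pow_ne_zero 2 (hpos _ (hcT t ht)).ne')]
  by_cases hv0 : v = 0
  -- A constant curve: with direction 0, any increasing h will do.
  · refine ⟨c a, 0, id, contDiffOn_id, fun t ht ↦ ?_, fun t ht ↦ ?_⟩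
    · rw [derivWithin_id _ _ (hU t ht)]; exact one_pos
    · rw [smul_zero, add_zero]
      refine hconst (fun t ht ↦ ?_) t ht
      have := hc1 t ht
      rwa [hvel' t ht, hv0, smul_zero] at this
  · have hvv : 0 < ‖v‖ ^ 2 := by positivity
    -- Reading h off the curve by projection onto v avoids integrating l⁻² and makes its smoothness
    -- immediate.
    have hh : ∀ t ∈ J, HasDerivWithinAt (fun t ↦ (‖v‖ ^ 2)⁻¹ * inner ℝ v (c t - c a))
        ((l (c t) ^ 2)⁻¹) J t := by
      intro t ht
      have h1 := ((innerSL ℝ v).hasFDerivAt.comp_hasDerivWithinAt t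
        ((hc1 t ht).sub_const (c a))).const_mul ((‖v‖ ^ 2)⁻¹)
      refine h1.congr_deriv ?_
      rw [hvel' t ht, map_smul, innerSL_apply_apply, real_inner_self_eq_norm_sq, smul_eq_mul]
      field_simp
    refine ⟨c a, v, fun t ↦ (‖v‖ ^ 2)⁻¹ * inner ℝ v (c t - c a), ?_, fun t ht ↦ ?_, fun t ht ↦ ?_⟩
    · exact contDiffOn_const.mul (contDiffOn_const.inner ℝ (hc.sub contDiffOn_const))
    · rw [(hh t ht).derivWithin (hU t ht)]
      have := hpos _ (hcT t ht)
      positivity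
    · have h := hconst (p := fun t ↦ c t - ((‖v‖ ^ 2)⁻¹ * inner ℝ v (c t - c a)) • v)
        (fun t ht ↦ ?_) t ht
      · simp only [sub_self, inner_zero_right, mul_zero, zero_smul, sub_zero] at h
        exact eq_add_of_sub_eq h
      · have h1 := (hc1 t ht).sub ((hh t ht).smul_const v)
        rwa [hvel' t ht, sub_self] at h1

/-- With φ = -(1/α) log l, direct computation gives D²φ + α dφ dφ = (2 dl dl - l D²l) / (α l²), and
the hypothesis evaluates the numerator. -/
theorem expHessian_neg_log {d : ℕ} {l : EuclideanSpace ℝ (Fin d) → ℝ}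
    {z : EuclideanSpace ℝ (Fin d)} {α c : ℝ} (hα : 0 < α) {i j : Fin d}
    (hl : ContDiffAt ℝ ∞ l z) (hpos : 0 < l z)
    (h : l z * fderiv ℝ (fderiv ℝ l) z (EuclideanSpace.single i 1) (EuclideanSpace.single j 1)
      = 2 * fderiv ℝ l z (EuclideanSpace.single i 1) * fderiv ℝ l z (EuclideanSpace.single j 1)
        - c * l z ^ 2) :
    expHessian α (fun z ↦ -(1 / α) * Real.log (l z)) z i j = c / α := by
  have hev := eventually_differentiableAt hl
  have hne : ∀ᶠ y in 𝓝 z, l y ≠ 0 := hl.continuousAt.eventually_ne hpos.ne'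
  have hl1 := (hl.differentiableAt (by simp)).hasFDerivAt
  have hl' : ContDiffAt ℝ ∞ (fderiv ℝ l) z := hl.fderiv_right (by simp)
  have hI : ∀ w, ∀ᶠ y in 𝓝 z, fderiv ℝ (fun z ↦ -(1 / α) * Real.log (l z)) y w
      = -(1 / α) * ((l y)⁻¹ * fderiv ℝ l y w) := by
    intro w
    filter_upwards [hev, hne] with y hy hy0
    rw [((hy.hasFDerivAt.log hy0).const_mul (-(1 / α))).fderiv]
    simp
  have hl2 := (hl'.differentiableAt (by simp)).hasFDerivAt.clm_apply
    (hasFDerivAt_const (EuclideanSpace.single j (1 : ℝ)) z)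
  have h2 : HasFDerivAt
      (fun y ↦ -(1 / α) * ((l y)⁻¹ * fderiv ℝ l y (EuclideanSpace.single j (1 : ℝ)))) _ z :=
    (((hasDerivAt_inv hpos.ne').comp_hasFDerivAt z hl1).mul hl2).const_mul _
  simp only [expHessian, pderiv]
  rw [show fderiv ℝ (pderiv j fun z ↦ -(1 / α) * Real.log (l z)) z = _ from
    Filter.EventuallyEq.fderiv_eq (hI (EuclideanSpace.single j 1)), h2.fderiv, (hI _).self_of_nhds, (hI _).self_of_nhds]
  simp
  field_simp
  linear_combination -h

end ProjectiveCoordinates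

end InfoGeo

namespace InfoGeo

/-! ### Projective coordinates q/p and their potential. -/

section HomogeneousCoordinates

open Set Filter Topology

variable {d : ℕ} {M : Type*} [TopologicalSpace M] [ChartedSpace (EuclideanSpace ℝ (Fin d)) M]
  [IsManifold (𝓡 d) ∞ M]
  {e ξ : OpenPartialHomeomorph M (EuclideanSpace ℝ (Fin d))} (nabla : AffineConnection d M)

theorem trans_mem_maximalAtlas (he : e ∈ IsManifold.maximalAtlas (𝓡 d) ∞ M)
    {θ : OpenPartialHomeomorph (EuclideanSpace ℝ (Fin d)) (EuclideanSpace ℝ (Fin d))}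
    (hθ : ContDiffOn ℝ ∞ θ θ.source) (hθ' : ContDiffOn ℝ ∞ θ.symm θ.target) :
    e.trans θ ∈ IsManifold.maximalAtlas (𝓡 d) ∞ M := by
  refine OpenPartialHomeomorph.mem_maximalAtlas_of_contMDiffOn _ ?_ ?_
  · exact (contMDiffOn_iff_contDiffOn.2 hθ).comp' (contMDiffOn_of_mem_maximalAtlas he) |>.mono
      (by rw [OpenPartialHomeomorph.trans_source])
  · exact (contMDiffOn_symm_of_mem_maximalAtlas he).comp' (contMDiffOn_iff_contDiffOn.2 hθ') |>.mono
      (by rw [OpenPartialHomeomorph.trans_target])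

/-- Consequences of the Hessian equation for `l` and `z ↦ l z • z` in the coordinates `ξ`. -/
theorem of_homogeneous_hessian (hξ : ξ ∈ IsManifold.maximalAtlas (𝓡 d) ∞ M)
    (g : RiemMetric d M) {k α : ℝ} (hα : 0 < α) {l : EuclideanSpace ℝ (Fin d) → ℝ}
    (hl : ContDiffOn ℝ ∞ l ξ.target) (hpos : ∀ z ∈ ξ.target, 0 < l z)
    (h1 : ∀ x ∈ ξ.source, ∀ u v, fderiv ℝ (fderiv ℝ l) (ξ x) u v
      = fderiv ℝ l (ξ x) (nabla.christoffel ξ x u v)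
        - (k * g.inner x (coordField ξ u x) (coordField ξ v x)) * l (ξ x))
    (h2 : ∀ x ∈ ξ.source, ∀ u v, fderiv ℝ (fderiv ℝ fun z ↦ l z • z) (ξ x) u v
      = fderiv ℝ (fun z ↦ l z • z) (ξ x) (nabla.christoffel ξ x u v)
        - (k * g.inner x (coordField ξ u x) (coordField ξ v x)) • (l (ξ x) • ξ x)) :
    nabla.GeodesicsAreLinesIn ξ ∧
      ContDiffOn ℝ ∞ (fun z ↦ -(1 / α) * Real.log (l z)) ξ.target ∧
      (∀ x ∈ ξ.source, ∀ i j, expHessian α (fun z ↦ -(1 / α) * Real.log (l z)) (ξ x) i j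
        = k / α * metricCoeff g ξ x i j) ∧
      (Convex ℝ ξ.target → k ≤ 0 →
        ExpConcaveOn α ξ.target fun z ↦ -(1 / α) * Real.log (l z)) ∧
      (Convex ℝ ξ.target → 0 ≤ k →
        ExpConvexOn α ξ.target fun z ↦ -(1 / α) * Real.log (l z)) := by
  have hlx : ∀ z ∈ ξ.target, ContDiffAt ℝ ∞ l z := fun z hz ↦
    hl.contDiffAt (ξ.open_target.mem_nhds hz)
  have key := fun x (hx : x ∈ ξ.source) u v ↦ hessian_homogeneous (hlx _ (ξ.map_source hx))
    (hpos _ (ξ.map_source hx)) (h1 x hx u v) (h2 x hx u v)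
  have hexp : ∀ z ∈ ξ.target, Real.exp (α * (-(1 / α) * Real.log (l z))) = (l z)⁻¹ := by
    intro z hz
    rw [← mul_assoc, mul_neg, mul_one_div_cancel hα.ne', neg_one_mul, Real.exp_neg,
      Real.exp_log (hpos z hz)]
  have hinv : ContDiffOn ℝ ∞ (fun z ↦ (l z)⁻¹) ξ.target := hl.inv fun z hz ↦ (hpos z hz).ne'
  -- As e^{αφ} = 1/l, its Hessian is k times the nonnegative quantity g(v, v)/l; the sign of k
  -- decides between concave and convex.
  have hinv2 : ∀ z ∈ ξ.target, ∀ v, ∃ c, 0 ≤ c ∧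
      fderiv ℝ (fderiv ℝ fun z ↦ (l z)⁻¹) z v v = k * c := by
    intro z hz v
    have h := (key (ξ.symm z) (ξ.map_target hz) v v).2.2
    rw [ξ.right_inv hz] at h
    refine ⟨g.inner (ξ.symm z) (coordField ξ v (ξ.symm z)) (coordField ξ v (ξ.symm z)) * (l z)⁻¹,
      mul_nonneg ?_ (inv_nonneg.2 (hpos z hz).le), by rw [h]; ring⟩
    by_cases h0 : coordField ξ v (ξ.symm z) = 0
    · rw [h0]; simp
    · exact (g.pos _ _ h0).le
  refine ⟨fun γ J hγ hJξ ↦ ?_, ?_, fun x hx i j ↦ ?_, fun hconv hk ↦ ?_, fun hconv hk ↦ ?_⟩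
  · refine isReparametrizedLineOn_of_geodesic hγ.ordConnected hγ.nontrivial ?_ ξ.open_target hl hpos
      (fun t ht ↦ ξ.map_source (hJξ t ht)) fun t ht ↦ ?_
    · exact contMDiffOn_iff_contDiffOn.1
        ((contMDiffOn_of_mem_maximalAtlas hξ).comp hγ.smooth hJξ)
    · have h := hγ.equation t ht ξ hξ (hJξ t ht)
      have h' := (key (γ t) (hJξ t ht) (derivWithin (fun s ↦ ξ (γ s)) J t)
        (derivWithin (fun s ↦ ξ (γ s)) J t)).1
      rw [eq_neg_of_add_eq_zero_left h, smul_neg, h']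
      module
  · exact contDiffOn_const.mul (hl.log fun z hz ↦ (hpos z hz).ne')
  · rw [expHessian_neg_log hα (hlx _ (ξ.map_source hx)) (hpos _ (ξ.map_source hx))
      (key x hx _ _).2.1, metricCoeff]
    ring
  · refine (concaveOn_of_hessian_nonpos ξ.open_target hconv hinv fun z hz v ↦ ?_).congr
      fun z hz ↦ (hexp z hz).symm
    obtain ⟨c, hc, h⟩ := hinv2 z hz v
    rw [h]
    exact mul_nonpos_of_nonpos_of_nonneg hk hc
  · refine (convexOn_of_hessian_nonneg ξ.open_target hconv hinv fun z hz v ↦ ?_).congr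
      fun z hz ↦ (hexp z hz).symm
    obtain ⟨c, hc, h⟩ := hinv2 z hz v
    rw [h]
    exact mul_nonneg hk hc

/-- A solution `(p, q)` of the Hessian equation in the coordinates `e` gives projective coordinates
`q / p`. -/
theorem of_hessian_solution (he : e ∈ IsManifold.maximalAtlas (𝓡 d) ∞ M)
    (g : RiemMetric d M) {k α : ℝ} (hα : 0 < α) {p : EuclideanSpace ℝ (Fin d) → ℝ}
    {q : EuclideanSpace ℝ (Fin d) → EuclideanSpace ℝ (Fin d)}
    {θ : OpenPartialHomeomorph (EuclideanSpace ℝ (Fin d)) (EuclideanSpace ℝ (Fin d))}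
    (hθe : θ.source ⊆ e.target) (hp : ContDiffOn ℝ ∞ p θ.source) (hq : ContDiffOn ℝ ∞ q θ.source)
    (hpos : ∀ y ∈ θ.source, 0 < p y) (hθ : ∀ y ∈ θ.source, θ y = (p y)⁻¹ • q y)
    (hθ' : ContDiffOn ℝ ∞ θ.symm θ.target) (hconv : Convex ℝ θ.target)
    (h1 : ∀ y ∈ θ.source, ∀ u v, fderiv ℝ (fderiv ℝ p) y u v
      = fderiv ℝ p y (nabla.christoffel e (e.symm y) u v) - (k * g.inner (e.symm y)
        (coordField e u (e.symm y)) (coordField e v (e.symm y))) * p y)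
    (h2 : ∀ y ∈ θ.source, ∀ u v, fderiv ℝ (fderiv ℝ q) y u v
      = fderiv ℝ q y (nabla.christoffel e (e.symm y) u v) - (k * g.inner (e.symm y)
        (coordField e u (e.symm y)) (coordField e v (e.symm y))) • q y) :
    e.trans θ ∈ IsManifold.maximalAtlas (𝓡 d) ∞ M ∧ (e.trans θ).target = θ.target ∧
      nabla.GeodesicsAreLinesIn (e.trans θ) ∧
      ∃ φ : EuclideanSpace ℝ (Fin d) → ℝ, ContDiffOn ℝ ∞ φ θ.target ∧
        (∀ y ∈ θ.source, φ (θ y) = -(1 / α) * Real.log (p y)) ∧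
        (∀ x ∈ (e.trans θ).source, ∀ i j, expHessian α φ (e.trans θ x) i j
          = k / α * metricCoeff g (e.trans θ) x i j) ∧
        (k ≤ 0 → ExpConcaveOn α θ.target φ) ∧ (0 ≤ k → ExpConvexOn α θ.target φ) := by
  have htgt : (e.trans θ).target = θ.target := by
    rw [OpenPartialHomeomorph.trans_target]
    exact inter_eq_left.2 fun z hz ↦ hθe (θ.map_target hz)
  have hθs : ContDiffOn ℝ ∞ θ θ.source :=
    ((hp.inv fun y hy ↦ (hpos y hy).ne').smul hq).congr hθ
  have hξ := trans_mem_maximalAtlas he hθs hθ'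
  -- In the coordinates z = q/p the solution (p, q) becomes (l, l z), the homogeneous form treated
  -- above.
  set l : EuclideanSpace ℝ (Fin d) → ℝ := fun z ↦ p (θ.symm z) with hldef
  have hl : ContDiffOn ℝ ∞ l θ.target := hp.comp hθ' fun z hz ↦ θ.map_target hz
  have hlz : ContDiffOn ℝ ∞ (fun z ↦ l z • z) θ.target := hl.smul contDiffOn_id
  have hq' : ∀ y ∈ θ.source, q y = p y • θ y := fun y hy ↦ by
    rw [hθ y hy, smul_inv_smul₀ (hpos y hy).ne']
  have hsrc : ∀ x ∈ (e.trans θ).source, x ∈ e.source ∧ e x ∈ θ.source := fun x hx ↦ by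
    rwa [OpenPartialHomeomorph.trans_source] at hx
  have hnear : ∀ x ∈ (e.trans θ).source, ∀ᶠ y in 𝓝 x, e y ∈ θ.source := fun x hx ↦ by
    filter_upwards [(e.trans θ).open_source.mem_nhds hx] with y hy using (hsrc y hy).2
  have h := of_homogeneous_hessian nabla hξ g (k := k) hα (l := l) (by rwa [htgt])
    (fun z hz ↦ hpos _ (θ.map_target (htgt ▸ hz)))
    (fun x hx ↦ by
      obtain ⟨hxe, hxθ⟩ := hsrc x hx
      refine hessian_equation_transfer nabla he hξ g hxe hx (f' := p)
        (hp.contDiffAt (θ.open_source.mem_nhds hxθ))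
        (hl.contDiffAt (θ.open_target.mem_nhds (θ.map_source hxθ))) ?_ ?_
      · filter_upwards [hnear x hx] with y hy
        simp [hldef, θ.left_inv hy]
      · have := h1 (e x) hxθ
        rwa [e.left_inv hxe] at this)
    (fun x hx ↦ by
      obtain ⟨hxe, hxθ⟩ := hsrc x hx
      refine hessian_equation_transfer nabla he hξ g hxe hx (f' := q)
        (f'' := fun z ↦ l z • z) (hq.contDiffAt (θ.open_source.mem_nhds hxθ))
        (hlz.contDiffAt (θ.open_target.mem_nhds (θ.map_source hxθ))) ?_ ?_
      · filter_upwards [hnear x hx] with y hy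
        simp [hldef, θ.left_inv hy, hq' _ hy]
      · have := h2 (e x) hxθ
        rwa [e.left_inv hxe] at this)
  rw [htgt] at h
  refine ⟨hξ, htgt, h.1, fun z ↦ -(1 / α) * Real.log (l z), h.2.1, fun y hy ↦ ?_, h.2.2.1,
    h.2.2.2.1 hconv, h.2.2.2.2 hconv⟩
  simp [hldef, θ.left_inv hy]

end HomogeneousCoordinates

end InfoGeo

namespace InfoGeo

/-! ### The dual pair of coordinate systems. -/

section DualCoordinates

open Set Filter Topology

theorem isInvertible_of_injective {E : Type*} [NormedAddCommGroup E] [NormedSpace ℝ E]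
    [FiniteDimensional ℝ E] {L : E →L[ℝ] E} (hL : ∀ v, L v = 0 → v = 0) : L.IsInvertible :=
  ⟨(LinearEquiv.ofInjectiveEndo L.toLinearMap
    ((injective_iff_map_eq_zero L.toLinearMap).2 hL)).toContinuousLinearEquiv, by ext; rfl⟩

theorem hasFDerivAt_inv_smul {E F : Type*} [NormedAddCommGroup E] [NormedSpace ℝ E]
    [NormedAddCommGroup F] [NormedSpace ℝ F] {p : E → ℝ} {q : E → F} {x : E}
    (hp : DifferentiableAt ℝ p x) (hq : DifferentiableAt ℝ q x) (hpx : p x = 1) (hqx : q x = 0) :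
    HasFDerivAt (fun y ↦ (p y)⁻¹ • q y) (fderiv ℝ q x) x := by
  have h : HasFDerivAt (fun y ↦ (p y)⁻¹ • q y) _ x :=
    ((hasDerivAt_inv (by rw [hpx]; exact one_ne_zero)).comp_hasFDerivAt x hp.hasFDerivAt).smul
      hq.hasFDerivAt
  refine h.congr_fderiv ?_
  ext v
  simp [hpx, hqx]

theorem hessian_equation_clm {E V W : Type*} [NormedAddCommGroup E] [NormedSpace ℝ E]
    [NormedAddCommGroup V] [NormedSpace ℝ V] [NormedAddCommGroup W] [NormedSpace ℝ W]
    (J : V →L[ℝ] W) {f : E → V} {x u v Γ : E} {c : ℝ} (hf : ContDiffAt ℝ ∞ f x)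
    (h : fderiv ℝ (fderiv ℝ f) x u v = fderiv ℝ f x Γ - c • f x) :
    fderiv ℝ (fderiv ℝ fun y ↦ J (f y)) x u v = fderiv ℝ (fun y ↦ J (f y)) x Γ - c • J (f x) := by
  have hJ : ∀ y, DifferentiableAt ℝ f y → ∀ w,
      fderiv ℝ (fun y ↦ J (f y)) y w = J (fderiv ℝ f y w) := fun y hy w ↦ by
    have : HasFDerivAt (fun y ↦ J (f y)) _ y := J.hasFDerivAt.comp y hy.hasFDerivAt
    rw [this.fderiv]; rfl
  have hf' : ContDiffAt ℝ ∞ (fderiv ℝ f) x := hf.fderiv_right (by simp)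
  have h2 : HasFDerivAt (fun y ↦ fderiv ℝ f y v) ((fderiv ℝ (fderiv ℝ f) x).flip v) x := by
    have h := (hf'.differentiableAt (by simp)).hasFDerivAt.clm_apply (hasFDerivAt_const v x)
    simpa using h
  have h3 : HasFDerivAt (fun y ↦ J (fderiv ℝ f y v)) _ x := J.hasFDerivAt.comp x h2
  rw [fderiv_fderiv_apply (f := fun y ↦ J (f y)) (J.contDiff.contDiffAt.comp x hf),
    Filter.EventuallyEq.fderiv_eq ((eventually_differentiableAt hf).mono fun y hy ↦ hJ y hy v),
    h3.fderiv, hJ x (hf.differentiableAt (by simp))]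
  simp [h]

variable {E : Type} [NormedAddCommGroup E] [InnerProductSpace ℝ E] [FiniteDimensional ℝ E]

/-- Duality rewrites the left side as G(u, Γ(w, v)) + G(w, Γ(u, v)) + G(v, Γ'(w, u)), which is
symmetric in u and w because Γ' is symmetric. -/
theorem codazzi_of_dual {Γ Γ' : E → E →L[ℝ] E →L[ℝ] E} {G : E → E →L[ℝ] E →L[ℝ] ℝ} {U : Set E}
    (hU : IsOpen U) (hG : ContDiffOn ℝ ∞ G U)
    (hΓsymm : ∀ x ∈ U, ∀ u v, Γ x u v = Γ x v u) (hΓ'symm : ∀ x ∈ U, ∀ u v, Γ' x u v = Γ' x v u)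
    (hGsymm : ∀ x ∈ U, ∀ u v, G x u v = G x v u)
    (hdual : ∀ x ∈ U, ∀ u v w, fderiv ℝ G x w u v = G x (Γ x w u) v + G x u (Γ' x w v)) :
    ∀ x ∈ U, ∀ u v w, fderiv ℝ G x w u v + G x w (Γ x u v)
      = fderiv ℝ G x u w v + G x u (Γ x w v) := by
  have hswap : ∀ x ∈ U, ∀ u v w, fderiv ℝ G x w u v = fderiv ℝ G x w v u := by
    intro x hx u v w
    have hd := ((hG.contDiffAt (hU.mem_nhds hx)).differentiableAt (by simp)).hasFDerivAt
    have h1 : ∀ u v, HasFDerivAt (fun z ↦ G z u v) ((fderiv ℝ G x).flip u |>.flip v) x := by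
      intro u v
      have h := (hd.clm_apply (hasFDerivAt_const u x)).clm_apply (hasFDerivAt_const v x)
      convert! h using 1
      ext w
      simp
    have h2 : (fun z ↦ G z u v) =ᶠ[𝓝 x] fun z ↦ G z v u := by
      filter_upwards [hU.mem_nhds hx] with z hz using hGsymm z hz u v
    have h3 := h2.fderiv_eq (𝕜 := ℝ)
    rw [(h1 u v).fderiv, (h1 v u).fderiv] at h3
    exact DFunLike.congr_fun h3 w
  intro x hx u v w
  rw [hswap x hx u v w, hswap x hx w v u, hdual x hx, hdual x hx, hΓ'symm x hx w u,
    hΓsymm x hx w v, hΓsymm x hx u v, hGsymm x hx w, hGsymm x hx u]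
  ring

/-- Riesz representation of the second component. Dividing Q by α makes the pairing of (p, q) with
its dual read p p' + α q·q'. -/
theorem exists_pairing {α : ℝ} (hα : α ≠ 0) :
    ∃ (P : (ℝ × E →L[ℝ] ℝ) →L[ℝ] ℝ) (Q : (ℝ × E →L[ℝ] ℝ) →L[ℝ] E),
      ∀ (m : ℝ × E →L[ℝ] ℝ) s y, m (s, y) = s * P m + α * inner ℝ y (Q m) := by
  refine ⟨ContinuousLinearMap.apply ℝ ℝ ((1, 0) : ℝ × E),
    α⁻¹ • ((InnerProductSpace.toDual ℝ E).symm.toContinuousLinearEquiv.toContinuousLinearMap ∘L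
      (ContinuousLinearMap.compL ℝ E (ℝ × E) ℝ).flip (ContinuousLinearMap.inr ℝ ℝ E)),
    fun m s y ↦ ?_⟩
  have h1 : α * inner ℝ y (α⁻¹ • (InnerProductSpace.toDual ℝ E).symm
      (m ∘L ContinuousLinearMap.inr ℝ ℝ E)) = m (0, y) := by
    rw [real_inner_smul_right, real_inner_comm, InnerProductSpace.toDual_symm_apply,
      mul_inv_cancel_left₀ hα]
    simp
  have h2 : ((s, y) : ℝ × E) = s • (1, 0) + (0, y) := by ext <;> simp
  rw [h2, map_add, map_smul, ← h1]
  rfl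

/-- Here (p, q) are the components of f and (p', q') those of its dual functional h, and the final
identity is h(f) = 1. The initial jet of f makes dξ the identity at 0, while dη there is k/α times
G, so it is invertible because k ≠ 0 and G is definite. -/
theorem exists_dual_coordinates {k α : ℝ} (hk : k ≠ 0) (hα : α ≠ 0)
    {Γ Γ' : E → E →L[ℝ] E →L[ℝ] E} {G : E → E →L[ℝ] E →L[ℝ] ℝ} {U : Set E}
    (hU : IsOpen U) (h0 : 0 ∈ U) (hΓ : ContDiffOn ℝ ∞ Γ U) (hG : ContDiffOn ℝ ∞ G U)
    (hΓsymm : ∀ x ∈ U, ∀ u v, Γ x u v = Γ x v u) (hΓ'symm : ∀ x ∈ U, ∀ u v, Γ' x u v = Γ' x v u)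
    (hGsymm : ∀ x ∈ U, ∀ u v, G x u v = G x v u) (hGpos : ∀ v, v ≠ 0 → 0 < G 0 v v)
    (hdual : ∀ x ∈ U, ∀ u v w, fderiv ℝ G x w u v = G x (Γ x w u) v + G x u (Γ' x w v))
    (hcurv : ∀ x ∈ U, ∀ u v w, fderiv ℝ Γ x u v w - fderiv ℝ Γ x v u w
      + Γ x u (Γ x v w) - Γ x v (Γ x u w) = k • (G x v w • u - G x u w • v)) :
    ∃ (p p' : E → ℝ) (q q' : E → E) (θ θ' : OpenPartialHomeomorph E E),
      0 ∈ θ.source ∧ θ.source = θ'.source ∧ θ.source ⊆ U ∧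
      (ContDiffOn ℝ ∞ p θ.source ∧ ContDiffOn ℝ ∞ q θ.source ∧
        (∀ y ∈ θ.source, 0 < p y) ∧ (∀ y ∈ θ.source, θ y = (p y)⁻¹ • q y) ∧
        ContDiffOn ℝ ∞ θ.symm θ.target ∧ Convex ℝ θ.target ∧
        (∀ y ∈ θ.source, ∀ u v, fderiv ℝ (fderiv ℝ p) y u v
          = fderiv ℝ p y (Γ y u v) - (k * G y u v) * p y) ∧
        (∀ y ∈ θ.source, ∀ u v, fderiv ℝ (fderiv ℝ q) y u v
          = fderiv ℝ q y (Γ y u v) - (k * G y u v) • q y)) ∧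
      (ContDiffOn ℝ ∞ p' θ.source ∧ ContDiffOn ℝ ∞ q' θ.source ∧
        (∀ y ∈ θ.source, 0 < p' y) ∧ (∀ y ∈ θ.source, θ' y = (p' y)⁻¹ • q' y) ∧
        ContDiffOn ℝ ∞ θ'.symm θ'.target ∧ Convex ℝ θ'.target ∧
        (∀ y ∈ θ.source, ∀ u v, fderiv ℝ (fderiv ℝ p') y u v
          = fderiv ℝ p' y (Γ' y u v) - (k * G y u v) * p' y) ∧
        (∀ y ∈ θ.source, ∀ u v, fderiv ℝ (fderiv ℝ q') y u v
          = fderiv ℝ q' y (Γ' y u v) - (k * G y u v) • q' y)) ∧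
      ∀ y ∈ θ.source, p y * p' y + α * inner ℝ (q y) (q' y) = 1 := by
  obtain ⟨f, r, hr, hrU, hf0, hdf0, hf, hfΓ⟩ := exists_hessian_solution hU h0 hΓ hG hΓsymm hGsymm
    (codazzi_of_dual hU hG hΓsymm hΓ'symm hGsymm hdual) hcurv ((1, 0) : ℝ × E) (ContinuousLinearMap.inr ℝ ℝ E)
  obtain ⟨h, r', hr', hr'r, hh, hh0, hhf⟩ := exists_dual_functional hr hf hf0 hdf0
  have hball : Metric.ball (0 : E) r' ⊆ Metric.ball 0 r := Metric.ball_subset_ball hr'r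
  have hballU := hball.trans hrU
  have hdh := dual_hessian_equation Metric.isOpen_ball (hG.mono hballU)
    (fun x hx ↦ hGsymm x (hballU hx)) (fun x hx ↦ hdual x (hballU hx)) (hf.mono hball)
    (fun x hx ↦ hfΓ x (hball hx)) hh (fun x hx ↦ (hhf x hx).1) (fun x hx ↦ (hhf x hx).2.1)
    (fun x hx ↦ (hhf x hx).2.2)
  obtain ⟨P, Q, hPQ⟩ := exists_pairing (E := E) hα
  let p : E → ℝ := fun y ↦ ContinuousLinearMap.fst ℝ ℝ E (f y)
  let q : E → E := fun y ↦ ContinuousLinearMap.snd ℝ ℝ E (f y)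
  let p' : E → ℝ := fun y ↦ P (h y)
  let q' : E → E := fun y ↦ Q (h y)
  have hsm : ContDiffOn ℝ ∞ p (Metric.ball 0 r') ∧ ContDiffOn ℝ ∞ q (Metric.ball 0 r') ∧
      ContDiffOn ℝ ∞ p' (Metric.ball 0 r') ∧ ContDiffOn ℝ ∞ q' (Metric.ball 0 r') :=
    ⟨(hf.mono hball).continuousLinearMap_comp _, (hf.mono hball).continuousLinearMap_comp _,
      hh.continuousLinearMap_comp _, hh.continuousLinearMap_comp _⟩
  obtain ⟨hp, hq, hp', hq'⟩ := hsm
  have hp0 : p 0 = 1 := by simp [p, hf0]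
  have hq0 : q 0 = 0 := by simp [q, hf0]
  have hp'0 : p' 0 = 1 := by
    have h1 := hPQ (h 0) 1 0
    simpa [hh0, p'] using h1.symm
  have hq'0 : q' 0 = 0 := by
    refine ext_inner_right ℝ fun y ↦ mul_left_cancel₀ hα ?_
    have h1 := hPQ (h 0) 0 y
    simpa [hh0, q', real_inner_comm] using h1.symm
  let N : Set E := (Metric.ball 0 r' ∩ p ⁻¹' Ioi 0) ∩ (Metric.ball 0 r' ∩ p' ⁻¹' Ioi 0)
  have hN : IsOpen N := (hp.continuousOn.isOpen_inter_preimage Metric.isOpen_ball isOpen_Ioi).inter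
    (hp'.continuousOn.isOpen_inter_preimage Metric.isOpen_ball isOpen_Ioi)
  have hNr : N ⊆ Metric.ball 0 r' := fun y hy ↦ hy.1.1
  have h0r : (0 : E) ∈ Metric.ball 0 r' := Metric.mem_ball_self hr'
  have h0N : 0 ∈ N := ⟨⟨h0r, by simp [hp0]⟩, ⟨h0r, by simp [hp'0]⟩⟩
  have hd : ∀ {F : Type} [NormedAddCommGroup F] [NormedSpace ℝ F] {f : E → F},
      ContDiffOn ℝ ∞ f (Metric.ball 0 r') → DifferentiableAt ℝ f 0 := fun hf ↦
    (hf.contDiffAt (Metric.isOpen_ball.mem_nhds h0r)).differentiableAt (by simp)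
  have hξd := hasFDerivAt_inv_smul (hd hp) (hd hq) hp0 hq0
  have hηd := hasFDerivAt_inv_smul (hd hp') (hd hq') hp'0 hq'0
  have hdq : ∀ v, fderiv ℝ q 0 v = v := fun v ↦ by
    have : HasFDerivAt q _ 0 :=
      (ContinuousLinearMap.snd ℝ ℝ E).hasFDerivAt.comp 0 (hd (hf.mono hball)).hasFDerivAt
    rw [this.fderiv, hdf0]
    simp
  -- This is the relation dh(v)(df u) = k G(u, v) at 0, where df u = (0, u).
  have hdq' : ∀ u v, α * inner ℝ (fderiv ℝ q' 0 v) u = k * G 0 u v := fun u v ↦ by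
    have : HasFDerivAt q' _ 0 := Q.hasFDerivAt.comp 0 (hd hh).hasFDerivAt
    rw [this.fderiv, ContinuousLinearMap.comp_apply, ← (hdh 0 h0r).2.1 u v, hdf0,
      ContinuousLinearMap.inr_apply, hPQ (fderiv ℝ h 0 v) 0 u, zero_mul, zero_add, real_inner_comm]
  obtain ⟨θ, θ', hθ0, hθθ', hθN, hθ, hθ', -, -, hθs, hθ's, hconv, hconv'⟩ :=
    exists_convex_charts (ξ := fun y ↦ (p y)⁻¹ • q y) (η := fun y ↦ (p' y)⁻¹ • q' y) hN h0N
      (((hp.mono hNr).inv fun y hy ↦ (ne_of_gt hy.1.2)).smul (hq.mono hNr))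
      (((hp'.mono hNr).inv fun y hy ↦ (ne_of_gt hy.2.2)).smul (hq'.mono hNr))
      (by simp [hq0])
      (isInvertible_of_injective fun v hv ↦ by rwa [hξd.fderiv, hdq] at hv)
      (isInvertible_of_injective fun v hv ↦ by
        rw [hηd.fderiv] at hv
        by_contra hne
        have h1 := hdq' v v
        rw [hv, inner_zero_left, mul_zero] at h1
        exact mul_ne_zero hk (hGpos v hne).ne' h1.symm)
  have hθr := hθN.trans hNr
  have hfc : ∀ y ∈ θ.source, ContDiffAt ℝ ∞ f y := fun y hy ↦
    hf.contDiffAt (Metric.isOpen_ball.mem_nhds (hball (hθr hy)))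
  have hhc : ∀ y ∈ θ.source, ContDiffAt ℝ ∞ h y := fun y hy ↦
    hh.contDiffAt (Metric.isOpen_ball.mem_nhds (hθr hy))
  refine ⟨p, p', q, q', θ, θ', hθ0, hθθ', hθr.trans hballU,
    ⟨hp.mono hθr, hq.mono hθr, fun y hy ↦ (hθN hy).1.2, fun y _ ↦ by rw [hθ], hθs, hconv,
      fun y hy u v ↦ hessian_equation_clm _ (hfc y hy) (hfΓ y (hball (hθr hy)) u v),
      fun y hy u v ↦ hessian_equation_clm _ (hfc y hy) (hfΓ y (hball (hθr hy)) u v)⟩,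
    ⟨hp'.mono hθr, hq'.mono hθr, fun y hy ↦ (hθN hy).2.2, fun y _ ↦ by rw [hθ'], hθ's, hconv',
      fun y hy u v ↦ hessian_equation_clm _ (hhc y hy) ((hdh y (hθr hy)).2.2 u v),
      fun y hy u v ↦ hessian_equation_clm _ (hhc y hy) ((hdh y (hθr hy)).2.2 u v)⟩,
    fun y hy ↦ ?_⟩
  rw [← (hhf y (hθr hy)).1]
  exact (hPQ (h y) (f y).1 (f y).2).symm

end DualCoordinates

end InfoGeo

namespace InfoGeo

/-! ### Assembly on the manifold, for any curvature k ≠ 0. -/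

section ProjectiveCoordinatesOfCurvature

open Set Filter Topology

variable {d : ℕ} {M : Type*} [TopologicalSpace M] [ChartedSpace (EuclideanSpace ℝ (Fin d)) M]
  [IsManifold (𝓡 d) ∞ M]

theorem exists_centered_chart (p : M) :
    ∃ e ∈ IsManifold.maximalAtlas (𝓡 d) ∞ M, p ∈ e.source ∧ e p = 0 := by
  refine ⟨(chartAt (EuclideanSpace ℝ (Fin d)) p).trans
    (Homeomorph.subRight (chartAt (EuclideanSpace ℝ (Fin d)) p p)).toOpenPartialHomeomorph,
    trans_mem_maximalAtlas (IsManifold.chart_mem_maximalAtlas p) ?_ ?_, ?_, ?_⟩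
  · exact (contDiff_id.sub contDiff_const).contDiffOn
  · exact (contDiff_id.add contDiff_const).contDiffOn
  · simp
  · simp

theorem exists_projective_coordinates [T2Space M] (S : StatisticalStructure d M) {k α : ℝ}
    (hα : 0 < α) (hk : k ≠ 0) (hcurv : S.primal.HasConstantCurvature S.g k) (x₀ : M) :
    ∃ ξ ∈ IsManifold.maximalAtlas (𝓡 d) ∞ M, ∃ η ∈ IsManifold.maximalAtlas (𝓡 d) ∞ M,
      x₀ ∈ ξ.source ∧ ξ.source = η.source ∧
      S.primal.GeodesicsAreLinesIn ξ ∧ S.dual.GeodesicsAreLinesIn η ∧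
      (∀ x ∈ ξ.source, 0 < 1 + α * ∑ l, ξ x l * η x l) ∧
      ∃ φ ψ : EuclideanSpace ℝ (Fin d) → ℝ,
        ContDiffOn ℝ ∞ φ ξ.target ∧ ContDiffOn ℝ ∞ ψ η.target ∧
        (k ≤ 0 → ExpConcaveOn α ξ.target φ ∧ ExpConcaveOn α η.target ψ) ∧
        (0 ≤ k → ExpConvexOn α ξ.target φ ∧ ExpConvexOn α η.target ψ) ∧
        (∀ x ∈ ξ.source,
          φ (ξ x) + ψ (η x) = 1 / α * Real.log (1 + α * ∑ l, ξ x l * η x l)) ∧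
        (∀ x ∈ ξ.source, ∀ i j : Fin d,
          expHessian α φ (ξ x) i j = k / α * metricCoeff S.g ξ x i j ∧
          expHessian α ψ (η x) i j = k / α * metricCoeff S.g η x i j) := by
  obtain ⟨e, he, hx₀, hex₀⟩ := exists_centered_chart (d := d) x₀
  obtain ⟨Γ, hΓ, hΓe⟩ := exists_christoffel_contDiffOn S.primal S.primal_smooth_torsionFree he
  obtain ⟨Γ', -, hΓ'e⟩ := exists_christoffel_contDiffOn S.dual S.dual_smooth_torsionFree he
  obtain ⟨G, hG, hGe⟩ := exists_metric_contDiffOn S.g he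
  have h0 : 0 ∈ e.target := hex₀ ▸ e.map_source hx₀
  have hcurv' : ∀ y ∈ e.target, ∀ u v w, fderiv ℝ Γ y u v w - fderiv ℝ Γ y v u w
      + Γ y u (Γ y v w) - Γ y v (Γ y u w) = k • (G y v w • u - G y u w • v) := by
    intro y hy u v w
    have hd : ∀ u v w, fderiv ℝ (fun z ↦ S.primal.christoffel e (e.symm z) v w) y u
        = fderiv ℝ Γ y u v w := by
      intro u v w
      have h1 := (((hΓ.contDiffAt (e.open_target.mem_nhds hy)).differentiableAt
        (by simp)).hasFDerivAt.clm_apply (hasFDerivAt_const v y)).clm_apply (hasFDerivAt_const w y)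
      have h2 : (fun z ↦ S.primal.christoffel e (e.symm z) v w) =ᶠ[𝓝 y] fun z ↦ Γ z v w := by
        filter_upwards [e.open_target.mem_nhds hy] with z hz using (hΓe z hz v w).symm
      rw [h2.fderiv_eq, h1.fderiv]
      simp
    have h := christoffel_curvature_eq S.primal S.primal_smooth_torsionFree he hcurv
      (e.map_target hy) u v w
    rw [e.right_inv hy, hd, hd] at h
    simpa only [hΓe y hy, hGe y hy] using h
  obtain ⟨p, p', q, q', θ, θ', hθ0, hθθ', hθe, ⟨hp, hq, hpos, hθ, hθs, hconv, hpH, hqH⟩,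
    ⟨hp', hq', hpos', hθ', hθ's, hconv', hp'H, hq'H⟩, hpq⟩ :=
    exists_dual_coordinates (Γ' := Γ') hk hα.ne' e.open_target h0 hΓ hG
      (fun y hy u v ↦ by
        rw [hΓe y hy, hΓe y hy, christoffel_symm _ S.primal_smooth_torsionFree he (e.map_target hy)])
      (fun y hy u v ↦ by
        rw [hΓ'e y hy, hΓ'e y hy, christoffel_symm _ S.dual_smooth_torsionFree he (e.map_target hy)])
      (fun y hy u v ↦ by rw [hGe y hy, hGe y hy, S.g.symm])
      (fun v hv ↦ by
        rw [hGe 0 h0]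
        refine S.g.pos _ _ fun h ↦ hv ?_
        rw [← mvfderiv_coordField he (e.map_target h0) v, h, map_zero])
      (fun y hy u v w ↦ by
        rw [fderiv_metric_of_dual S he hG hGe hy, hΓe y hy, hΓ'e y hy])
      hcurv'
  rw [hθθ'] at hp' hq' hpos' hθ' hp'H hq'H
  have hθ'e : θ'.source ⊆ e.target := hθθ' ▸ hθe
  obtain ⟨hξ, hξt, hξg, φ, hφ, hφp, hφH, hφc, hφc'⟩ := of_hessian_solution S.primal he S.g (k := k)
    hα hθe hp hq hpos hθ hθs hconv
    (fun y hy u v ↦ by rw [hpH y hy, hΓe y (hθe hy), hGe y (hθe hy)])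
    (fun y hy u v ↦ by rw [hqH y hy, hΓe y (hθe hy), hGe y (hθe hy)])
  obtain ⟨hη, hηt, hηg, ψ, hψ, hψp, hψH, hψc, hψc'⟩ := of_hessian_solution S.dual he S.g (k := k)
    hα hθ'e hp' hq' hpos' hθ' hθ's hconv'
    (fun y hy u v ↦ by rw [hp'H y hy, hΓ'e y (hθ'e hy), hGe y (hθ'e hy)])
    (fun y hy u v ↦ by rw [hq'H y hy, hΓ'e y (hθ'e hy), hGe y (hθ'e hy)])
  have hsource : (e.trans θ).source = (e.trans θ').source := by
    rw [OpenPartialHomeomorph.trans_source, OpenPartialHomeomorph.trans_source, hθθ']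
  have hmem : ∀ x ∈ (e.trans θ).source, e x ∈ θ.source := fun x hx ↦ by
    rw [OpenPartialHomeomorph.trans_source] at hx
    exact hx.2
  -- The identity p p' + α q·q' = 1 divided by p p'. It gives positivity at once, and its logarithm
  -- is the identity for φ + ψ.
  have hprod : ∀ x ∈ (e.trans θ).source,
      1 + α * ∑ l, e.trans θ x l * e.trans θ' x l = (p (e x))⁻¹ * (p' (e x))⁻¹ := by
    intro x hx
    have hy := hmem x hx
    have hinner : ∑ l, e.trans θ x l * e.trans θ' x l = inner ℝ (θ (e x)) (θ' (e x)) := by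
      rw [PiLp.inner_apply]
      exact Finset.sum_congr rfl fun l _ ↦ by simp [mul_comm]
    have h1 := (hpos _ hy).ne'
    have h2 := (hpos' _ (hθθ' ▸ hy)).ne'
    rw [hinner, hθ _ hy, hθ' _ (hθθ' ▸ hy), real_inner_smul_left, real_inner_smul_right]
    field_simp
    exact hpq _ hy
  refine ⟨e.trans θ, hξ, e.trans θ', hη, ?_, hsource, hξg, hηg, fun x hx ↦ ?_, φ, ψ,
    by rwa [hξt], by rwa [hηt], ?_, ?_, fun x hx ↦ ?_, fun x hx i j ↦
      ⟨hφH x hx i j, hψH x (by rwa [← hsource]) i j⟩⟩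
  · rw [OpenPartialHomeomorph.trans_source]
    exact ⟨hx₀, by rw [mem_preimage, hex₀]; exact hθ0⟩
  · rw [hprod x hx]
    exact mul_pos (inv_pos.2 (hpos _ (hmem x hx))) (inv_pos.2 (hpos' _ (hθθ' ▸ hmem x hx)))
  · rw [hξt, hηt]
    exact fun h ↦ ⟨hφc h, hψc h⟩
  · rw [hξt, hηt]
    exact fun h ↦ ⟨hφc' h, hψc' h⟩
  · have hy := hmem x hx
    have hy' : e x ∈ θ'.source := by rwa [← hθθ']
    rw [hprod x hx, Real.log_mul (inv_pos.2 (hpos _ hy)).ne' (inv_pos.2 (hpos' _ hy')).ne',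
      Real.log_inv, Real.log_inv]
    refine (congrArg₂ (· + ·) (hφp _ hy) (hψp _ hy')).trans ?_
    ring

end ProjectiveCoordinatesOfCurvature

end InfoGeo
end

/-! ### The main theorem. -/

open InfoGeo in
theorem mainTheorem1 {d : ℕ} (hd : 2 ≤ d) {M : Type*} [TopologicalSpace M] [T2Space M]
    [ChartedSpace (EuclideanSpace ℝ (Fin d)) M] [IsManifold (𝓡 d) ∞ M]
    (S : StatisticalStructure d M)
    (hprimal : S.primal.IsProjectivelyFlat) (hdual : S.dual.IsProjectivelyFlat)
    (α : ℝ) (hα : 0 < α) :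
    (S.primal.HasConstantCurvature S.g (-α) → S.dual.HasConstantCurvature S.g (-α) →
      ∀ p : M, ∃ ξ ∈ IsManifold.maximalAtlas (𝓡 d) ∞ M, ∃ η ∈ IsManifold.maximalAtlas (𝓡 d) ∞ M,
        p ∈ ξ.source ∧ ξ.source = η.source ∧
        S.primal.GeodesicsAreLinesIn ξ ∧ S.dual.GeodesicsAreLinesIn η ∧
        (∀ x ∈ ξ.source, 0 < 1 + α * ∑ l, ξ x l * η x l) ∧
        ∃ φ ψ : EuclideanSpace ℝ (Fin d) → ℝ,
          ContDiffOn ℝ ∞ φ ξ.target ∧ ContDiffOn ℝ ∞ ψ η.target ∧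
          ExpConcaveOn α ξ.target φ ∧ ExpConcaveOn α η.target ψ ∧
          (∀ x ∈ ξ.source,
            φ (ξ x) + ψ (η x) = 1 / α * Real.log (1 + α * ∑ l, ξ x l * η x l)) ∧
          (∀ x ∈ ξ.source, ∀ i j : Fin d,
            metricCoeff S.g ξ x i j = -expHessian α φ (ξ x) i j ∧
            metricCoeff S.g η x i j = -expHessian α ψ (η x) i j)) ∧
    (S.primal.HasConstantCurvature S.g α → S.dual.HasConstantCurvature S.g α →
      ∀ p : M, ∃ ξ ∈ IsManifold.maximalAtlas (𝓡 d) ∞ M, ∃ η ∈ IsManifold.maximalAtlas (𝓡 d) ∞ M,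
        p ∈ ξ.source ∧ ξ.source = η.source ∧
        S.primal.GeodesicsAreLinesIn ξ ∧ S.dual.GeodesicsAreLinesIn η ∧
        (∀ x ∈ ξ.source, 0 < 1 + α * ∑ l, ξ x l * η x l) ∧
        ∃ φ ψ : EuclideanSpace ℝ (Fin d) → ℝ,
          ContDiffOn ℝ ∞ φ ξ.target ∧ ContDiffOn ℝ ∞ ψ η.target ∧
          ExpConvexOn α ξ.target φ ∧ ExpConvexOn α η.target ψ ∧
          (∀ x ∈ ξ.source,
            φ (ξ x) + ψ (η x) = 1 / α * Real.log (1 + α * ∑ l, ξ x l * η x l)) ∧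
          (∀ x ∈ ξ.source, ∀ i j : Fin d,
            metricCoeff S.g ξ x i j = expHessian α φ (ξ x) i j ∧
            metricCoeff S.g η x i j = expHessian α ψ (η x) i j)) := by
  -- The two cases are k = -α and k = α, where the factor k/α in the metric formula is -1 and 1.
  refine ⟨fun hcurv _ p ↦ ?_, fun hcurv _ p ↦ ?_⟩
  · obtain ⟨ξ, hξ, η, hη, hp, hs, hg, hg', hpos, φ, ψ, hφ, hψ, hconc, -, hid, hH⟩ :=
      exists_projective_coordinates S hα (neg_ne_zero.2 hα.ne') hcurv p
    refine ⟨ξ, hξ, η, hη, hp, hs, hg, hg', hpos, φ, ψ, hφ, hψ, (hconc (by linarith)).1,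
      (hconc (by linarith)).2, hid, fun x hx i j ↦ ?_⟩
    rw [(hH x hx i j).1, (hH x hx i j).2, neg_div, div_self hα.ne']
    exact ⟨by ring, by ring⟩
  · obtain ⟨ξ, hξ, η, hη, hp, hs, hg, hg', hpos, φ, ψ, hφ, hψ, -, hconv, hid, hH⟩ :=
      exists_projective_coordinates S hα hα.ne' hcurv p
    refine ⟨ξ, hξ, η, hη, hp, hs, hg, hg', hpos, φ, ψ, hφ, hψ, (hconv hα.le).1, (hconv hα.le).2,
      hid, fun x hx i j ↦ ?_⟩
    rw [(hH x hx i j).1, (hH x hx i j).2, div_self hα.ne', one_mul, one_mul]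
    exact ⟨rfl, rfl⟩
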